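/- Let $(r,\sigma)$ be a pair with either $\sigma=-1$, $r\ge 1$, or $\sigma=+1$, $r\ge 3$ ($r$ an integer), and let $\lambda=\frac{r+\sqrt{r^2-4\sigma}}2>1$. Let $\mathbb T^2=\mathbb R^2/\mathbb Z^2$. **Compacta.** For $\sigma=-1$ let $C=\mathfrak X_r$ be the set of sequences $(\varepsilon_n)_{n\in\mathbb Z}$ with $0\le\varepsilon_n\le r$ such that $\varepsilon_n=r$ implies $\varepsilon_{n+1}=0$. For $\sigma=+1$ let $C=\mathfrak Y_r$ be the set of sequences with $0\le\varepsilon_n\le r-1$ which contain no block $(r-1)(r-2)^{j}(r-1)$, $j\ge 0$. Both carry the product topology. **Identifications.** Let $\mathfrak R_1$ (on $\mathfrak X_r$), resp. $\mathfrak R_2$ (on $\mathfrak Y_r$), be the smallest closed equivalence relation that identifies the following pairs of sequences of $C$, where $*$ is one and the same arbitrary tail and corresponding digits stand at the same place: * $\mathfrak R_1$: $(*\,k,r,0,r,0,\dots)\sim(*\,k+1,0,0,0,\dots)$ and $(\dots,0,r,0,r,0,k\,*)\sim(\dots,r,0,r,0,r-1,k+1\,*)$, for $0\le k\le r-1$;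 * $\mathfrak R_2$: $(*\,k,r-1,r-2,r-2,\dots)\sim(*\,k+1,0,0,\dots)$ and $(\dots,r-2,r-2,r-1,k\,*)\sim(\dots,0,0,0,k+1\,*)$, for $0\le k\le r-2$. Let $C'$ be the factor space ($\mathfrak X_r'=\mathfrak X_r/\mathfrak R_1$, resp. $\mathfrak Y_r'=\mathfrak Y_r/\mathfrak R_2$) with the quotient topology, and $[\varepsilon]\in C'$ the class of $\varepsilon\in C$. Say that $z\in C$ is a *two-sided normalization* of a sequence $x\in\mathbb Z_{\ge0}^{\mathbb Z}$ if $\mathbb Z$ can be cut into finite intervals $I_j$, $j\in\mathbb Z$ (in increasing order), such that $\sum_{n\in I_j}x_n\lambda^{-n}=\sum_{n\in I_j}z_n\lambda^{-n}$ for every $j$. **Coding maps.** Let $\widetilde{\mathfrak X}$ be the semigroup of sequences $\varepsilon\in\mathbb Z_{\ge 0}^{\mathbb Z}$ for which $\sum_{n\ge1}\varepsilon_n\lambda^{-n}$ and $\sum_{n\ge1}\varepsilon_{-n}\lambda^{-n}$ converge, with coordinatewise addition, and $(\tau\varepsilon)_n=\varepsilon_{n+1}$ the shift. Let $T$ be an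 automorphism of $\mathbb T^2$ given by an integer $2\times2$ matrix $M$ with trace $r$ and determinant $\sigma$. A *coding map* for $T$ is a map $\varphi:\widetilde{\mathfrak X}\to\mathbb T^2$ with $\varphi(\varepsilon+\varepsilon')=\varphi(\varepsilon)+\varphi(\varepsilon')$ and $\varphi\tau=T\varphi$, whose restriction to each set $\{\varepsilon: \varepsilon_n\le B \text{ for all } n\}$, $B\in\mathbb N$, is continuous in the product topology. An *arithmetic coding* is a coding map that maps $C$ onto $\mathbb T^2$. **Claim.** 1. $C'$ is a compact Hausdorff space, and there is exactly one structure of abelian topological group on $C'$ such that, for all $\varepsilon,\varepsilon',z\in C$: $[\varepsilon]+[\varepsilon']=[z]$ whenever $z$ is a two-sided normalization of $(\varepsilon_n+\varepsilon'_n)_n$; and $-[\varepsilon]=[z]$ whenever $z$ is a two-sided normalization of $(r-\varepsilon_n)_n$ if $\sigma=-1$, resp. of $(2(r-2)-\varepsilon_n)_n$ if $\sigma=+1$. 2. For every $T$ as above and every coding map $\varphi$ for $T$, there is a continuous group homomorphism $\varphi':C'\to\mathbb T^2$ with $\varphi'([\varepsilon])=\varphi(\varepsilon)$ for all $\varepsilon\in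 C$. 3. If moreover $\varphi$ is not identically $\mathbf 0$ on $C$ (in particular, if $\varphi$ is an arithmetic coding), then $\varphi'$ is onto, and there is an integer $K\ge1$ such that every fibre of $\varphi'$ has exactly $K$ elements, and such that $\varphi|_C$ is $K$-to-$1$ almost everywhere: $\#\{\varepsilon\in C:\varphi(\varepsilon)=\varphi'(p)\}=K$ for almost every $p\in C'$ with respect to Haar measure $\mu$ on $C'$, and $\#\{\varepsilon\in C:\varphi(\varepsilon)=x\}=K$ for Lebesgue almost every $x\in\mathbb T^2$. -/

import Mathlib

noncomputable section

namespace ArithCoding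

/-- The two-dimensional torus `ℝ² / ℤ²`, with Lebesgue (= Haar probability) measure `volume`. -/
abbrev Torus : Type := Fin 2 → UnitAddCircle

/-- The endomorphism of the torus given by an integer matrix. -/
def toralMap (M : Matrix (Fin 2) (Fin 2) ℤ) (x : Torus) : Torus :=
  fun i => ∑ j, M i j • x j

/-- The larger eigenvalue `(r + √(r² - 4σ)) / 2` of a matrix of trace `r` and determinant `σ`. -/
def dominantRoot (r : ℕ) (σ : ℤ) : ℝ :=
  ((r : ℝ) + Real.sqrt ((r : ℝ) ^ 2 - 4 * (σ : ℝ))) / 2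

/-- Two-sided sequences of nonnegative integers such that `∑_{n ≥ 1} ε_n lam⁻ⁿ` and
`∑_{n ≥ 1} ε_{-n} lam⁻ⁿ` converge. -/
def primarySpace (lam : ℝ) : Set (ℤ → ℕ) :=
  {ε | Summable (fun n : ℕ => (ε ((n : ℤ) + 1) : ℝ) / lam ^ (n + 1)) ∧
       Summable (fun n : ℕ => (ε (-((n : ℤ) + 1)) : ℝ) / lam ^ (n + 1))}

/-- The two-sided shift, `(τ ε)_n = ε_{n+1}`. -/
def shift (ε : ℤ → ℕ) : ℤ → ℕ := fun n => ε (n + 1)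

/-- `φ`, defined on `primarySpace lam` (its values elsewhere play no role), is a homomorphism of
semigroups into the torus which turns the shift into the toral automorphism of `M`, and is
continuous for coordinatewise convergence along sequences with uniformly bounded digits. -/
structure IsCodingMap (M : Matrix (Fin 2) (Fin 2) ℤ) (lam : ℝ) (φ : (ℤ → ℕ) → Torus) : Prop where
  map_add : ∀ a ∈ primarySpace lam, ∀ b ∈ primarySpace lam, φ (a + b) = φ a + φ b
  map_shift : ∀ a ∈ primarySpace lam, φ (shift a) = toralMap M (φ a)
  continuousOn : ∀ B : ℕ, ContinuousOn φ {ε | ∀ n, ε n ≤ B}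

/-- The Markov compactum: digits `0, …, r`, each digit `r` being followed by `0`. -/
def markovCompactum (r : ℕ) : Set (ℤ → ℕ) :=
  {ε | ∀ n, ε n ≤ r ∧ (ε n = r → ε (n + 1) = 0)}

/-- The sofic compactum (used for `3 ≤ r`): digits `0, …, r - 1`, and no block
`(r-1)(r-2)^j(r-1)` with `j ≥ 0`. -/
def soficCompactum (r : ℕ) : Set (ℤ → ℕ) :=
  {ε | (∀ n, ε n ≤ r - 1) ∧
    ∀ (n : ℤ) (j : ℕ), ¬ (ε n = r - 1 ∧ (∀ i : ℕ, i < j → ε (n + 1 + i) = r - 2) ∧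
      ε (n + 1 + j) = r - 1)}

/-- `(* k, r, 0, r, 0, …) ∼ (* k+1, 0, 0, 0, …)` with `k ≤ r - 1` at place `N`. -/
def MarkovGlueRight (r : ℕ) (a b : ℤ → ℕ) : Prop :=
  ∃ (N : ℤ) (k : ℕ), k < r ∧ (∀ n < N, a n = b n) ∧ a N = k ∧ b N = k + 1 ∧
    (∀ i : ℕ, a (N + 1 + 2 * i) = r ∧ a (N + 2 + 2 * i) = 0) ∧ ∀ n > N, b n = 0

/-- `(… 0, r, 0, r, 0, k *) ∼ (… r, 0, r, 0, r-1, k+1 *)` with `k ≤ r - 1` at place `N`. -/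
def MarkovGlueLeft (r : ℕ) (a b : ℤ → ℕ) : Prop :=
  ∃ (N : ℤ) (k : ℕ), k < r ∧ (∀ n > N, a n = b n) ∧ a N = k ∧ b N = k + 1 ∧
    (∀ i : ℕ, a (N - 1 - 2 * i) = 0 ∧ a (N - 2 - 2 * i) = r) ∧
    b (N - 1) = r - 1 ∧ ∀ i : ℕ, b (N - 2 - 2 * i) = 0 ∧ b (N - 3 - 2 * i) = r

/-- `(* k, r-1, r-2, r-2, …) ∼ (* k+1, 0, 0, 0, …)` with `k ≤ r - 2` at place `N`. -/
def SoficGlueRight (r : ℕ) (a b : ℤ → ℕ) : Prop :=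
  ∃ (N : ℤ) (k : ℕ), k + 2 ≤ r ∧ (∀ n < N, a n = b n) ∧ a N = k ∧ b N = k + 1 ∧
    a (N + 1) = r - 1 ∧ (∀ i : ℕ, a (N + 2 + i) = r - 2) ∧ ∀ n > N, b n = 0

/-- `(… r-2, r-2, r-1, k *) ∼ (… 0, 0, 0, k+1 *)` with `k ≤ r - 2` at place `N`. -/
def SoficGlueLeft (r : ℕ) (a b : ℤ → ℕ) : Prop :=
  ∃ (N : ℤ) (k : ℕ), k + 2 ≤ r ∧ (∀ n > N, a n = b n) ∧ a N = k ∧ b N = k + 1 ∧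
    a (N - 1) = r - 1 ∧ (∀ i : ℕ, a (N - 2 - i) = r - 2) ∧ ∀ n < N, b n = 0

/-- The symbolic compactum attached to trace `r` and determinant `σ`: the Markov compactum for
`σ = -1`, the sofic one for `σ = 1`. -/
def compactum (r : ℕ) (σ : ℤ) : Set (ℤ → ℕ) :=
  if σ = -1 then markovCompactum r else soficCompactum r

/-- The pairs of sequences to be glued. -/
def Glue (r : ℕ) (σ : ℤ) (a b : ℤ → ℕ) : Prop :=
  if σ = -1 then MarkovGlueRight r a b ∨ MarkovGlueLeft r a b
  else SoficGlueRight r a b ∨ SoficGlueLeft r a b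

/-- The smallest closed equivalence relation containing a relation on a topological space. -/
def closedEquivalence {X : Type*} [TopologicalSpace X] (R : X → X → Prop) : Setoid X :=
  sInf {s : Setoid X | (∀ a b, R a b → s a b) ∧ IsClosed {p : X × X | s p.1 p.2}}

/-- The identifications, as an equivalence relation on the compactum: limits of glued sequences
are glued too. -/
def gluing (r : ℕ) (σ : ℤ) : Setoid (compactum r σ) :=
  closedEquivalence fun a b => Glue r σ a b

/-- The factor space of the compactum. -/
def GluedSpace (r : ℕ) (σ : ℤ) : Type := Quotient (gluing r σ)

instance (r : ℕ) (σ : ℤ) : TopologicalSpace (GluedSpace r σ) :=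
  inferInstanceAs (TopologicalSpace (Quotient (gluing r σ)))

instance (r : ℕ) (σ : ℤ) : MeasurableSpace (GluedSpace r σ) := borel _

instance (r : ℕ) (σ : ℤ) : BorelSpace (GluedSpace r σ) := ⟨rfl⟩

/-- The natural projection of the compactum onto its factor space. -/
def proj (r : ℕ) (σ : ℤ) (a : compactum r σ) : GluedSpace r σ := Quotient.mk (gluing r σ) a

/-- `z` is a two-sided (blockwise) normalization of the sequence `x` of nonnegative integers:
`z` lies in the compactum, and `ℤ` can be cut into finite blocks (indexed by `ℤ`) such that on
each block `x` and `z` represent the same number in base `lam = dominantRoot r σ`. -/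
def IsNormalization (r : ℕ) (σ : ℤ) (x z : ℤ → ℕ) : Prop :=
  z ∈ compactum r σ ∧ ∃ c : ℤ → ℤ, StrictMono c ∧ ∀ j : ℤ,
    ∑ n ∈ Finset.Ioc (c j) (c (j + 1)), (x n : ℝ) * dominantRoot r σ ^ (-n) =
    ∑ n ∈ Finset.Ioc (c j) (c (j + 1)), (z n : ℝ) * dominantRoot r σ ^ (-n)

/-- The sequence `r - ε_n` in the Markov case, `2(r-2) - ε_n` in the sofic case; the normalization
of this sequence is to represent `-ε`. (No truncation occurs on the compactum when `3 ≤ r` in the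
sofic case.) -/
def reflect (r : ℕ) (σ : ℤ) (ε : ℤ → ℕ) : ℤ → ℕ :=
  fun n => (if σ = -1 then r else 2 * (r - 2)) - ε n

/-- An abelian group structure on the factor space which is compatible with the topology, and in
which sums and inverses are given by two-sided normalization of the coordinatewise sum and of the
reflected sequence, whenever such a normalization exists. -/
structure IsNormalizationGroup (r : ℕ) (σ : ℤ) (G : AddCommGroup (GluedSpace r σ)) : Prop where
  isTopologicalAddGroup : IsTopologicalAddGroup (GluedSpace r σ)
  proj_add : ∀ a b z : compactum r σ,
    IsNormalization r σ ((a : ℤ → ℕ) + (b : ℤ → ℕ)) z → proj r σ a + proj r σ b = proj r σ z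
  proj_neg : ∀ a z : compactum r σ,
    IsNormalization r σ (reflect r σ a) z → - proj r σ a = proj r σ z

end ArithCoding

end

namespace ArithCoding

/-! The quotient is the torus itself, via one universal coding. The recursion `r q_N - q_{N+1} - σ
q_{N-1} = d_N` (`charOp`) is hyperbolic, so for bounded `d` it has exactly one bounded real
solution, the `potential` of `d`, a convolution with the summable `green`. The potential at the
places 0 and 1, taken modulo 1, is `torusCode`, or `code` on sequences of digits. It is additive, it
is continuous on bounded sequences, and it turns the shift into the companion matrix. A bounded
integer sequence has code 0 exactly when it is `charOp` of a bounded integer sequence, the carry.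
Modulo 1 the code of a finite sequence depends only on its value in base `dominantRoot`, so
normalization preserves codes.

The code maps the compactum onto the torus: finite sequences can be normalized (`exists_normal`), so
the image is a closed subgroup, and it contains arbitrarily small points on both eigenlines
(`code_surjOn`). Two points of the compactum have the same code exactly when they are glued
(`gluing_iff`). For the hard direction, the sharp ℓ¹ norm of `green` confines the carry to `{-1, 0,
1}`, and a combinatorial analysis of such carries produces a short chain of glues and limits of
glues (`SoficCarry.rel`, `MarkovCarry.rel`). Hence the quotient is homeomorphic to the torus
(`gluedHomeo`) and inherits its group law. The law is unique because sums of truncations are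
determined by finite normalization and truncations are dense.

For a coding map `φ`, the points `φ (unitDigit n)` satisfy the recursion on the torus and tend to 0
in both directions, so their coordinates are integer combinations of two translates of `green`
(`exists_coeff`). Therefore `φ = toralMap A ∘ code` on bounded sequences, for an integer matrix `A`
(`exists_eq_toralMap`). If `φ` is nontrivial on the compactum, then `A ≠ 0` intertwines the
companion matrix with `M`, and irreducibility of the characteristic polynomial makes `A`
nonsingular. The number `K` is the order of the kernel of `A`.

Distinct points with the same code involve a sequence with an exceptional tail (zero, or
alternating). Their codes form a null set, since a power of the shift or of its inverse contracts
each family of sequences with zero tail into small neighbourhoods of 0 while preserving measure.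
This gives the almost everywhere statements. -/

/-- The admissible pairs of trace and determinant. -/
def Admissible (r : ℕ) (σ : ℤ) : Prop := (σ = -1 ∧ 1 ≤ r) ∨ (σ = 1 ∧ 3 ≤ r)

/-- The smaller eigenvalue, conjugate to `dominantRoot`. -/
noncomputable def conjRoot (r : ℕ) (σ : ℤ) : ℝ := (r : ℝ) - dominantRoot r σ

/-! ### The two eigenvalues and the Green function of the recursion. -/

section Roots

variable {r : ℕ} {σ : ℤ}

theorem dominantRoot_add_conjRoot : dominantRoot r σ + conjRoot r σ = r := by
  simp [conjRoot]

theorem Admissible.sign_sq (h : Admissible r σ) : (σ : ℝ) * σ = 1 := by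
  rcases h with ⟨rfl, _⟩ | ⟨rfl, _⟩ <;> norm_num

theorem Admissible.discr_pos (h : Admissible r σ) : 0 < (r : ℝ) ^ 2 - 4 * (σ : ℝ) := by
  rcases h with ⟨rfl, hr⟩ | ⟨rfl, hr⟩
  · push_cast; nlinarith [sq_nonneg (r : ℝ)]
  · have : (3 : ℝ) ≤ r := by exact_mod_cast hr
    push_cast; nlinarith

theorem Admissible.dominantRoot_sq (h : Admissible r σ) :
    dominantRoot r σ ^ 2 = r * dominantRoot r σ - σ := by
  have := Real.sq_sqrt h.discr_pos.le
  unfold dominantRoot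
  nlinarith

theorem Admissible.one_lt (h : Admissible r σ) : 1 < dominantRoot r σ := by
  have hs := Real.sq_sqrt h.discr_pos.le
  have hs0 := Real.sqrt_nonneg ((r : ℝ) ^ 2 - 4 * (σ : ℝ))
  unfold dominantRoot
  generalize √((r : ℝ) ^ 2 - 4 * (σ : ℝ)) = s at hs hs0 ⊢
  rcases h with ⟨rfl, hr⟩ | ⟨rfl, hr⟩
  · have h1 : (1 : ℝ) ≤ r := by exact_mod_cast hr
    push_cast at hs
    have : 1 < s := by nlinarith
    linarith
  · have h1 : (3 : ℝ) ≤ r := by exact_mod_cast hr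
    linarith

theorem Admissible.pos (h : Admissible r σ) : 0 < dominantRoot r σ := by
  linarith [h.one_lt]

theorem Admissible.dominantRoot_mul_conjRoot (h : Admissible r σ) :
    dominantRoot r σ * conjRoot r σ = σ := by
  have := h.dominantRoot_sq
  unfold conjRoot
  linarith

theorem Admissible.conjRoot_sq (h : Admissible r σ) :
    conjRoot r σ ^ 2 = r * conjRoot r σ - σ := by
  have := h.dominantRoot_sq
  unfold conjRoot
  linarith

theorem Admissible.abs_conjRoot (h : Admissible r σ) :
    |conjRoot r σ| = (dominantRoot r σ)⁻¹ := by
  have h1 := h.dominantRoot_mul_conjRoot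
  have h2 : |dominantRoot r σ * conjRoot r σ| = 1 := by
    rw [h1]
    rcases h with ⟨rfl, _⟩ | ⟨rfl, _⟩ <;> norm_num
  rw [abs_mul, abs_of_pos h.pos] at h2
  exact eq_inv_of_mul_eq_one_right h2

theorem Admissible.conjRoot_ne_zero (h : Admissible r σ) : conjRoot r σ ≠ 0 := by
  rw [← abs_pos, h.abs_conjRoot]
  exact inv_pos.2 h.pos

theorem Admissible.conjRoot_lt_one (h : Admissible r σ) : conjRoot r σ < 1 :=
  (le_abs_self _).trans_lt (by rw [h.abs_conjRoot]; exact inv_lt_one_of_one_lt₀ h.one_lt)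

theorem Admissible.sub_pos (h : Admissible r σ) :
    0 < dominantRoot r σ - conjRoot r σ := by
  linarith [h.conjRoot_lt_one, h.one_lt]

/-- Powers of a root of the characteristic polynomial satisfy the linear recursion. -/
theorem zpow_rec {x : ℝ} (hx : x ≠ 0) (h : x ^ 2 = r * x - σ) (n : ℤ) :
    (r : ℝ) * x ^ (-n) - x ^ (-(n - 1)) - σ * x ^ (-(n + 1)) = 0 := by
  have h1 : x ^ (-n) = x ^ (-(n + 1)) * x := by
    rw [← zpow_add_one₀ hx]; congr 1; lia
  have h2 : x ^ (-(n - 1)) = x ^ (-(n + 1)) * x ^ 2 := by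
    rw [← zpow_natCast x 2, ← zpow_add₀ hx]; congr 1; lia
  rw [h1, h2, h]; ring

variable (r σ) in
/-- The bounded fundamental solution of the linear recursion. -/
noncomputable def green (n : ℤ) : ℝ :=
  (if 0 ≤ n then dominantRoot r σ ^ (-n) else conjRoot r σ ^ (-n)) /
    (dominantRoot r σ - conjRoot r σ)

theorem green_of_nonneg {n : ℤ} (hn : 0 ≤ n) :
    green r σ n = dominantRoot r σ ^ (-n) / (dominantRoot r σ - conjRoot r σ) := by
  simp [green, hn]

theorem green_of_nonpos {n : ℤ} (hn : n ≤ 0) :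
    green r σ n = conjRoot r σ ^ (-n) / (dominantRoot r σ - conjRoot r σ) := by
  rcases hn.lt_or_eq with hn | rfl
  · simp [green, not_le.2 hn]
  · simp [green]

theorem Admissible.abs_green (h : Admissible r σ) (n : ℤ) :
    |green r σ n| = dominantRoot r σ ^ (-|n|) / (dominantRoot r σ - conjRoot r σ) := by
  have hs := h.sub_pos
  rcases le_total 0 n with hn | hn
  · rw [green_of_nonneg hn, abs_div, abs_of_pos hs, abs_of_nonneg hn,
      abs_of_pos (zpow_pos h.pos _)]
  · rw [green_of_nonpos hn, abs_div, abs_of_pos hs, abs_of_nonpos hn, abs_zpow, h.abs_conjRoot,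
      inv_zpow', neg_neg]

/-- Away from 0 each branch is a geometric solution of the homogeneous recursion. At 0 the left side
is `(r - 2 * conjRoot) / (dominantRoot - conjRoot)`, because `σ / dominantRoot = conjRoot`; this
equals 1 and explains the denominator in `green`. -/
theorem Admissible.green_rec (h : Admissible r σ) (n : ℤ) :
    (r : ℝ) * green r σ n - green r σ (n - 1) - σ * green r σ (n + 1) =
      if n = 0 then 1 else 0 := by
  have hs := h.sub_pos.ne'
  rcases lt_trichotomy n 0 with hn | rfl | hn
  · rw [green_of_nonpos hn.le, green_of_nonpos (by lia), green_of_nonpos (by lia), if_neg hn.ne]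
    have := zpow_rec h.conjRoot_ne_zero h.conjRoot_sq n
    field_simp
    linarith
  · rw [green_of_nonneg le_rfl, green_of_nonpos (by lia), green_of_nonneg (by lia), if_pos rfl]
    have h1 := h.dominantRoot_mul_conjRoot
    have h2 := dominantRoot_add_conjRoot (r := r) (σ := σ)
    have h3 := h.pos.ne'
    norm_num
    rw [← h1]
    field_simp
    linarith
  · rw [green_of_nonneg hn.le, green_of_nonneg (by lia), green_of_nonneg (by lia), if_neg hn.ne']
    have := zpow_rec h.pos.ne' h.dominantRoot_sq n
    field_simp
    linarith

theorem Admissible.hasSum_zpow_neg_abs (h : Admissible r σ) :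
    HasSum (fun n : ℤ => dominantRoot r σ ^ (-|n|))
      ((dominantRoot r σ + 1) / (dominantRoot r σ - 1)) := by
  have h1 := h.one_lt
  have h0 := h.pos
  have hg := hasSum_geometric_of_lt_one (inv_nonneg.2 h.pos.le) (inv_lt_one_of_one_lt₀ h1)
  have := HasSum.of_nat_of_neg_add_one (f := fun n : ℤ => dominantRoot r σ ^ (-|n|))
    (m := (1 - (dominantRoot r σ)⁻¹)⁻¹)
    (m' := (dominantRoot r σ)⁻¹ * (1 - (dominantRoot r σ)⁻¹)⁻¹) ?_ ?_
  · convert this using 1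
    have : dominantRoot r σ - 1 ≠ 0 := by linarith
    field_simp
  · simpa using hg
  · refine (hg.mul_left (dominantRoot r σ)⁻¹).congr_fun fun n => ?_
    have : |(-((n : ℤ) + 1))| = n + 1 := by rw [abs_neg, abs_of_nonneg (by positivity)]
    rw [this, neg_add, zpow_add₀ h0.ne', zpow_neg, zpow_neg_one, zpow_natCast, inv_pow]
    ring

/-- The exact ℓ¹ norm is recorded, not only its finiteness: it is what limits carries to `{-1, 0,
1}`. -/
theorem Admissible.hasSum_abs_green (h : Admissible r σ) :
    HasSum (fun n : ℤ => |green r σ n|) ((dominantRoot r σ + 1) / (dominantRoot r σ - 1) /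
      (dominantRoot r σ - conjRoot r σ)) := by
  simp_rw [h.abs_green]
  exact h.hasSum_zpow_neg_abs.div_const _

theorem Admissible.summable_abs_green (h : Admissible r σ) :
    Summable (fun n : ℤ => |green r σ n|) := h.hasSum_abs_green.summable

theorem Admissible.summable_green_mul (h : Admissible r σ) {d : ℤ → ℝ} {B : ℝ}
    (hd : ∀ n, |d n| ≤ B) (N : ℤ) : Summable (fun n => green r σ (n - N) * d n) := by
  have : Summable (fun n : ℤ => |green r σ (n - N)| * B) :=
    ((Equiv.subRight N).summable_iff.2 h.summable_abs_green).mul_right B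
  refine Summable.of_norm_bounded this fun n => ?_
  rw [Real.norm_eq_abs, abs_mul]
  exact mul_le_mul_of_nonneg_left (hd n) (abs_nonneg _)

variable (r σ) in
/-- The bounded solution `p` of `r p_N - p_{N+1} - σ p_{N-1} = d_N`. -/
noncomputable def potential (d : ℤ → ℝ) (N : ℤ) : ℝ := ∑' n, green r σ (n - N) * d n

variable (σ) in
/-- The operator `q ↦ r q_N - q_{N+1} - σ q_{N-1}`. -/
def charOp {R : Type*} [CommRing R] (r : ℕ) (q : ℤ → R) (N : ℤ) : R :=
  r * q N - q (N + 1) - σ * q (N - 1)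

theorem Admissible.potential_add (h : Admissible r σ) {d e : ℤ → ℝ} {B C : ℝ}
    (hd : ∀ n, |d n| ≤ B) (he : ∀ n, |e n| ≤ C) (N : ℤ) :
    potential r σ (fun n => d n + e n) N = potential r σ d N + potential r σ e N := by
  unfold potential
  rw [← (h.summable_green_mul hd N).tsum_add (h.summable_green_mul he N)]
  simp [mul_add]

theorem potential_mul_left (c : ℝ) (d : ℤ → ℝ) (N : ℤ) :
    potential r σ (fun n => c * d n) N = c * potential r σ d N := by
  unfold potential
  rw [← tsum_mul_left]
  congr 1; ext n; ring

theorem potential_shift (d : ℤ → ℝ) (k N : ℤ) :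
    potential r σ (fun n => d (n + k)) N = potential r σ d (N + k) := by
  unfold potential
  rw [← (Equiv.addRight k).tsum_eq (fun n => green r σ (n - (N + k)) * d n)]
  simp

theorem Admissible.abs_potential_le (h : Admissible r σ) {d : ℤ → ℝ} {B : ℝ}
    (hd : ∀ n, |d n| ≤ B) (N : ℤ) :
    |potential r σ d N| ≤ (dominantRoot r σ + 1) / (dominantRoot r σ - 1) /
      (dominantRoot r σ - conjRoot r σ) * B := by
  have hs : HasSum (fun n : ℤ => |green r σ (n - N)| * B) _ :=
    ((Equiv.subRight N).hasSum_iff.2 h.hasSum_abs_green).mul_right B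
  refine tsum_of_norm_bounded (f := fun n => green r σ (n - N) * d n) hs fun n => ?_
  rw [Real.norm_eq_abs, abs_mul]
  exact mul_le_mul_of_nonneg_left (hd n) (abs_nonneg _)

theorem Admissible.charOp_potential (h : Admissible r σ) {d : ℤ → ℝ} {B : ℝ}
    (hd : ∀ n, |d n| ≤ B) (N : ℤ) : charOp σ r (potential r σ d) N = d N := by
  have hS := fun N => (h.summable_green_mul hd N).hasSum
  have := (((hS N).mul_left (r : ℝ)).sub (hS (N + 1))).sub ((hS (N - 1)).mul_left (σ : ℝ))
  refine this.unique ?_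
  have h0 : HasSum (fun n => if n = N then d N else 0) (d N) := hasSum_ite_eq N (d N)
  refine h0.congr_fun fun n => ?_
  have := h.green_rec (n - N)
  rw [show n - N - 1 = n - (N + 1) by ring, show n - N + 1 = n - (N - 1) by ring] at this
  have h2 := congrArg (· * d n) this
  simp only [sub_eq_zero, ite_mul, one_mul, zero_mul] at h2
  rw [show (if n = N then d N else 0) = if n = N then d n else 0 by
    split_ifs with hh <;> simp [hh], ← h2]
  ring

/-- Convolution commutes with the constant-coefficient operator `charOp`, which reduces this to
`charOp_potential`. In particular a bounded sequence is determined by its image under `charOp`. -/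
theorem Admissible.potential_charOp (h : Admissible r σ) {q : ℤ → ℝ} {B : ℝ}
    (hq : ∀ n, |q n| ≤ B) (N : ℤ) : potential r σ (charOp σ r q) N = q N := by
  have hS := h.summable_green_mul hq
  have e1 : potential r σ (charOp σ r q) N =
      charOp σ r (fun k => potential r σ q k) N := by
    have h1 := potential_shift (r := r) (σ := σ) q 1 N
    have h2 := potential_shift (r := r) (σ := σ) q (-1) N
    have hb1 : ∀ n, |(-1) * q (n + 1)| ≤ B := fun n => by simpa using hq (n + 1)
    have hb2 : ∀ n, |(-σ : ℝ) * q (n + -1)| ≤ |(σ : ℝ)| * B := fun n => by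
      rw [abs_mul, abs_neg]; exact mul_le_mul_of_nonneg_left (hq _) (abs_nonneg _)
    have hb0 : ∀ n, |(r : ℝ) * q n| ≤ |(r : ℝ)| * B := fun n => by
      rw [abs_mul]; exact mul_le_mul_of_nonneg_left (hq _) (abs_nonneg _)
    have hb01 : ∀ n, |(r : ℝ) * q n + (-1) * q (n + 1)| ≤ |(r : ℝ)| * B + B := fun n =>
      (abs_add_le _ _).trans (add_le_add (hb0 n) (hb1 n))
    have e := h.potential_add hb01 hb2 N
    rw [h.potential_add hb0 hb1, potential_mul_left, potential_mul_left, potential_mul_left,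
      h1, h2] at e
    have : charOp σ r q = fun n => (r : ℝ) * q n + (-1) * q (n + 1) + (-σ : ℝ) * q (n + -1) := by
      ext n; simp [charOp]; ring_nf
    rw [this, e]
    simp [charOp]; ring_nf
  rw [e1]
  exact h.charOp_potential hq N

/-- Modulo `1` the fundamental solution is the unstable exponential. -/
theorem Admissible.exists_green_eq (h : Admissible r σ) (n : ℤ) :
    ∃ k : ℤ, green r σ n = dominantRoot r σ ^ (-n) / (dominantRoot r σ - conjRoot r σ) + k := by
  rcases le_total 0 n with hn | hn
  · exact ⟨0, by simp [green_of_nonneg hn]⟩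
  obtain ⟨m, rfl⟩ : ∃ m : ℕ, n = -(m : ℤ) := ⟨n.natAbs, by lia⟩
  have hs := h.sub_pos.ne'
  -- The difference of the two exponentials divided by the difference of the roots is, up to sign, a
  -- Lucas sequence, hence an integer.
  suffices H : ∃ k : ℤ, conjRoot r σ ^ m - dominantRoot r σ ^ m =
      k * (dominantRoot r σ - conjRoot r σ) by
    obtain ⟨k, hk⟩ := H
    refine ⟨k, ?_⟩
    rw [green_of_nonpos hn]
    simp only [neg_neg, zpow_natCast]
    field_simp
    linarith
  induction m using Nat.strong_induction_on with
  | _ m ih =>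
    match m with
    | 0 => exact ⟨0, by simp⟩
    | 1 => exact ⟨-1, by push_cast; ring⟩
    | m + 2 =>
      obtain ⟨k, hk⟩ := ih m (by lia) (by lia)
      obtain ⟨l, hl⟩ := ih (m + 1) (by lia) (by lia)
      refine ⟨r * l - σ * k, ?_⟩
      rw [pow_add, pow_add, h.conjRoot_sq, h.dominantRoot_sq]
      push_cast
      rw [sub_mul, mul_assoc, ← hl, mul_assoc, ← hk]
      ring

end Roots
end ArithCoding

namespace ArithCoding

/-! ### Normalization of finitely supported sequences. -/

section FiniteNormalization

variable {r : ℕ} {σ : ℤ}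

variable (r σ) in
/-- The number represented by a finitely supported sequence in base `dominantRoot r σ`. -/
noncomputable def value : (ℤ →₀ ℕ) →+ ℝ :=
  Finsupp.liftAddHom fun n =>
    (AddMonoidHom.mulRight (dominantRoot r σ ^ (-n))).comp (Nat.castAddMonoidHom ℝ)

theorem value_single (n : ℤ) (k : ℕ) :
    value r σ (Finsupp.single n k) = k * dominantRoot r σ ^ (-n) := by
  simp [value]

theorem value_eq_sum (a : ℤ →₀ ℕ) {s : Finset ℤ} (hs : a.support ⊆ s) :
    value r σ a = ∑ n ∈ s, (a n : ℝ) * dominantRoot r σ ^ (-n) := by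
  simp only [value, Finsupp.liftAddHom_apply]
  rw [Finsupp.sum_of_support_subset _ hs _ (by simp)]
  simp

theorem exists_eq_add_single {a : ℤ →₀ ℕ} {n : ℤ} {k : ℕ} (h : k ≤ a n) :
    ∃ b : ℤ →₀ ℕ, a = b + Finsupp.single n k :=
  ⟨a - Finsupp.single n k, (tsub_add_cancel_of_le (Finsupp.single_le_iff.2 h)).symm⟩

theorem Admissible.value_nonneg (h : Admissible r σ) (a : ℤ →₀ ℕ) : 0 ≤ value r σ a := by
  rw [value_eq_sum a subset_rfl]
  exact Finset.sum_nonneg fun n _ => mul_nonneg (Nat.cast_nonneg _) (zpow_pos h.pos _).le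

theorem Admissible.le_value (h : Admissible r σ) {a : ℤ →₀ ℕ} {n : ℤ} (hn : a n ≠ 0) :
    dominantRoot r σ ^ (-n) ≤ value r σ a := by
  obtain ⟨b, hb⟩ := exists_eq_add_single (a := a) (n := n) (k := 1) (by lia)
  rw [hb, map_add, value_single, Nat.cast_one, one_mul]
  linarith [h.value_nonneg b]

theorem Admissible.zpow_carry (h : Admissible r σ) (n : ℤ) :
    (r : ℝ) * dominantRoot r σ ^ (-n) =
      dominantRoot r σ ^ (-(n - 1)) + σ * dominantRoot r σ ^ (-(n + 1)) := by
  linarith [zpow_rec h.pos.ne' h.dominantRoot_sq n]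

/-- A digit `r - 1` followed by `j` digits `r - 2` can be split off a sequence. -/
theorem exists_split_sofic (h : Admissible r 1) (hr : 3 ≤ r) (a : ℤ →₀ ℕ) (n : ℤ)
    (hn : r - 1 ≤ a n) (j : ℕ) (hj : ∀ i < j, r - 2 ≤ a (n + 1 + i)) :
    ∃ b u : ℤ →₀ ℕ, a = b + u ∧ value r 1 u = dominantRoot r 1 ^ (-(n - 1)) +
      dominantRoot r 1 ^ (-(n + j + 1)) - dominantRoot r 1 ^ (-(n + j)) ∧ r - 1 ≤ u.degree ∧
      ∀ m > n + j, b m = a m := by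
  induction j with
  -- A digit `r - 1` at `n` is worth a unit at `n - 1`, plus a unit at `n + 1`, minus a unit at `n`.
  -- Each further `r - 2` moves the defect pair one place to the right, so the value of the removed
  -- part `u` telescopes.
  | zero =>
    obtain ⟨b, hb⟩ := exists_eq_add_single hn
    refine ⟨b, _, hb, ?_, (Finsupp.degree_single _ _).ge, fun m hm => ?_⟩
    · rw [value_single]
      have := h.zpow_carry n
      push_cast [Nat.cast_sub (show 1 ≤ r by lia)] at this ⊢
      rw [add_zero]
      linarith
    · have : n ≠ m := by simp at hm; lia
      simp [hb, this.symm]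
  | succ j ih =>
    obtain ⟨b, u, rfl, hv, hd, hm⟩ := ih fun i hi => hj i (by lia)
    have := hj j (by lia)
    rw [← hm _ (by lia)] at this
    obtain ⟨c, rfl⟩ := exists_eq_add_single this
    refine ⟨c, Finsupp.single (n + 1 + j) (r - 2) + u, by abel, ?_, ?_, fun m hm' => ?_⟩
    · rw [map_add, hv, value_single]
      have := h.zpow_carry (n + 1 + j)
      push_cast [Nat.cast_sub (show 2 ≤ r by lia)] at this ⊢
      rw [show n + (j + 1) + 1 = n + 1 + j + 1 by ring, show n + (j + 1) = n + 1 + j by ring,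
        show n + j + 1 = n + 1 + (j : ℤ) by ring]
      rw [show n + 1 + (j : ℤ) - 1 = n + j by ring] at this
      linarith
    · rw [map_add]; lia
    · push_cast at hm'
      rw [← hm m (by lia)]
      have : m ≠ n + 1 + j := by lia
      simp [this]

/-- Induction on the digit sum. Both obstructions to normality, a digit at least `r` and a forbidden
block, can be traded for one unit on either side at equal value. Since `r ≥ 3`, each trade lowers
the digit sum. -/
theorem exists_normal_sofic (h : Admissible r 1) (hr : 3 ≤ r) (a : ℤ →₀ ℕ) :
    ∃ z : ℤ →₀ ℕ, ⇑z ∈ soficCompactum r ∧ value r 1 z = value r 1 a := by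
  induction hS : a.degree using Nat.strong_induction_on generalizing a with
  | _ S ih =>
    by_cases ha : ⇑a ∈ soficCompactum r
    · exact ⟨a, ha, rfl⟩
    suffices H : ∃ b : ℤ →₀ ℕ, value r 1 b = value r 1 a ∧ b.degree < S by
      obtain ⟨b, hb, hd⟩ := H
      obtain ⟨z, hz, hv⟩ := ih _ hd b rfl
      exact ⟨z, hz, hv.trans hb⟩
    by_cases hd : ∀ n, a n ≤ r - 1
    · have : ∃ (n : ℤ) (j : ℕ), (a n = r - 1 ∧ (∀ i : ℕ, i < j → a (n + 1 + i) = r - 2) ∧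
          a (n + 1 + j) = r - 1) := by
        by_contra! hcon
        exact ha ⟨hd, fun n j hh => hcon n j hh.1 hh.2.1 hh.2.2⟩
      obtain ⟨n, j, h1, h2, h3⟩ := this
      obtain ⟨b, u, hbu, hv, hu, hm⟩ :=
        exists_split_sofic h hr a n h1.ge j fun i hi => (h2 i hi).ge
      have h4 : r - 1 ≤ b (n + 1 + j) := by rw [hm _ (by lia), h3]
      obtain ⟨c, rfl⟩ := exists_eq_add_single h4
      refine ⟨c + Finsupp.single (n - 1) 1 + Finsupp.single (n + 1 + j + 1) 1, ?_, ?_⟩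
      · simp only [hbu, map_add, value_single, hv]
        have := h.zpow_carry (n + 1 + j)
        push_cast [Nat.cast_sub (show 1 ≤ r by lia)] at this ⊢
        rw [show n + j + 1 = n + 1 + (j : ℤ) by ring]
        rw [show n + 1 + (j : ℤ) - 1 = n + j by ring] at this
        linarith
      · rw [← hS, hbu]
        simp only [map_add, Finsupp.degree_single]
        lia
    · push Not at hd
      obtain ⟨n, hn⟩ := hd
      obtain ⟨b, rfl⟩ := exists_eq_add_single (a := a) (n := n) (k := r) (by lia)
      refine ⟨b + Finsupp.single (n - 1) 1 + Finsupp.single (n + 1) 1, ?_, ?_⟩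
      · simp only [map_add, value_single]
        have := h.zpow_carry n
        push_cast at this ⊢
        linarith
      · rw [← hS]
        simp only [map_add, Finsupp.degree_single]
        lia

/-- The digit sum alone is no termination measure here, since resolving a digit above `r` may leave
it unchanged. The argument is extremal: among representations of minimal digit sum, take the
leftmost place `n` that can be occupied and the largest digit `m` possible there, normalize the
remainder by induction, and put `m` back. The bound on the digit sum is part of the conclusion so
that the remainder cannot grow. -/
theorem exists_normal_markov (h : Admissible r (-1)) (hr : 1 ≤ r) (a : ℤ →₀ ℕ) :
    ∃ z : ℤ →₀ ℕ, ⇑z ∈ markovCompactum r ∧ value r (-1) z = value r (-1) a ∧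
      z.degree ≤ a.degree := by
  induction hS : a.degree using Nat.strong_induction_on generalizing a with
  | _ S ih =>
    by_cases hmin : ∃ b : ℤ →₀ ℕ, value r (-1) b = value r (-1) a ∧ b.degree < S
    · obtain ⟨b, hb, hd⟩ := hmin
      obtain ⟨z, hz, hv, hzd⟩ := ih _ hd b rfl
      exact ⟨z, hz, hv.trans hb, by lia⟩
    push Not at hmin
    rcases Nat.eq_zero_or_pos S with rfl | hpos
    · exact ⟨0, fun n => by simp, by simp [(Finsupp.degree_eq_zero_iff a).1 hS], by simp⟩
    set V := value r (-1) a with hV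
    let P : ℤ → Prop := fun n => ∃ b : ℤ →₀ ℕ, value r (-1) b = V ∧ b.degree = S ∧ b n ≠ 0
    have hP : ∃ n, P n := by
      by_contra! hcon
      have : a = 0 := by
        ext n
        by_contra hn
        exact hcon n ⟨a, rfl, hS, hn⟩
      rw [this, map_zero] at hS
      lia
    have hbdd : ∃ k : ℤ, ∀ n, P n → k ≤ n := by
      -- An occupied place `n` contributes at least `dominantRoot ^ (-n)` to the fixed value `V`, so
      -- it cannot lie arbitrarily far left.
      obtain ⟨k, hk⟩ := pow_unbounded_of_one_lt V h.one_lt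
      refine ⟨-k, fun n ⟨b, hb, _, hn⟩ => ?_⟩
      have h1 := h.le_value hn
      rw [hb] at h1
      by_contra! hlt
      have h2 : dominantRoot r (-1) ^ ((k : ℕ) : ℤ) ≤ dominantRoot r (-1) ^ (-n) :=
        zpow_le_zpow_right₀ h.one_lt.le (by lia)
      rw [zpow_natCast] at h2
      linarith
    obtain ⟨n, hn, hleast⟩ := Int.exists_least_of_bdd hbdd hP
    let Q : ℕ → Prop := fun m => ∃ b : ℤ →₀ ℕ, value r (-1) b = V ∧ b.degree = S ∧ b n = m
    classical
    have hQ : ∀ m, Q m → m ≤ S := by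
      rintro m ⟨b, _, hb, rfl⟩
      rw [← hb]
      exact Finsupp.le_degree n b
    obtain ⟨b₀, hb₀, hb₀S, hb₀n⟩ := hn
    have hQ₀ : Q (b₀ n) := ⟨b₀, hb₀, hb₀S, rfl⟩
    obtain ⟨b, hb, hbS, hbn⟩ := Nat.findGreatest_spec (hQ _ hQ₀) hQ₀
    have hmax : ∀ k, Q k → k ≤ Nat.findGreatest Q S := fun k hk =>
      Nat.le_findGreatest (hQ k hk) hk
    have hm0 : 0 < Nat.findGreatest Q S := lt_of_lt_of_le (by lia) (hmax _ hQ₀)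
    set m := Nat.findGreatest Q S
    obtain ⟨c, rfl⟩ := exists_eq_add_single hbn.ge
    simp only [map_add, Finsupp.degree_single] at hbS hb
    obtain ⟨z, hz, hvz, hdz⟩ := ih c.degree (by lia) c rfl
    have hrep : value r (-1) (z + Finsupp.single n m) = V := by rw [map_add, hvz, hb]
    have hdeg : (z + Finsupp.single n m).degree = S := by
      refine le_antisymm ?_ (hmin _ hrep)
      rw [map_add, Finsupp.degree_single]
      lia
    have hzlt : ∀ k < n, z k = 0 := fun k hk => by
      by_contra hne
      have := hleast k ⟨_, hrep, hdeg, by simp [hne]⟩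
      lia
    have hzn : z n = 0 := by
      have := hmax (z n + m) ⟨_, hrep, hdeg, by simp⟩
      lia
    have hdeg' : z.degree + m = S := by simpa using hdeg
    have hcarry := h.zpow_carry n
    have hcarry' := h.zpow_carry (n + 1)
    -- Otherwise `r` units at `n` and one at `n + 1` merge into a single unit at `n - 1`, lowering
    -- the minimal digit sum.
    have hfollow : r ≤ m → z (n + 1) = 0 := fun hrm => by
      by_contra hne
      obtain ⟨w, rfl⟩ := exists_eq_add_single (a := z) (n := n + 1) (k := 1) (by lia)
      have := hmin (w + Finsupp.single n (m - r) + Finsupp.single (n - 1) 1) ?_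
      · simp only [map_add, Finsupp.degree_single] at this hdeg'
        lia
      · rw [← hrep]
        simp only [map_add, value_single]
        push_cast [Nat.cast_sub hrm] at hcarry ⊢
        linarith
    -- With `r + 1` units at `n`, unfold one of them to the right and merge `r` units with one of
    -- the new units at `n + 1`. This leaves 1 at `n - 1`, `r - 1` at `n + 1` and 1 at `n + 2`: the
    -- digit sum is the same, but `n - 1` is occupied, against the choice of `n`.
    have hmr : m ≤ r := by
      by_contra! hlt
      have := hleast (n - 1) ⟨z + Finsupp.single n (m - r - 1) + Finsupp.single (n - 1) 1 +
        Finsupp.single (n + 1) (r - 1) + Finsupp.single (n + 1 + 1) 1, ?_, ?_, by simp⟩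
      · lia
      · rw [← hrep]
        simp only [map_add, value_single]
        push_cast [Nat.cast_sub hlt.le, Nat.cast_sub (show 1 ≤ m - r by lia),
          Nat.cast_sub hr] at hcarry hcarry' ⊢
        rw [add_sub_cancel_right] at hcarry'
        linarith
      · simp only [map_add, Finsupp.degree_single]
        lia
    refine ⟨z + Finsupp.single n m, fun k => ?_, hrep, hdeg.le⟩
    simp only [Finsupp.add_apply]
    rcases lt_trichotomy k n with hk | rfl | hk
    · rw [hzlt k hk, Finsupp.single_eq_of_ne hk.ne]
      exact ⟨by lia, fun h => by lia⟩
    · rw [hzn, Finsupp.single_eq_same, Finsupp.single_eq_of_ne (by lia)]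
      exact ⟨by lia, fun h => by simpa using hfollow (by lia)⟩
    · rw [Finsupp.single_eq_of_ne hk.ne', Finsupp.single_eq_of_ne (by lia)]
      exact hz k

/-- Every finitely supported sequence has a finite normalization. -/
theorem Admissible.exists_normal (h : Admissible r σ) (a : ℤ →₀ ℕ) :
    ∃ z : ℤ →₀ ℕ, ⇑z ∈ compactum r σ ∧ value r σ z = value r σ a := by
  have h' := h
  rcases h with ⟨rfl, hr⟩ | ⟨rfl, hr⟩
  · obtain ⟨z, hz, hv, -⟩ := exists_normal_markov h' hr a
    exact ⟨z, by simpa [compactum] using hz, hv⟩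
  · obtain ⟨z, hz, hv⟩ := exists_normal_sofic h' hr a
    exact ⟨z, by simpa [compactum] using hz, hv⟩

end FiniteNormalization
end ArithCoding

namespace ArithCoding
open Filter Topology

/-! ### Integer matrices acting on the torus. -/

section ToralMaps

theorem coe_int_eq_zero (k : ℤ) : ((k : ℝ) : UnitAddCircle) = 0 :=
  (AddCircle.coe_eq_zero_iff (1 : ℝ)).2 ⟨k, by simp⟩

theorem coe_int_mul (k : ℤ) (x : ℝ) : ((k * x : ℝ) : UnitAddCircle) = k • (x : UnitAddCircle) := by
  rw [← AddCircle.coe_zsmul, zsmul_eq_mul]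

theorem coe_eq_zero_iff_int (x : ℝ) : (x : UnitAddCircle) = 0 ↔ ∃ k : ℤ, (k : ℝ) = x := by
  rw [AddCircle.coe_eq_zero_iff]
  simp

theorem continuous_toralMap (M : Matrix (Fin 2) (Fin 2) ℤ) : Continuous (toralMap M) := by
  unfold toralMap
  fun_prop

theorem toralMap_apply (M : Matrix (Fin 2) (Fin 2) ℤ) (x : Torus) (i : Fin 2) :
    toralMap M x i = M i 0 • x 0 + M i 1 • x 1 := by
  simp [toralMap, Fin.sum_univ_two]

theorem toralMap_add (M : Matrix (Fin 2) (Fin 2) ℤ) (x y : Torus) :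
    toralMap M (x + y) = toralMap M x + toralMap M y := by
  ext i
  simp only [toralMap_apply, Pi.add_apply, smul_add]
  abel

/-- The toral endomorphism of an integer matrix, as a group homomorphism. -/
def toralHom (M : Matrix (Fin 2) (Fin 2) ℤ) : Torus →+ Torus :=
  AddMonoidHom.mk' (toralMap M) (toralMap_add M)

@[simp] theorem toralHom_apply (M : Matrix (Fin 2) (Fin 2) ℤ) (x : Torus) :
    toralHom M x = toralMap M x := rfl

theorem toralMap_mul (M N : Matrix (Fin 2) (Fin 2) ℤ) (x : Torus) :
    toralMap (M * N) x = toralMap M (toralMap N x) := by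
  ext i
  simp only [toralMap_apply, Matrix.mul_apply, Fin.sum_univ_two, smul_add, smul_smul, add_smul]
  abel

end ToralMaps

/-! ### The universal coding of bounded integer sequences. -/

section TorusCode

variable {r : ℕ} {σ : ℤ}

/-- Two-sided integer sequences bounded by `B`. -/
def boundedSeq (B : ℕ) : Set (ℤ → ℤ) := {d | ∀ n, |d n| ≤ B}

theorem abs_cast_le {B : ℕ} {d : ℤ → ℤ} (hd : d ∈ boundedSeq B) (n : ℤ) :
    |(d n : ℝ)| ≤ B := by
  exact_mod_cast hd n

variable (r σ) in
/-- The universal coding: the potential of a bounded sequence at `0` and `1`, modulo `1`. -/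
noncomputable def torusCode (d : ℤ → ℤ) : Torus :=
  ![((potential r σ (fun n => d n) 0 : ℝ) : UnitAddCircle),
    ((potential r σ (fun n => d n) 1 : ℝ) : UnitAddCircle)]

theorem Admissible.torusCode_add (h : Admissible r σ) {B C : ℕ} {d e : ℤ → ℤ}
    (hd : d ∈ boundedSeq B) (he : e ∈ boundedSeq C) :
    torusCode r σ (d + e) = torusCode r σ d + torusCode r σ e := by
  have := h.potential_add (abs_cast_le hd) (abs_cast_le he)
  ext i
  fin_cases i <;> simp [torusCode, this]

theorem torusCode_neg (d : ℤ → ℤ) : torusCode r σ (-d) = -torusCode r σ d := by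
  have := potential_mul_left (r := r) (σ := σ) (-1) (fun n => d n)
  simp only [neg_one_mul] at this
  ext i
  fin_cases i <;> simp [torusCode, this]

theorem neg_mem_boundedSeq {B : ℕ} {d : ℤ → ℤ} (hd : d ∈ boundedSeq B) : -d ∈ boundedSeq B :=
  fun n => by simpa using hd n

theorem Admissible.torusCode_sub (h : Admissible r σ) {B C : ℕ} {d e : ℤ → ℤ}
    (hd : d ∈ boundedSeq B) (he : e ∈ boundedSeq C) :
    torusCode r σ (d - e) = torusCode r σ d - torusCode r σ e := by
  rw [sub_eq_add_neg, h.torusCode_add hd (neg_mem_boundedSeq he), torusCode_neg, sub_eq_add_neg]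

theorem Admissible.continuousOn_potential (h : Admissible r σ) (B : ℕ) (N : ℤ) :
    ContinuousOn (fun d : ℤ → ℤ => potential r σ (fun n => d n) N) (boundedSeq B) := by
  refine continuousOn_tsum (u := fun n : ℤ => |green r σ (n - N)| * B) (fun n => ?_) ?_ ?_
  · exact (continuous_const.mul (continuous_of_discreteTopology.comp
      (continuous_apply n))).continuousOn
  · exact ((Equiv.subRight N).summable_iff.2 h.summable_abs_green).mul_right _
  · intro n d hd
    rw [Real.norm_eq_abs, abs_mul]
    exact mul_le_mul_of_nonneg_left ((abs_cast_le hd n)) (abs_nonneg _)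

theorem Admissible.continuousOn_torusCode (h : Admissible r σ) (B : ℕ) :
    ContinuousOn (torusCode r σ) (boundedSeq B) := by
  refine continuousOn_pi.2 fun i => ?_
  have hc : Continuous (fun x : ℝ => (x : UnitAddCircle)) := AddCircle.continuous_mk' 1
  fin_cases i
  · exact hc.comp_continuousOn (h.continuousOn_potential B 0)
  · exact hc.comp_continuousOn (h.continuousOn_potential B 1)

theorem Admissible.tendsto_torusCode (h : Admissible r σ) {B : ℕ} {d : ℤ → ℤ}
    {e : ℕ → ℤ → ℤ} (he : ∀ j, e j ∈ boundedSeq B) (hd : d ∈ boundedSeq B)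
    (hlim : ∀ n, ∀ᶠ j in atTop, e j n = d n) :
    Tendsto (fun j => torusCode r σ (e j)) atTop (𝓝 (torusCode r σ d)) := by
  refine Tendsto.comp (h.continuousOn_torusCode B d hd) ?_
  refine tendsto_nhdsWithin_iff.2 ⟨tendsto_pi_nhds.2 fun n => ?_, .of_forall he⟩
  exact tendsto_const_nhds.congr' ((hlim n).mono fun j hj => hj.symm)

/-- A bounded sequence coding `0` is in the image of the characteristic operator. -/
theorem Admissible.exists_potential_eq (h : Admissible r σ) {B : ℕ} {d : ℤ → ℤ}
    (hd : d ∈ boundedSeq B) (h0 : torusCode r σ d = 0) :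
    ∃ q : ℤ → ℤ, (∀ N, (q N : ℝ) = potential r σ (fun n => d n) N) ∧
      ∀ N, d N = charOp σ r q N := by
  set p := potential r σ (fun n => d n) with hp
  have hrec : ∀ N, (r : ℝ) * p N - p (N + 1) - σ * p (N - 1) = d N :=
    fun N => h.charOp_potential (abs_cast_le hd) N
  have hσ := h.sign_sq
  have h00 : ∃ k : ℤ, (k : ℝ) = p 0 := by
    have := congrFun h0 0
    exact (coe_eq_zero_iff_int _).1 this
  have h01 : ∃ k : ℤ, (k : ℝ) = p (0 + 1) := by
    have := congrFun h0 1
    exact (coe_eq_zero_iff_int _).1 this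
  -- Two consecutive integral values propagate in both directions, because the outer coefficients of
  -- the recursion are the units `-1` and `-σ`.
  have key : ∀ N, (∃ k : ℤ, (k : ℝ) = p N) ∧ ∃ k : ℤ, (k : ℝ) = p (N + 1) := by
    intro N
    induction N using Int.induction_on with
    | zero => exact ⟨h00, h01⟩
    | succ N ih =>
      obtain ⟨⟨k, hk⟩, l, hl⟩ := ih
      refine ⟨⟨l, hl⟩, r * l - σ * k - d (N + 1), ?_⟩
      have := hrec (N + 1)
      rw [add_sub_cancel_right] at this
      push_cast
      rw [hk, hl]
      linarith
    | pred N ih =>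
      obtain ⟨⟨k, hk⟩, l, hl⟩ := ih
      refine ⟨⟨σ * (r * k - l - d (-N)), ?_⟩, k, by rw [hk]; congr 1; ring⟩
      have := hrec (-N)
      push_cast
      rw [hk, hl, ← this]
      linear_combination (p (-N - 1)) * hσ
  choose q hq using fun N => (key N).1
  refine ⟨q, hq, fun N => ?_⟩
  have := hrec N
  rw [← hq, ← hq, ← hq] at this
  unfold charOp
  exact_mod_cast this.symm

/-- The image of a bounded integer sequence under the characteristic operator codes `0`. -/
theorem Admissible.torusCode_charOp (h : Admissible r σ) {B : ℕ} {q : ℤ → ℤ}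
    (hq : q ∈ boundedSeq B) : torusCode r σ (charOp σ r q) = 0 := by
  have := h.potential_charOp (abs_cast_le hq)
  have e : (fun n => ((charOp σ r q n : ℤ) : ℝ)) = charOp σ r (fun n => (q n : ℝ)) := by
    ext n; simp [charOp]
  ext i
  fin_cases i
  · simp [torusCode, e, this, coe_int_eq_zero]
  · simp [torusCode, e, this, coe_int_eq_zero]

/-- Modulo 1 each `green` may be replaced by the unstable exponential, so the potential of a finite
sequence is a multiple of its value in base `dominantRoot`. This is the link between normalization
and the torus. -/
theorem Admissible.exists_potential_finset (h : Admissible r σ) (s : Finset ℤ) (d : ℤ → ℤ)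
    (N : ℤ) : ∃ k : ℤ, potential r σ (fun n => ((if n ∈ s then d n else 0 : ℤ) : ℝ)) N =
      dominantRoot r σ ^ N / (dominantRoot r σ - conjRoot r σ) *
        ∑ n ∈ s, (d n : ℝ) * dominantRoot r σ ^ (-n) + k := by
  choose k hk using fun n => h.exists_green_eq (n - N)
  refine ⟨∑ n ∈ s, d n * k n, ?_⟩
  unfold potential
  rw [tsum_eq_sum (s := s) fun n hn => by simp [hn]]
  push_cast
  rw [Finset.mul_sum, ← Finset.sum_add_distrib]
  refine Finset.sum_congr rfl fun n hn => ?_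
  rw [if_pos hn, hk, neg_sub, sub_eq_add_neg, zpow_add₀ h.pos.ne']
  ring

theorem Admissible.torusCode_finset_eq (h : Admissible r σ) (s : Finset ℤ) (d e : ℤ → ℤ)
    (hde : ∑ n ∈ s, (d n : ℝ) * dominantRoot r σ ^ (-n) =
      ∑ n ∈ s, (e n : ℝ) * dominantRoot r σ ^ (-n)) :
    torusCode r σ (fun n => if n ∈ s then d n else 0) =
      torusCode r σ (fun n => if n ∈ s then e n else 0) := by
  have key : ∀ N, ((potential r σ (fun n => ((if n ∈ s then d n else 0 : ℤ) : ℝ)) N : ℝ) :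
      UnitAddCircle) = (potential r σ (fun n => ((if n ∈ s then e n else 0 : ℤ) : ℝ)) N : ℝ) := by
    intro N
    obtain ⟨k, hk⟩ := h.exists_potential_finset s d N
    obtain ⟨l, hl⟩ := h.exists_potential_finset s e N
    rw [hk, hl, hde, AddCircle.coe_add, AddCircle.coe_add, coe_int_eq_zero, coe_int_eq_zero]
  ext i
  fin_cases i
  · exact key 0
  · exact key 1

/-- Modulo 1 the integer digit drops out of the recursion, so consecutive pairs of potentials move
by the companion matrix, of trace `r` and determinant `σ`. -/
theorem Admissible.torusCode_shift (h : Admissible r σ) {B : ℕ} {d : ℤ → ℤ}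
    (hd : d ∈ boundedSeq B) : torusCode r σ (fun n => d (n + 1)) =
      toralMap !![0, 1; -σ, r] (torusCode r σ d) := by
  have h1 := potential_shift (r := r) (σ := σ) (fun n => (d n : ℝ)) 1
  have h2 := h.charOp_potential (abs_cast_le hd) 1
  ext i
  fin_cases i
  · simp [toralMap_apply, torusCode, h1]
  · simp only [charOp, sub_self, one_add_one_eq_two] at h2
    have h3 : potential r σ (fun n => (d n : ℝ)) 2 =
        ((-σ : ℤ) : ℝ) * potential r σ (fun n => (d n : ℝ)) 0
        + ((r : ℤ) : ℝ) * potential r σ (fun n => (d n : ℝ)) 1 - (d 1 : ℤ) := by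
      push_cast; linarith
    have h4 := congrArg (fun x : ℝ => (x : UnitAddCircle)) h3
    simp only [AddCircle.coe_sub, AddCircle.coe_add, coe_int_mul, coe_int_eq_zero, sub_zero] at h4
    simpa [toralMap_apply, torusCode, h1, -neg_smul, -zsmul_eq_mul] using h4

theorem Admissible.torusCode_unshift (h : Admissible r σ) {B : ℕ} {d : ℤ → ℤ}
    (hd : d ∈ boundedSeq B) : torusCode r σ (fun n => d (n - 1)) =
      toralMap !![σ * r, -σ; 1, 0] (torusCode r σ d) := by
  have h1 := potential_shift (r := r) (σ := σ) (fun n => (d n : ℝ)) (-1)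
  simp only [← sub_eq_add_neg] at h1
  have h2 := h.charOp_potential (abs_cast_le hd) 0
  ext i
  fin_cases i
  · simp only [charOp, zero_add, zero_sub] at h2
    have h3 : potential r σ (fun n => (d n : ℝ)) (-1) =
        ((σ * r : ℤ) : ℝ) * potential r σ (fun n => (d n : ℝ)) 0
        + ((-σ : ℤ) : ℝ) * potential r σ (fun n => (d n : ℝ)) 1 - ((σ * d 0 : ℤ) : ℝ) := by
      push_cast
      rw [← h2]
      linear_combination (-potential r σ (fun n => (d n : ℝ)) (-1)) * h.sign_sq
    have h4 := congrArg (fun x : ℝ => (x : UnitAddCircle)) h3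
    simp only [AddCircle.coe_sub, AddCircle.coe_add, coe_int_mul, coe_int_eq_zero, sub_zero] at h4
    simpa [toralMap_apply, torusCode, h1, -neg_smul, -zsmul_eq_mul] using h4
  · simp [toralMap_apply, torusCode, h1]

end TorusCode
end ArithCoding

namespace ArithCoding
open Filter Topology

/-! ### The universal coding on the compactum and its surjectivity. -/

section CompactumCode

variable {r : ℕ} {σ : ℤ}

theorem Admissible.le_of_mem (h : Admissible r σ) {a : ℤ → ℕ} (ha : a ∈ compactum r σ) (n : ℤ) :
    a n ≤ r := by
  rcases h with ⟨rfl, hr⟩ | ⟨rfl, hr⟩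
  · rw [compactum, if_pos rfl] at ha
    exact (ha n).1
  · rw [compactum, if_neg (by norm_num)] at ha
    exact (ha.1 n).trans (by lia)

theorem isClosed_markovCompactum : IsClosed (markovCompactum r) := by
  simp only [markovCompactum, Set.ofPred_forall]
  refine isClosed_iInter fun n => ?_
  exact (isClosed_discrete {p : ℕ × ℕ | p.1 ≤ r ∧ (p.1 = r → p.2 = 0)}).preimage
    (f := fun ε : ℤ → ℕ => (ε n, ε (n + 1))) (by fun_prop)

theorem isClosed_soficCompactum : IsClosed (soficCompactum r) := by
  have heq : ∀ (n : ℤ) (k : ℕ), IsOpen {ε : ℤ → ℕ | ε n = k} := fun n k =>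
    (isOpen_discrete ({k} : Set ℕ)).preimage
      (continuous_apply n : Continuous fun ε : ℤ → ℕ => ε n)
  have h1 : IsClosed {ε : ℤ → ℕ | ∀ n, ε n ≤ r - 1} := by
    simp only [Set.ofPred_forall]
    exact isClosed_iInter fun n =>
      (isClosed_discrete (Set.Iic (r - 1))).preimage
        (continuous_apply n : Continuous fun ε : ℤ → ℕ => ε n)
  have h2 : IsClosed {ε : ℤ → ℕ | ∀ (n : ℤ) (j : ℕ), ¬ (ε n = r - 1 ∧
      (∀ i : ℕ, i < j → ε (n + 1 + i) = r - 2) ∧ ε (n + 1 + j) = r - 1)} := ?_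
  · exact h1.inter h2
  simp only [Set.ofPred_forall]
  refine isClosed_iInter fun n => isClosed_iInter fun j => isOpen_compl_iff.1 ?_
  simp only [Set.compl_ofPred, not_not]
  have h3 : IsOpen {ε : ℤ → ℕ | ∀ i : ℕ, i < j → ε (n + 1 + i) = r - 2} := ?_
  · exact (heq _ _).inter (h3.inter (heq _ _))
  simp only [Set.ofPred_forall]
  exact (Set.finite_lt_nat j).isOpen_biInter fun i _ => heq _ _

theorem isClosed_compactum : IsClosed (compactum r σ) := by
  unfold compactum
  split_ifs
  exacts [isClosed_markovCompactum, isClosed_soficCompactum]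

theorem isCompact_boundedDigits (B : ℕ) : IsCompact {a : ℤ → ℕ | ∀ n, a n ≤ B} := by
  have := isCompact_univ_pi (s := fun _ : ℤ => Set.Iic B) fun _ => (Set.finite_Iic B).isCompact
  convert this using 1
  ext a; simp [Pi.le_def]

theorem Admissible.isCompact_compactum (h : Admissible r σ) : IsCompact (compactum r σ) :=
  (isCompact_boundedDigits r).of_isClosed_subset isClosed_compactum fun _ ha => h.le_of_mem ha

variable (r σ) in
/-- The universal coding of a sequence of digits. -/
noncomputable def code (a : ℤ → ℕ) : Torus := torusCode r σ fun n => (a n : ℤ)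

theorem cast_mem_boundedSeq {B : ℕ} {a : ℤ → ℕ} (ha : ∀ n, a n ≤ B) :
    (fun n => (a n : ℤ)) ∈ boundedSeq B := fun n => by
  simpa using ha n

theorem Admissible.continuousOn_code (h : Admissible r σ) (B : ℕ) :
    ContinuousOn (code r σ) {a | ∀ n, a n ≤ B} := by
  refine (h.continuousOn_torusCode B).comp (Continuous.continuousOn ?_)
    fun a ha => cast_mem_boundedSeq ha
  exact continuous_pi fun n => continuous_of_discreteTopology.comp (continuous_apply n)

theorem Admissible.code_add (h : Admissible r σ) {B C : ℕ} {a b : ℤ → ℕ}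
    (ha : ∀ n, a n ≤ B) (hb : ∀ n, b n ≤ C) :
    code r σ (a + b) = code r σ a + code r σ b := by
  unfold code
  rw [← h.torusCode_add (cast_mem_boundedSeq ha) (cast_mem_boundedSeq hb)]
  congr 1

/-- The restriction of a sequence to a finite set of places. -/
noncomputable def restrict (s : Finset ℤ) (a : ℤ → ℕ) : ℤ →₀ ℕ :=
  Finsupp.onFinset s (fun n => if n ∈ s then a n else 0) fun n hn => by
    by_contra hs; simp [hs] at hn

theorem restrict_apply (s : Finset ℤ) (a : ℤ → ℕ) (n : ℤ) :
    restrict s a n = if n ∈ s then a n else 0 := rfl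

theorem restrict_le (s : Finset ℤ) (a : ℤ → ℕ) (n : ℤ) : restrict s a n ≤ a n := by
  rw [restrict_apply]; split_ifs <;> simp

/-- Every forbidden pattern consists of positive digits (here `r ≥ 3` matters in the sofic case), so
replacing digits by 0 creates none. -/
theorem Admissible.restrict_mem (h : Admissible r σ) {a : ℤ → ℕ} (ha : a ∈ compactum r σ)
    (s : Finset ℤ) : ⇑(restrict s a) ∈ compactum r σ := by
  rcases h with ⟨rfl, hr⟩ | ⟨rfl, hr⟩
  · rw [compactum, if_pos rfl] at *
    intro n
    refine ⟨(restrict_le s a n).trans (ha n).1, fun hn => ?_⟩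
    have h1 := restrict_le s a n
    have h2 := restrict_le s a (n + 1)
    have := (ha n).2 (by have := (ha n).1; lia)
    lia
  · rw [compactum, if_neg (by norm_num)] at *
    refine ⟨fun n => (restrict_le s a n).trans (ha.1 n), fun n j hj => ha.2 n j ?_⟩
    have key : ∀ m k, restrict s a m = k → 0 < k → a m = k := fun m k hm hk => by
      rw [restrict_apply] at hm
      split_ifs at hm with hs <;> lia
    exact ⟨key _ _ hj.1 (by lia), fun i hi => key _ _ (hj.2.1 i hi) (by lia),
      key _ _ hj.2.2 (by lia)⟩

theorem tendsto_restrict (a : ℤ → ℕ) :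
    Tendsto (fun j : ℕ => (⇑(restrict (Finset.Icc (-j : ℤ) j) a) : ℤ → ℕ)) atTop (𝓝 a) := by
  refine tendsto_pi_nhds.2 fun n => tendsto_const_nhds.congr' ?_
  filter_upwards [eventually_ge_atTop n.natAbs] with j hj
  rw [restrict_apply, if_pos (Finset.mem_Icc.2 (by lia))]

theorem Admissible.tendsto_code (h : Admissible r σ) {B : ℕ} {a : ℤ → ℕ} {e : ℕ → ℤ → ℕ}
    (he : ∀ j n, e j n ≤ B) (ha : ∀ n, a n ≤ B) (hlim : Tendsto e atTop (𝓝 a)) :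
    Tendsto (fun j => code r σ (e j)) atTop (𝓝 (code r σ a)) :=
  (h.continuousOn_code B a ha).tendsto.comp (tendsto_nhdsWithin_iff.2 ⟨hlim, .of_forall he⟩)

theorem Admissible.code_eq_of_value_eq (h : Admissible r σ) {a b : ℤ →₀ ℕ}
    (hab : value r σ a = value r σ b) : code r σ a = code r σ b := by
  have h1 := value_eq_sum (r := r) (σ := σ) a (s := a.support ∪ b.support)
    Finset.subset_union_left
  have h2 := value_eq_sum (r := r) (σ := σ) b (s := a.support ∪ b.support)
    Finset.subset_union_right
  have := h.torusCode_finset_eq (a.support ∪ b.support) (fun n => (a n : ℤ)) (fun n => (b n : ℤ))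
    (by push_cast; rw [← h1, ← h2, hab])
  unfold code
  convert this using 2
  · ext n
    by_cases hn : n ∈ a.support ∪ b.support
    · simp [hn]
    · have h0 : a n = 0 := by simp at hn; exact hn.1
      simp [hn, h0]
  · ext n
    by_cases hn : n ∈ a.support ∪ b.support
    · simp [hn]
    · have h0 : b n = 0 := by simp at hn; exact hn.2
      simp [hn, h0]

theorem Admissible.isClosed_image_code (h : Admissible r σ) :
    IsClosed (code r σ '' compactum r σ) :=
  (h.isCompact_compactum.image_of_continuousOn
    ((h.continuousOn_code r).mono fun _ ha => h.le_of_mem ha)).isClosed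

/-- Every bounded sequence of digits has the same code as an element of the compactum. -/
theorem Admissible.code_mem_image (h : Admissible r σ) {B : ℕ} {x : ℤ → ℕ} (hx : ∀ n, x n ≤ B) :
    code r σ x ∈ code r σ '' compactum r σ := by
  refine h.isClosed_image_code.mem_of_tendsto (h.tendsto_code
    (fun j n => (restrict_le _ x n).trans (hx n)) hx (tendsto_restrict x)) (.of_forall fun j => ?_)
  obtain ⟨z, hz, hv⟩ := h.exists_normal (restrict (Finset.Icc (-j : ℤ) j) x)
  exact ⟨z, hz, h.code_eq_of_value_eq hv⟩

theorem sum_Ioc_blocks {c : ℤ → ℤ} (hc : StrictMono c) {f g : ℤ → ℝ}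
    (hfg : ∀ j, ∑ n ∈ Finset.Ioc (c j) (c (j + 1)), f n = ∑ n ∈ Finset.Ioc (c j) (c (j + 1)), g n)
    (i : ℤ) (j : ℕ) : ∑ n ∈ Finset.Ioc (c i) (c (i + j)), f n =
      ∑ n ∈ Finset.Ioc (c i) (c (i + j)), g n := by
  induction j with
  | zero => simp
  | succ j ih =>
    have h1 : c i ≤ c (i + j) := hc.monotone (by lia)
    have h2 : c (i + j) ≤ c (i + j + 1) := hc.monotone (by lia)
    have hdis := Finset.Ioc_disjoint_Ioc_of_le (a := c i) (d := c (i + j + 1))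
      (le_refl (c (i + j)))
    have hun := Finset.Ioc_union_Ioc_eq_Ioc h1 h2
    push_cast
    rw [← add_assoc, ← hun, Finset.sum_union hdis, Finset.sum_union hdis, ih, hfg]

/-- Over any finite union of consecutive blocks the two truncations have equal value, hence equal
code. The blocks exhaust `ℤ`, and the code is continuous on bounded sequences. -/
theorem Admissible.code_eq_of_isNormalization (h : Admissible r σ) {B : ℕ} {x z : ℤ → ℕ}
    (hx : ∀ n, x n ≤ B) (hz : IsNormalization r σ x z) : code r σ x = code r σ z := by
  obtain ⟨hzC, c, hc, hcj⟩ := hz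
  set s : ℕ → Finset ℤ := fun j => Finset.Ioc (c (-j)) (c (-j + (2 * j : ℕ)))
  have hlim : ∀ y : ℤ → ℕ, Tendsto (fun j => (⇑(restrict (s j) y) : ℤ → ℕ)) atTop (𝓝 y) := by
    intro y
    refine tendsto_pi_nhds.2 fun n => tendsto_const_nhds.congr' ?_
    have key : ∀ j : ℕ, c 0 + j ≤ c j ∧ c (-j) ≤ c 0 - j := by
      intro j
      induction j with
      | zero => simp
      | succ j ih =>
        have h1 : c j < c ((j + 1 : ℕ) : ℤ) := hc (by lia)
        have h2 : c (-(j + 1 : ℕ) : ℤ) < c (-j) := hc (by lia)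
        push_cast at *
        lia
    filter_upwards [eventually_gt_atTop (n - c 0).natAbs] with j hj
    have := key j
    rw [restrict_apply, if_pos (Finset.mem_Ioc.2 ?_)]
    rw [show (-j + (2 * j : ℕ) : ℤ) = j by push_cast; ring]
    lia
  have e1 := h.tendsto_code (fun j n => (restrict_le _ x n).trans (hx n)) hx (hlim x)
  have e2 := h.tendsto_code (fun j n => (restrict_le _ z n).trans (h.le_of_mem hzC n))
    (h.le_of_mem hzC) (hlim z)
  refine tendsto_nhds_unique e1 (e2.congr fun j => (h.code_eq_of_value_eq ?_).symm)
  have := sum_Ioc_blocks hc hcj (-j) (2 * j)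
  rw [value_eq_sum (s := s j) (restrict (s j) x) Finsupp.support_onFinset_subset,
    value_eq_sum (s := s j) (restrict (s j) z) Finsupp.support_onFinset_subset]
  refine Eq.trans (Finset.sum_congr rfl fun n hn => ?_) (this.trans
    (Finset.sum_congr rfl fun n hn => ?_)) <;> rw [restrict_apply, if_pos hn]

theorem Admissible.reflect_add (h : Admissible r σ) {a : ℤ → ℕ} (ha : a ∈ compactum r σ) :
    reflect r σ a + a = fun _ => if σ = -1 then r else 2 * (r - 2) := by
  ext n
  rcases h with ⟨rfl, hr⟩ | ⟨rfl, hr⟩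
  · rw [compactum, if_pos rfl] at ha
    have := (ha n).1
    simp [reflect]; lia
  · rw [compactum, if_neg (by norm_num)] at ha
    have := ha.1 n
    simp [reflect]; lia

/-- The constant is `charOp` of the constant 1 in the Markov case and of the constant 2 in the sofic
case. This is why reflection represents the inverse. -/
theorem Admissible.code_const (h : Admissible r σ) :
    code r σ (fun _ => if σ = -1 then r else 2 * (r - 2)) = 0 := by
  rcases h.imp id id with ⟨rfl, hr⟩ | ⟨rfl, hr⟩
  · have := h.torusCode_charOp (q := fun _ => 1) (B := 1) (fun n => by simp)
    rw [← this]
    unfold code; congr 1; ext n; simp [charOp]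
  · have := h.torusCode_charOp (q := fun _ => 2) (B := 2) (fun n => by simp)
    rw [← this]
    unfold code; congr 1; ext n
    simp [charOp]; lia

theorem reflect_le (a : ℤ → ℕ) (n : ℤ) : reflect r σ a n ≤ 2 * r := by
  unfold reflect; split_ifs <;> lia

theorem Admissible.code_reflect (h : Admissible r σ) {a : ℤ → ℕ} (ha : a ∈ compactum r σ) :
    code r σ (reflect r σ a) = -code r σ a := by
  have := h.code_add (reflect_le (r := r) (σ := σ) a) (h.le_of_mem ha)
  rw [h.reflect_add ha, h.code_const] at this
  exact eq_neg_of_add_eq_zero_left this.symm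

variable (r σ) in
/-- The subgroup of all codes. -/
def codeSubgroup (h : Admissible r σ) : AddSubgroup Torus where
  carrier := code r σ '' compactum r σ
  zero_mem' := by
    rw [← h.code_const]
    exact h.code_mem_image (B := 2 * r) fun n => by split_ifs <;> lia
  add_mem' := by
    rintro _ _ ⟨a, ha, rfl⟩ ⟨b, hb, rfl⟩
    rw [← h.code_add (h.le_of_mem ha) (h.le_of_mem hb)]
    exact h.code_mem_image (B := r + r) fun n =>
      add_le_add (h.le_of_mem ha n) (h.le_of_mem hb n)
  neg_mem' := by
    rintro _ ⟨a, ha, rfl⟩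
    rw [← h.code_reflect ha]
    exact h.code_mem_image (reflect_le a)

/-- The unit digit at place `n`. -/
noncomputable def unitDigit (n : ℤ) : ℤ → ℕ := Pi.single n 1

theorem unitDigit_le (n m : ℤ) : unitDigit n m ≤ 1 := by
  unfold unitDigit
  rw [Pi.single_apply]
  split_ifs <;> lia

theorem code_unitDigit (n : ℤ) : code r σ (unitDigit n) =
    ![((green r σ n : ℝ) : UnitAddCircle), ((green r σ (n - 1) : ℝ) : UnitAddCircle)] := by
  have : ∀ N, potential r σ (fun m => (((unitDigit n m : ℕ) : ℤ) : ℝ)) N = green r σ (n - N) := by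
    intro N
    unfold potential
    rw [tsum_eq_single n fun m hm => by simp [unitDigit, hm]]
    simp [unitDigit]
  simp only [code, torusCode, this, sub_zero]

/-- The error of the integer multiple is less than one step `y n` in absolute value. -/
theorem tendsto_floor_div_mul {y : ℕ → ℝ} (hy0 : ∀ n, y n ≠ 0) (hy : Tendsto y atTop (𝓝 0))
    (s : ℝ) : Tendsto (fun n => (⌊s / y n⌋ : ℝ) * y n) atTop (𝓝 s) := by
  rw [tendsto_iff_norm_sub_tendsto_zero]
  refine squeeze_zero (fun _ => norm_nonneg _) (fun n => ?_)
    (tendsto_zero_iff_norm_tendsto_zero.1 hy)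
  have h1 : (⌊s / y n⌋ : ℝ) * y n - s = -(Int.fract (s / y n) * y n) := by
    have : s / y n * y n = s := div_mul_cancel₀ _ (hy0 n)
    have h2 := Int.self_sub_floor (s / y n)
    rw [← h2]; linear_combination this
  rw [h1, norm_neg, norm_mul, Real.norm_eq_abs, abs_of_nonneg (Int.fract_nonneg _)]
  exact mul_le_of_le_one_left (norm_nonneg _) (Int.fract_lt_one _).le

/-- The compactum is mapped onto the torus. -/
theorem Admissible.code_surjOn (h : Admissible r σ) (x : Torus) :
    ∃ a ∈ compactum r σ, code r σ a = x := by
  suffices H : x ∈ codeSubgroup r σ h from H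
  obtain ⟨X, hX⟩ := QuotientAddGroup.mk_surjective (x 0)
  obtain ⟨Y, hY⟩ := QuotientAddGroup.mk_surjective (x 1)
  have hs := h.sub_pos
  set l := dominantRoot r σ with hl
  set m := conjRoot r σ with hm
  -- Coordinates of a lift of `x` in the eigenbasis of the companion matrix: `(X, Y) = s (1, l) + t
  -- (1, m)`.
  set s := (Y - m * X) / (l - m) with hs'
  set t := (l * X - Y) / (l - m) with ht'
  have hst : s + t = X := by rw [hs', ht']; field_simp; ring
  have hst' : l * s + m * t = Y := by rw [hs', ht']; field_simp; ring
  set y : ℕ → ℝ := fun n => l⁻¹ ^ (n + 1) / (l - m) with hy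
  set w : ℕ → ℝ := fun n => m ^ n / (l - m) with hw
  have hy0 : Tendsto y atTop (𝓝 0) := by
    have := ((tendsto_pow_atTop_nhds_zero_of_lt_one (inv_nonneg.2 h.pos.le)
      (inv_lt_one_of_one_lt₀ h.one_lt)).comp (tendsto_add_atTop_nat 1)).div_const (l - m)
    simpa only [Function.comp_def, zero_div] using this
  have hw0 : Tendsto w atTop (𝓝 0) := by
    have := (tendsto_pow_atTop_nhds_zero_of_abs_lt_one (r := m)
      (by rw [h.abs_conjRoot]; exact inv_lt_one_of_one_lt₀ h.one_lt)).div_const (l - m)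
    simpa using this
  have hl0 := h.pos.ne'
  have hyne : ∀ n, y n ≠ 0 := fun n => div_ne_zero (pow_ne_zero _ (inv_ne_zero hl0)) hs.ne'
  have hwne : ∀ n, w n ≠ 0 := fun n => div_ne_zero (pow_ne_zero _ h.conjRoot_ne_zero) hs.ne'
  have hcy : ∀ n : ℕ, code r σ (unitDigit (n + 1)) =
      ![((y n : ℝ) : UnitAddCircle), ((l * y n : ℝ) : UnitAddCircle)] := by
    intro n
    rw [code_unitDigit, green_of_nonneg (by lia), green_of_nonneg (by lia), add_sub_cancel_right,
      ← hl, ← hm]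
    have e1 : l ^ (-((n : ℤ) + 1)) = l⁻¹ ^ (n + 1) := by
      rw [zpow_neg, inv_pow]; norm_cast
    have e2 : l ^ (-(n : ℤ)) = l * l⁻¹ ^ (n + 1) := by
      rw [zpow_neg, zpow_natCast, pow_succ, inv_pow, mul_left_comm, mul_inv_cancel₀ hl0, mul_one]
    rw [e1, e2, mul_div_assoc]
  have hcw : ∀ n : ℕ, code r σ (unitDigit (-n)) =
      ![((w n : ℝ) : UnitAddCircle), ((m * w n : ℝ) : UnitAddCircle)] := by
    intro n
    rw [code_unitDigit, green_of_nonpos (by lia), green_of_nonpos (by lia), ← hl, ← hm]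
    have e1 : m ^ (-(-(n : ℤ))) = m ^ n := by simp
    have e2 : m ^ (-(-(n : ℤ) - 1)) = m * m ^ n := by
      rw [neg_sub, sub_neg_eq_add, zpow_add₀ h.conjRoot_ne_zero, zpow_one, zpow_natCast]
    rw [e1, e2, mul_div_assoc]
  have hmem : ∀ n, code r σ (unitDigit n) ∈ codeSubgroup r σ h := fun n =>
    h.code_mem_image (unitDigit_le n)
  have hc : Continuous (fun x : ℝ => (x : UnitAddCircle)) := AddCircle.continuous_mk' 1
  have hA := tendsto_floor_div_mul hyne hy0 s
  have hB := tendsto_floor_div_mul hwne hw0 t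
  have hlim : Tendsto (fun n : ℕ => ⌊s / y n⌋ • code r σ (unitDigit (n + 1)) +
      ⌊t / w n⌋ • code r σ (unitDigit (-n))) atTop (𝓝 x) := by
    refine tendsto_pi_nhds.2 fun i => ?_
    fin_cases i
    · have := (hc.tendsto _).comp (hA.add hB)
      rw [hst] at this
      refine Tendsto.congr (fun n => ?_) (this.trans_eq (congrArg 𝓝 hX))
      simp only [Function.comp_apply, hcy, hcw, Pi.add_apply, Pi.smul_apply, AddCircle.coe_add,
        coe_int_mul]
      rfl
    · have := (hc.tendsto _).comp ((hA.const_mul l).add (hB.const_mul m))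
      rw [hst'] at this
      refine Tendsto.congr (fun n => ?_) (this.trans_eq (congrArg 𝓝 hY))
      simp only [Function.comp_apply, hcy, hcw, Pi.add_apply, Pi.smul_apply, AddCircle.coe_add,
        mul_left_comm _ (Int.cast _ : ℝ), coe_int_mul]
      rfl
  exact h.isClosed_image_code.mem_of_tendsto hlim (.of_forall fun n =>
    (codeSubgroup r σ h).add_mem ((codeSubgroup r σ h).zsmul_mem (hmem _) _)
      ((codeSubgroup r σ h).zsmul_mem (hmem _) _))

end CompactumCode
end ArithCoding

namespace ArithCoding
open Filter Topology

/-- An equivalence relation on a set of sequences that contains the pairs to be glued and is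
closed under limits. -/
structure IsClosedGluing (C : Set (ℤ → ℕ)) (g R : (ℤ → ℕ) → (ℤ → ℕ) → Prop) : Prop where
  refl : ∀ a ∈ C, R a a
  symm : ∀ a b, R a b → R b a
  trans : ∀ a b c, R a b → R b c → R a c
  glue : ∀ a ∈ C, ∀ b ∈ C, g a b → R a b
  lim : ∀ (u v : ℕ → ℤ → ℕ) (a b : ℤ → ℕ), a ∈ C → b ∈ C → (∀ j, R (u j) (v j)) →
    Tendsto u atTop (𝓝 a) → Tendsto v atTop (𝓝 b) → R a b

/-! ### Carries in the sofic compactum and the glues they produce. -/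

section Sofic

variable {r : ℕ}

/-- Two elements of the sofic compactum whose difference is the image of a sequence with values in
`{-1, 0, 1}` under the characteristic operator. -/
structure SoficCarry (r : ℕ) (a b : ℤ → ℕ) (q : ℤ → ℤ) : Prop where
  hr : 3 ≤ r
  left_mem : a ∈ soficCompactum r
  right_mem : b ∈ soficCompactum r
  abs_le : ∀ n, -1 ≤ q n ∧ q n ≤ 1
  sub_eq : ∀ n, (a n : ℤ) - b n = r * q n - q (n + 1) - q (n - 1)

theorem SoficCarry.symm {a b : ℤ → ℕ} {q : ℤ → ℤ} (h : SoficCarry r a b q) :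
    SoficCarry r b a (-q) where
  hr := h.hr
  left_mem := h.right_mem
  right_mem := h.left_mem
  abs_le n := by have := h.abs_le n; simp only [Pi.neg_apply]; lia
  sub_eq n := by
    have := h.sub_eq n
    simp only [Pi.neg_apply]
    linear_combination -this

/-- If all intermediate digits were at least `r - 2`, the first `r - 1` after `n` would close a
forbidden block. -/
theorem exists_lt_of_mem_sofic {a : ℤ → ℕ} (ha : a ∈ soficCompactum r) {n m : ℤ} (hnm : n < m)
    (hn : a n = r - 1) (hm : a m = r - 1) : ∃ k, n < k ∧ k < m ∧ a k < r - 2 := by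
  by_contra! hcon
  obtain ⟨j, hj⟩ : ∃ j : ℕ, m = n + 1 + j := ⟨(m - n - 1).toNat, by lia⟩
  induction j using Nat.strong_induction_on generalizing m with
  | _ j ih =>
    by_cases hall : ∀ i : ℕ, i < j → a (n + 1 + i) = r - 2
    · exact ha.2 n j ⟨hn, hall, hj ▸ hm⟩
    · push Not at hall
      obtain ⟨i, hi, hne⟩ := hall
      have h1 := hcon (n + 1 + i) (by lia) (by lia)
      have h2 := ha.1 (n + 1 + i)
      exact ih i hi (show n < n + 1 + i by lia) (by lia) (fun k hk hk' => hcon k hk (by lia)) rfl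

/-- Time reversal of a two-sided sequence. -/
def reverse {α : Type*} (a : ℤ → α) : ℤ → α := fun n => a (-n)

theorem reverse_mem_sofic {a : ℤ → ℕ} (ha : a ∈ soficCompactum r) :
    reverse a ∈ soficCompactum r := by
  refine ⟨fun n => ha.1 (-n), fun n j hj => ha.2 (-(n + 1 + j)) j ⟨hj.2.2, fun i hi => ?_, ?_⟩⟩
  · have := hj.2.1 (j - 1 - i) (by lia)
    rw [← this, reverse]
    congr 1
    lia
  · rw [← hj.1, reverse]
    congr 1
    lia

theorem SoficCarry.reverse {a b : ℤ → ℕ} {q : ℤ → ℤ} (h : SoficCarry r a b q) :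
    SoficCarry r (reverse a) (reverse b) (reverse q) where
  hr := h.hr
  left_mem := reverse_mem_sofic h.left_mem
  right_mem := reverse_mem_sofic h.right_mem
  abs_le n := h.abs_le (-n)
  sub_eq n := by
    have := h.sub_eq (-n)
    simp only [ArithCoding.reverse]
    rw [this, show -(n + 1) = -n - 1 by ring, show -(n - 1) = -n + 1 by ring]
    ring

namespace SoficCarry

variable {a b : ℤ → ℕ} {q : ℤ → ℤ}

/-- The difference of digits is at most `r - 1`, so the carries on the two sides add up to at least
1. -/
theorem neighbors (h : SoficCarry r a b q) {n : ℤ} (hn : q n = 1) :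
    (q (n - 1) = 1 ∧ q (n + 1) = 1 ∧ (a n : ℤ) = b n + r - 2) ∨
    (q (n - 1) = 1 ∧ q (n + 1) = 0 ∧ a n = r - 1 ∧ b n = 0) ∨
    (q (n - 1) = 0 ∧ q (n + 1) = 1 ∧ a n = r - 1 ∧ b n = 0) := by
  have h1 := h.sub_eq n
  have h2 := h.abs_le (n - 1)
  have h3 := h.abs_le (n + 1)
  have h4 := h.left_mem.1 n
  have := h.hr
  rw [hn] at h1
  lia

theorem le_of_one (h : SoficCarry r a b q) {n : ℤ} (hn : q n = 1) : r - 2 ≤ a n := by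
  have := h.hr
  rcases h.neighbors hn with h1 | h1 | h1 <;> lia

/-- A finite run of ones has digits `r - 1` of `a` at both ends and digits at least `r - 2` between
them, which the compactum excludes. A run of length one already violates `neighbors`. -/
theorem right_run (h : SoficCarry r a b q) {n : ℤ} (hn : q n = 1) (hn' : q (n - 1) = 0) :
    ∀ m, n ≤ m → q m = 1 := by
  have key : ∀ j : ℕ, ∀ i : ℕ, i ≤ j → q (n + i) = 1 := by
    intro j
    induction j with
    | zero => intro i hi; obtain rfl : i = 0 := by lia
              simpa using hn
    | succ j ih =>
      intro i hi
      rcases hi.lt_or_eq with hi | rfl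
      · exact ih i (by lia)
      by_contra hne
      push_cast at hne
      rw [← add_assoc] at hne
      have hj := ih j le_rfl
      have h0 := h.neighbors hn
      have h1 := h.neighbors hj
      have hj0 : j ≠ 0 := by
        rintro rfl
        simp only [Nat.cast_zero, add_zero] at hne
        lia
      obtain ⟨k, hk1, hk2, hk3⟩ := exists_lt_of_mem_sofic h.left_mem (n := n) (m := n + j)
        (by lia) (by lia) (by lia)
      obtain ⟨i, rfl⟩ : ∃ i : ℕ, k = n + i := ⟨(k - n).toNat, by lia⟩
      have := h.le_of_one (ih i (by lia))
      lia
  intro m hm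
  obtain ⟨i, rfl⟩ : ∃ i : ℕ, m = n + i := ⟨(m - n).toNat, by lia⟩
  exact key i i le_rfl

theorem left_run (h : SoficCarry r a b q) {n : ℤ} (hn : q n = 1) (hn' : q (n + 1) = 0) :
    ∀ m, m ≤ n → q m = 1 := fun m hm => by
  have := h.reverse.right_run (n := -n) (by simpa [ArithCoding.reverse] using hn)
    (by rw [ArithCoding.reverse, ← hn']; congr 1; ring) (-m) (by lia)
  simpa [ArithCoding.reverse] using this

theorem eq_of_zero (h : SoficCarry r a b q) (h0 : ∀ n, q n = 0) : a = b := by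
  ext n
  have := h.sub_eq n
  simp only [h0] at this
  lia

theorem glueRight (h : SoficCarry r a b q) {N : ℤ} (h0 : ∀ n ≤ N, q n = 0)
    (h1 : ∀ n > N, q n = 1) : SoficGlueRight r a b := by
  have hr := h.hr
  have hN1 : a (N + 1) = r - 1 ∧ b (N + 1) = 0 := by
    have e1 := h0 (N + 1 - 1) (by lia)
    have := h.neighbors (h1 (N + 1) (by lia))
    lia
  have hN2 : ∀ n > N + 1, a n = r - 2 ∧ b n = 0 := by
    intro n hn
    have e1 := h1 (n - 1) (by lia)
    have e2 := h1 (n + 1) (by lia)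
    have e3 := h.neighbors (h1 n (by lia))
    have e4 := h.left_mem.1 n
    have : a n ≠ r - 1 := fun e => by
      obtain ⟨k, hk1, hk2, hk3⟩ := exists_lt_of_mem_sofic h.left_mem (n := N + 1) (m := n)
        (by lia) hN1.1 e
      have := h.le_of_one (h1 k (by lia))
      lia
    lia
  have hN : (b N : ℤ) = a N + 1 := by
    have := h.sub_eq N
    rw [h0 N le_rfl, h0 (N - 1) (by lia), h1 (N + 1) (by lia)] at this
    lia
  refine ⟨N, a N, ?_, fun n hn => ?_, rfl, by lia, hN1.1, fun i => (hN2 _ (by lia)).1,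
    fun n hn => ?_⟩
  · have := h.right_mem.1 N
    lia
  · have := h.sub_eq n
    rw [h0 n (by lia), h0 (n - 1) (by lia), h0 (n + 1) (by lia)] at this
    lia
  · rcases (show n = N + 1 ∨ n > N + 1 by lia) with rfl | hn
    · exact hN1.2
    · exact (hN2 n hn).2

theorem glueLeft (h : SoficCarry r a b q) {N : ℤ} (h0 : ∀ n ≥ N, q n = 0)
    (h1 : ∀ n < N, q n = 1) : SoficGlueLeft r a b := by
  obtain ⟨N, k, hk, e1, e2, e3, e4, e5, e6⟩ := h.reverse.glueRight (N := -N)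
    (fun n hn => h0 _ (by lia)) (fun n hn => h1 _ (by lia))
  simp only [ArithCoding.reverse] at *
  refine ⟨-N, k, hk, fun n hn => ?_, e2, e3, ?_, fun i => ?_, fun n hn => ?_⟩
  · simpa using e1 (-n) (by lia)
  · rw [← e4]; congr 1; lia
  · rw [← e5 i]; congr 1; lia
  · simpa using e6 (-n) (by lia)

variable {R : (ℤ → ℕ) → (ℤ → ℕ) → Prop}

theorem rel_of_left_zero
    (hR : IsClosedGluing (soficCompactum r) (fun a b => SoficGlueRight r a b ∨ SoficGlueLeft r a b)
      R) (h : SoficCarry r a b q) {M : ℤ} (h0 : ∀ n ≤ M, q n = 0) : R a b := by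
  by_cases hz : ∀ n, q n = 0
  · rw [h.eq_of_zero hz]
    exact hR.refl _ h.right_mem
  push Not at hz
  obtain ⟨n, hn, hleast⟩ := Int.exists_least_of_bdd
    ⟨M, fun n hn => by by_contra hlt; exact hn (h0 n (by lia))⟩ hz
  have hbelow : ∀ m ≤ n - 1, q m = 0 := fun m hm => by
    by_contra hne
    have := hleast m hne
    lia
  have hn1 := h.abs_le n
  rcases (show q n = 1 ∨ q n = -1 by lia) with hq | hq
  · have := h.right_run hq (hbelow _ le_rfl)
    exact hR.glue _ h.left_mem _ h.right_mem
      (.inl (h.glueRight hbelow fun m hm => this m (by lia)))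
  · have h' := h.symm
    have := h'.right_run (n := n) (by simp [hq]) (by simp [hbelow _ le_rfl])
    exact hR.symm _ _ (hR.glue _ h'.left_mem _ h'.right_mem
      (.inl (h'.glueRight (N := n - 1) (fun m hm => by simp [hbelow m hm])
        fun m hm => this m (by lia))))

/-- The sequence equal to `b` on the left of `M`, to `a` on the right of `M`, and to `a M + 1` at
the place `M`. -/
def splice (a b : ℤ → ℕ) (M : ℤ) : ℤ → ℕ :=
  fun n => if n < M then b n else if n = M then a M + 1 else a n

/-- The left run is removed first: `a` is left-glued to the splice, and the carry between the splice
and `b` vanishes up to `M`, where `rel_of_left_zero` applies. -/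
theorem rel_of_left_run
    (hR : IsClosedGluing (soficCompactum r) (fun a b => SoficGlueRight r a b ∨ SoficGlueLeft r a b)
      R) (h : SoficCarry r a b q) {M : ℤ} (h1 : ∀ n < M, q n = 1) (h0 : q M = 0) : R a b := by
  have hr := h.hr
  have hM1 := h.neighbors (h1 (M - 1) (by lia))
  rw [show M - 1 + 1 = M by ring] at hM1
  have hbz : ∀ n < M, b n = 0 := by
    intro n hn
    rcases (show n = M - 1 ∨ n < M - 1 by lia) with rfl | hn'
    · lia
    have e1 := h1 (n - 1) (by lia)
    have e2 := h1 (n + 1) (by lia)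
    have e3 := h.neighbors (h1 n (by lia))
    have e4 := h.left_mem.1 n
    have : a n ≠ r - 1 := fun e => by
      obtain ⟨k, hk1, hk2, hk3⟩ := exists_lt_of_mem_sofic h.left_mem (n := n) (m := M - 1)
        (by lia) e (by lia)
      have := h.le_of_one (h1 k (by lia))
      lia
    lia
  have haM : a M + 2 ≤ r := by
    have := h.left_mem.1 M
    have h2 := h.left_mem.2 (M - 1) 0
    simp only [sub_add_cancel, Nat.cast_zero, add_zero] at h2
    by_contra hlt
    exact h2 ⟨by lia, by simp, by lia⟩
  have hz : splice a b M ∈ soficCompactum r := by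
    refine ⟨fun n => ?_, fun n j hj => ?_⟩
    · unfold splice
      have := h.left_mem.1 n
      have := h.right_mem.1 n
      split_ifs <;> lia
    · have hs : ∀ m > M, splice a b M m = a m := fun m hm => by
        simp [splice, not_lt.2 hm.le, hm.ne']
      rcases lt_trichotomy n M with hn | rfl | hn
      · have := hj.1
        rw [splice, if_pos hn, hbz n hn] at this
        lia
      · have h3 : a n = r - 2 := by
          have := hj.1
          simp [splice] at this
          lia
        -- A forbidden block of the splice starting at the raised digit comes from a longer one of
        -- `a` starting one place earlier, where `a` has `r - 1`.
        refine h.left_mem.2 (n - 1) (j + 1) ⟨by lia, fun i hi => ?_, ?_⟩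
        · rcases Nat.eq_zero_or_pos i with rfl | hi'
          · simpa using h3
          · rw [← hj.2.1 (i - 1) (by lia), hs _ (by lia)]
            congr 1; lia
        · rw [← hj.2.2, hs _ (by lia)]
          congr 1; push_cast; ring
      · exact h.left_mem.2 n j ⟨by rw [← hj.1, hs _ hn], fun i hi => by
          rw [← hj.2.1 i hi, hs _ (by lia)], by rw [← hj.2.2, hs _ (by lia)]⟩
  have hL : SoficCarry r a (splice a b M) (fun n => if n < M then 1 else 0) := by
    refine ⟨hr, h.left_mem, hz, fun n => by split_ifs <;> lia, fun n => ?_⟩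
    rcases (show n < M - 1 ∨ n = M - 1 ∨ n = M ∨ n > M by lia) with hn | rfl | rfl | hn
    · have e := h.sub_eq n
      rw [h1 n (by lia), h1 (n + 1) (by lia), h1 (n - 1) (by lia)] at e
      simp only [splice, show n < M by lia, show n + 1 < M by lia, show n - 1 < M by lia, if_true]
      lia
    · have e := h.sub_eq (M - 1)
      rw [h1 (M - 1) (by lia), h1 (M - 1 - 1) (by lia), sub_add_cancel, h0] at e
      simp only [splice, sub_add_cancel, show M - 1 < M by lia, show M - 1 - 1 < M by lia, if_true,
        lt_irrefl, if_false]
      lia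
    · simp [splice]
    · simp [splice, show ¬ n < M by lia, show ¬ n = M by lia, show ¬ n + 1 < M by lia,
        show ¬ n - 1 < M by lia]
  have hRt : SoficCarry r (splice a b M) b (fun n => if n ≤ M then 0 else q n) := by
    refine ⟨hr, hz, h.right_mem, fun n => ?_, fun n => ?_⟩
    · have := h.abs_le n
      split_ifs <;> lia
    · have e := h.sub_eq n
      rcases (show n < M ∨ n = M ∨ n = M + 1 ∨ n > M + 1 by lia) with hn | rfl | rfl | hn
      · simp [splice, hn, show n ≤ M by lia, show n + 1 ≤ M by lia, show n - 1 ≤ M by lia]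
      · rw [h0, h1 (n - 1) (by lia)] at e
        simp [splice]
        lia
      · rw [add_sub_cancel_right, h0] at e
        simp [splice, show ¬ M + 1 + 1 ≤ M by lia]
        lia
      · simp [splice, show ¬ n ≤ M by lia, show ¬ n < M by lia, show ¬ n = M by lia,
          show ¬ n + 1 ≤ M by lia, show ¬ n ≤ M + 1 by lia]
        lia
  refine hR.trans _ (splice a b M) _ (hR.glue _ h.left_mem _ hz (.inr (hL.glueLeft (N := M)
    (fun n hn => if_neg (by lia)) fun n hn => if_pos hn))) ?_
  exact rel_of_left_zero hR hRt (M := M) fun n hn => if_pos hn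

/-- A carry that is 1 everywhere has no end at which to glue. Closedness of the relation supplies
the pair: the place `-j` of a right glue is pushed to minus infinity. -/
theorem rel_const_zero
    (hR : IsClosedGluing (soficCompactum r) (fun a b => SoficGlueRight r a b ∨ SoficGlueLeft r a b)
      R) (hr : 3 ≤ r) : R (fun _ => r - 2) 0 := by
  refine hR.lim (fun j n => if n ≤ -(j : ℤ) then 0 else if n = -j + 1 then r - 1 else r - 2)
    (fun j n => if n = -(j : ℤ) then 1 else 0) _ _ ?_ ?_ (fun j => ?_) ?_ ?_
  · exact ⟨fun n => by lia, fun n j hj => by have := hj.1; lia⟩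
  · exact ⟨fun n => by simp, fun n j hj => by have := hj.1; simp at this; lia⟩
  · refine hR.glue _ ⟨fun n => ?_, fun n i hi => ?_⟩ _ ⟨fun n => ?_, fun n i hi => ?_⟩
      (.inl ⟨-j, 0, by lia, fun n hn => ?_, ?_, ?_, ?_, fun i => ?_, fun n hn => ?_⟩)
    · split_ifs <;> lia
    · have h1 := hi.1
      have h2 := hi.2.2
      beta_reduce at h1 h2
      split_ifs at h1 h2 <;> lia
    · beta_reduce; split_ifs <;> lia
    · have h1 := hi.1
      dsimp only at h1
      split_ifs at h1 <;> lia
    · beta_reduce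
      rw [if_pos hn.le, if_neg hn.ne]
    · simp
    · simp
    · simp
    · beta_reduce
      rw [if_neg (by lia), if_neg (by lia)]
    · exact if_neg (by lia)
  · refine tendsto_pi_nhds.2 fun n => tendsto_const_nhds.congr' ?_
    filter_upwards [eventually_gt_atTop (n.natAbs + 1)] with j hj
    rw [if_neg (by lia), if_neg (by lia)]
  · refine tendsto_pi_nhds.2 fun n => tendsto_const_nhds.congr' ?_
    filter_upwards [eventually_gt_atTop n.natAbs] with j hj
    rw [if_neg (by lia), Pi.zero_apply]

theorem rel_of_one
    (hR : IsClosedGluing (soficCompactum r) (fun a b => SoficGlueRight r a b ∨ SoficGlueLeft r a b)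
      R) (h : SoficCarry r a b q) (h1 : ∀ n, q n = 1) : R a b := by
  have hr := h.hr
  have hab : ∀ n, (a n : ℤ) = b n + r - 2 := fun n => by
    have e1 := h1 (n - 1)
    have e2 := h1 (n + 1)
    have := h.neighbors (h1 n)
    lia
  have hle := h.left_mem.1
  by_cases hex : ∃ n, a n = r - 1
  · obtain ⟨n, hn⟩ := hex
    have hother : ∀ m, m ≠ n → a m = r - 2 := by
      intro m hm
      have e1 := hab m
      have e2 := hle m
      have : a m ≠ r - 1 := fun e => by
        rcases lt_or_gt_of_ne hm with hlt | hlt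
        · obtain ⟨k, -, -, hk⟩ := exists_lt_of_mem_sofic h.left_mem hlt e hn
          have := hab k
          lia
        · obtain ⟨k, -, -, hk⟩ := exists_lt_of_mem_sofic h.left_mem hlt hn e
          have := hab k
          lia
      lia
    have hb : ∀ m, m ≠ n → b m = 0 := fun m hm => by
      have e1 := hab m
      have e2 := hother m hm
      lia
    have hbn : b n = 1 := by have := hab n; lia
    -- The intermediate sequence between `a` and `b`: a right glue at `n - 1` clears the right half
    -- of `a`, then a left glue at `n` clears the left half.
    set z : ℤ → ℕ := fun m => if m < n - 1 then r - 2 else if m = n - 1 then r - 1 else 0 with hz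
    have hzC : z ∈ soficCompactum r := by
      refine ⟨fun m => ?_, fun m i hi => ?_⟩
      · simp only [hz]; split_ifs <;> lia
      · have h1 := hi.1
        have h2 := hi.2.2
        simp only [hz] at h1 h2
        split_ifs at h1 h2 <;> lia
    have hz1 : ∀ m < n - 1, z m = r - 2 := fun m hm => if_pos hm
    have hz2 : z (n - 1) = r - 1 := by simp [hz]
    have hz3 : ∀ m > n - 1, z m = 0 := fun m hm => by
      simp only [hz]; rw [if_neg (by lia), if_neg (by lia)]
    refine hR.trans _ z _ (hR.glue _ h.left_mem _ hzC (.inl ⟨n - 1, r - 2, by lia,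
      fun m hm => by rw [hz1 m hm, hother m (by lia)], hother _ (by lia), by lia,
      by simpa using hn, fun i => hother _ (by lia), hz3⟩))
      (hR.glue _ hzC _ h.right_mem (.inr ⟨n, 0, by lia,
        fun m hm => by rw [hz3 m (by lia), hb m (by lia)], hz3 n (by lia), by lia, hz2,
        fun i => hz1 _ (by lia), fun m hm => hb m (by lia)⟩))
  · push Not at hex
    have ha : a = fun _ => r - 2 := by
      ext n
      have e1 := hab n
      have e2 := hle n
      have e3 := hex n
      lia
    have hb : b = 0 := by
      ext n
      have e1 := hab n
      rw [ha] at e1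
      simp only [Pi.zero_apply]
      lia
    rw [ha, hb]
    exact rel_const_zero hR hr

/-- Two elements of the sofic compactum with a carry are glued. -/
theorem rel
    (hR : IsClosedGluing (soficCompactum r) (fun a b => SoficGlueRight r a b ∨ SoficGlueLeft r a b)
      R) (h : SoficCarry r a b q) : R a b := by
  by_cases hz : ∃ m, q m = 0
  · obtain ⟨m, hm⟩ := hz
    by_cases h0 : ∀ n ≤ m, q n = 0
    · exact rel_of_left_zero hR h h0
    push Not at h0
    obtain ⟨n, ⟨hnm, hn⟩, hgreat⟩ := Int.exists_greatest_of_bdd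
      (P := fun n => n ≤ m ∧ q n ≠ 0) ⟨m, fun n hn => hn.1⟩ h0
    have hn1 : q (n + 1) = 0 := by
      by_contra hne
      rcases (show n = m ∨ n + 1 ≤ m by lia) with rfl | hle
      · exact hn hm
      · have := hgreat (n + 1) ⟨hle, hne⟩
        lia
    have := h.abs_le n
    rcases (show q n = 1 ∨ q n = -1 by lia) with hq | hq
    · have := h.left_run hq hn1
      exact rel_of_left_run hR h (M := n + 1) (fun k hk => this k (by lia)) hn1
    · have h' := h.symm
      have := h'.left_run (n := n) (by simp [hq]) (by simp [hn1])
      exact hR.symm _ _ (rel_of_left_run hR h' (M := n + 1) (fun k hk => this k (by lia))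
        (by simp [hn1]))
  · push Not at hz
    have key : ∀ {a b : ℤ → ℕ} {q : ℤ → ℤ}, SoficCarry r a b q → (∀ m, q m ≠ 0) → q 0 = 1 →
        ∀ n, q n = 1 := by
      intro a b q h hz h0 n
      induction n using Int.induction_on with
      | zero => exact h0
      | succ n ih =>
        have := h.neighbors ih
        have := hz (n + 1)
        lia
      | pred n ih =>
        have := h.neighbors ih
        have := hz (-n - 1)
        lia
    have h1 := h.abs_le 0
    have h2 := hz 0
    rcases (show q 0 = 1 ∨ q 0 = -1 by lia) with hq | hq
    · exact rel_of_one hR h (key h hz hq)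
    · exact hR.symm _ _ (rel_of_one hR h.symm (key h.symm (fun m => by simpa using hz m)
        (by simp [hq])))

theorem tail_of_right_run (h : SoficCarry r a b q) {N : ℤ} (h1 : ∀ n > N, q n = 1) :
    ∃ N, ∀ n > N, b n = 0 := by
  have hr := h.hr
  have hab : ∀ n > N + 1, (a n : ℤ) = b n + r - 2 := fun n hn => by
    have e1 := h1 (n - 1) (by lia)
    have e2 := h1 (n + 1) (by lia)
    have := h.neighbors (h1 n (by lia))
    lia
  have hle := h.left_mem.1
  by_cases hex : ∃ n > N + 1, a n = r - 1
  · obtain ⟨n, hnN, hn⟩ := hex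
    refine ⟨n, fun m hm => ?_⟩
    have e1 := hab m (by lia)
    have e2 := hle m
    have : a m ≠ r - 1 := fun e => by
      obtain ⟨k, hk1, -, hk⟩ := exists_lt_of_mem_sofic h.left_mem hm hn e
      have := hab k (by lia)
      lia
    lia
  · push Not at hex
    refine ⟨N + 1, fun m hm => ?_⟩
    have e1 := hab m hm
    have e2 := hle m
    have e3 := hex m hm
    lia

/-- The run through `n` is infinite on at least one side, and far along it the digits of `b` vanish.
-/
theorem tail_of_one (h : SoficCarry r a b q) {n : ℤ} (hn : q n = 1) :
    (∃ N, ∀ n > N, b n = 0) ∨ ∃ N, ∀ n < N, b n = 0 := by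
  by_cases hall : ∀ m, n ≤ m → q m = 1
  · exact .inl (h.tail_of_right_run (N := n - 1) fun m hm => hall m (by lia))
  push Not at hall
  obtain ⟨m, ⟨hm1, hm2⟩, hleast⟩ := Int.exists_least_of_bdd (P := fun m => n ≤ m ∧ q m ≠ 1)
    ⟨n, fun m hm => hm.1⟩ hall
  have hm3 : q (m - 1) = 1 := by
    by_contra hne
    rcases (show m = n ∨ n ≤ m - 1 by lia) with rfl | hle
    · exact hm2 hn
    · have := hleast (m - 1) ⟨hle, hne⟩
      lia
  have h4 := h.neighbors hm3
  rw [sub_add_cancel] at h4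
  have h5 := h.left_run hm3 (by rw [sub_add_cancel]; lia)
  obtain ⟨N, hN⟩ := h.reverse.tail_of_right_run (N := -m) fun k hk => h5 (-k) (by lia)
  exact .inr ⟨-N, fun k hk => by simpa [ArithCoding.reverse] using hN (-k) (by lia)⟩

end SoficCarry
end Sofic
end ArithCoding

namespace ArithCoding
open Filter Topology

/-! ### Carries in the Markov compactum and the glues they produce. -/

section Markov

variable {r : ℕ}

/-- Two elements of the Markov compactum whose difference is the image of a sequence with values in
`{-1, 0, 1}` under the characteristic operator. -/
structure MarkovCarry (r : ℕ) (a b : ℤ → ℕ) (q : ℤ → ℤ) : Prop where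
  hr : 1 ≤ r
  left_mem : a ∈ markovCompactum r
  right_mem : b ∈ markovCompactum r
  abs_le : ∀ n, -1 ≤ q n ∧ q n ≤ 1
  sub_eq : ∀ n, (a n : ℤ) - b n = r * q n - q (n + 1) + q (n - 1)

/-- The sequence with `r` at the places congruent to `p` modulo `2` and `0` elsewhere. -/
def alternating (r : ℕ) (p : ℤ) : ℤ → ℕ := fun n => if (n - p) % 2 = 0 then r else 0

theorem alternating_mem (r : ℕ) (p : ℤ) : alternating r p ∈ markovCompactum r := by
  intro n
  unfold alternating
  split_ifs <;> lia

theorem zero_mem_markov (r : ℕ) : (0 : ℤ → ℕ) ∈ markovCompactum r := fun n => by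
  simp

/-- Again a limit of right glues, whose place goes to minus infinity in steps of 2 so as to keep the
parity `p`. -/
theorem rel_alternating_zero {R : (ℤ → ℕ) → (ℤ → ℕ) → Prop}
    (hR : IsClosedGluing (markovCompactum r)
      (fun a b => MarkovGlueRight r a b ∨ MarkovGlueLeft r a b) R) (hr : 1 ≤ r) (p : ℤ) :
    R (alternating r p) 0 := by
  set u : ℕ → ℤ → ℕ := fun j n => if n ≤ p - 2 * j - 1 then 0 else alternating r p n with hu
  set v : ℕ → ℤ → ℕ := fun j n => if n = p - 2 * j - 1 then 1 else 0 with hv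
  refine hR.lim u v _ _ (alternating_mem r p) (zero_mem_markov r) (fun j => ?_) ?_ ?_
  · have hmu : u j ∈ markovCompactum r := by
      intro n
      simp only [hu, alternating]
      split_ifs <;> lia
    have hmv : v j ∈ markovCompactum r := by
      intro n
      simp only [hv]
      split_ifs <;> lia
    refine hR.glue _ hmu _ hmv (.inl ⟨p - 2 * j - 1, 0, hr, fun n hn => ?_, ?_, ?_,
      fun i => ⟨?_, ?_⟩, fun n hn => ?_⟩)
    · simp only [hu, hv]
      rw [if_pos hn.le, if_neg hn.ne]
    · simp [hu]
    · simp [hv]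
    · simp only [hu, alternating]
      rw [if_neg (by lia), if_pos (by lia)]
    · simp only [hu, alternating]
      rw [if_neg (by lia), if_neg (by lia)]
    · simp only [hv]
      rw [if_neg (by lia)]
  · refine tendsto_pi_nhds.2 fun n => tendsto_const_nhds.congr' ?_
    filter_upwards [eventually_gt_atTop (n.natAbs + p.natAbs)] with j hj
    simp only [hu]
    rw [if_neg (by lia)]
  · refine tendsto_pi_nhds.2 fun n => tendsto_const_nhds.congr' ?_
    filter_upwards [eventually_gt_atTop (n.natAbs + p.natAbs)] with j hj
    simp only [hv, Pi.zero_apply]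
    rw [if_neg (by lia)]

namespace MarkovCarry

variable {a b : ℤ → ℕ} {q : ℤ → ℤ}

theorem symm (h : MarkovCarry r a b q) : MarkovCarry r b a (-q) where
  hr := h.hr
  left_mem := h.right_mem
  right_mem := h.left_mem
  abs_le n := by have := h.abs_le n; simp only [Pi.neg_apply]; lia
  sub_eq n := by
    have := h.sub_eq n
    simp only [Pi.neg_apply]
    linear_combination -this

/-- Two consecutive ones force a third, and `a` would then have digit `r` at two consecutive places.
-/
theorem next_ne_one (h : MarkovCarry r a b q) {n : ℤ} (hn : q n = 1) : q (n + 1) ≠ 1 := by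
  intro h1
  have hr := h.hr
  have d1 := h.sub_eq (n + 1)
  have d2 := h.sub_eq (n + 1 + 1)
  have d3 := h.sub_eq (n + 1 + 1 + 1)
  have a1 := h.left_mem (n + 1)
  have a2 := h.left_mem (n + 1 + 1)
  have b2 := h.abs_le (n + 1 + 1)
  have b3 := h.abs_le (n + 1 + 1 + 1)
  rw [add_sub_cancel_right] at d1 d2
  rw [h1, hn] at d1
  have h2 : q (n + 1 + 1) = 1 := by lia
  rw [h2, h1] at d2
  lia

/-- The digit difference at `n` is `r + 1 + q (n - 1)` and cannot exceed `r`. Thus a sign change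
propagates to the left forever. -/
theorem prev_of_next (h : MarkovCarry r a b q) {n : ℤ} (hn : q n = 1) (hn' : q (n + 1) = -1) :
    q (n - 1) = -1 := by
  have d1 := h.sub_eq n
  have a1 := h.left_mem n
  have b1 := h.abs_le (n - 1)
  rw [hn, hn'] at d1
  lia

/-- Here `a` has digit `r` at `n`, hence 0 at `n + 1`, which forces the next carry but one to be 1.
The pattern `1, 0` therefore repeats to the right forever. -/
theorem right_step (h : MarkovCarry r a b q) {n : ℤ} (hn : q n = 1) (hn' : q (n - 1) = 0) :
    q (n + 1) = 0 ∧ q (n + 2) = 1 ∧ a n = r ∧ b n = 0 ∧ a (n + 1) = 0 ∧ b (n + 1) = 0 := by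
  have hr := h.hr
  have h0 : q (n + 1) = 0 := by
    have e1 := h.next_ne_one hn
    have e2 := h.prev_of_next hn
    have e3 := h.abs_le (n + 1)
    lia
  have d1 := h.sub_eq n
  have d2 := h.sub_eq (n + 1)
  have a1 := h.left_mem n
  have b2 := h.abs_le (n + 2)
  rw [hn, hn', h0] at d1
  rw [add_sub_cancel_right, h0, hn, add_assoc, one_add_one_eq_two] at d2
  lia

theorem right_iterate (h : MarkovCarry r a b q) {n : ℤ} (hn : q n = 1) (hn' : q (n - 1) = 0)
    (i : ℕ) : q (n + 2 * i) = 1 ∧ q (n + 2 * i + 1) = 0 ∧ a (n + 2 * i) = r ∧ b (n + 2 * i) = 0 ∧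
      a (n + 2 * i + 1) = 0 ∧ b (n + 2 * i + 1) = 0 := by
  have key : q (n + 2 * i) = 1 ∧ q (n + 2 * i - 1) = 0 := by
    induction i with
    | zero => simpa using ⟨hn, hn'⟩
    | succ i ih =>
      have := h.right_step ih.1 ih.2
      push_cast
      rw [show n + 2 * ((i : ℤ) + 1) = n + 2 * i + 2 by ring,
        show n + 2 * (i : ℤ) + 2 - 1 = n + 2 * i + 1 by ring]
      exact ⟨this.2.1, this.1⟩
  have := h.right_step key.1 key.2
  exact ⟨key.1, this.1, this.2.2⟩

theorem left_iterate (h : MarkovCarry r a b q) {n : ℤ} (hn : q n = 1) (hn' : q (n + 1) = -1)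
    (i : ℕ) : q (n - 2 * i) = 1 ∧ q (n - 2 * i + 1) = -1 := by
  induction i with
  | zero => simpa using ⟨hn, hn'⟩
  | succ i ih =>
    have h1 := h.prev_of_next ih.1 ih.2
    have h2 := h.symm.prev_of_next (n := n - 2 * i - 1) (by simp [h1])
      (by simp only [Pi.neg_apply, sub_add_cancel]; rw [ih.1])
    simp only [Pi.neg_apply, neg_inj] at h2
    push_cast
    rw [show n - 2 * ((i : ℤ) + 1) = n - 2 * i - 1 - 1 by ring,
      show n - 2 * (i : ℤ) - 1 - 1 + 1 = n - 2 * i - 1 by ring]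
    exact ⟨h2, h1⟩

theorem eq_of_zero (h : MarkovCarry r a b q) (h0 : ∀ n, q n = 0) : a = b := by
  ext n
  have := h.sub_eq n
  simp only [h0] at this
  lia

variable {R : (ℤ → ℕ) → (ℤ → ℕ) → Prop}

/-- Without adjacent nonzero carries the ones lie in an arithmetic progression of step 2 that is
infinite to the right. If it is infinite to the left too, `a` is alternating and `b` is zero;
otherwise its first term is the start of a right glue. -/
theorem rel_of_isolated_one
    (hR : IsClosedGluing (markovCompactum r)
      (fun a b => MarkovGlueRight r a b ∨ MarkovGlueLeft r a b) R) (h : MarkovCarry r a b q)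
    (hpos : ∀ n, q n = 1 → q (n - 1) = 0) (hneg : ∀ n, q n = -1 → q (n - 1) = 0) {n : ℤ}
    (hn : q n = 1) : R a b := by
  have hr := h.hr
  by_cases hall : ∀ i : ℕ, q (n - 2 * i) = 1
  · have hab : ∀ m, a m = alternating r n m ∧ b m = 0 := by
      intro m
      have hi := hall (m - n).natAbs
      have := h.right_iterate hi (hpos _ hi) ((m - n + 2 * (m - n).natAbs) / 2).toNat
      unfold alternating
      split_ifs with hpar
      · rw [show n - 2 * ((m - n).natAbs : ℤ) +
          2 * ((m - n + 2 * (m - n).natAbs) / 2).toNat = m by lia] at this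
        exact ⟨this.2.2.1, this.2.2.2.1⟩
      · rw [show n - 2 * ((m - n).natAbs : ℤ) +
          2 * ((m - n + 2 * (m - n).natAbs) / 2).toNat + 1 = m by lia] at this
        exact this.2.2.2.2
    rw [show a = alternating r n from funext fun m => (hab m).1,
      show b = 0 from funext fun m => (hab m).2]
    exact rel_alternating_zero hR hr n
  · have hex : ∃ i : ℕ, q (n - 2 * i) ≠ 1 := by simpa using hall
    classical
    set i := Nat.find hex with hi
    have hi1 : q (n - 2 * i) ≠ 1 := Nat.find_spec hex
    have hi0 : i ≠ 0 := fun e => hi1 (by simp [e, hn])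
    have hi2 : q (n - 2 * (i - 1 : ℕ)) = 1 := by
      by_contra hne
      exact Nat.find_min hex (m := i - 1) (by lia) hne
    obtain ⟨N, hN⟩ : ∃ N, N = n - 2 * ((i - 1 : ℕ) : ℤ) := ⟨_, rfl⟩
    rw [← hN] at hi2
    rw [show n - 2 * (i : ℤ) = N - 2 by lia] at hi1
    have hN1 := hpos N hi2
    have hN2 : q (N - 2) = 0 := by
      have := h.abs_le (N - 2)
      by_contra hne
      have hm : q (N - 2) = -1 := by lia
      have := h.symm.right_step (n := N - 2) (by simp [hm]) (by simp [hneg _ hm])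
      simp only [Pi.neg_apply, sub_add_cancel] at this
      lia
    -- An earlier nonzero carry would propagate in steps of 2 to `N - 1` or `N - 2`, where the carry
    -- is 0.
    have hz : ∀ m < N, q m = 0 := by
      intro m hm
      by_contra hne
      have hb := h.abs_le m
      have key : ∀ {a b : ℤ → ℕ} {q : ℤ → ℤ}, MarkovCarry r a b q → q m = 1 → q (m - 1) = 0 →
          q (N - 1) = 0 → q (N - 2) = 0 → False := by
        intro a b q h hq hq' e1 e2
        have := h.right_iterate hq hq' ((N - 1 - m) / 2).toNat
        rcases (show m + 2 * (((N - 1 - m) / 2).toNat : ℤ) = N - 1 ∨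
          m + 2 * (((N - 1 - m) / 2).toNat : ℤ) = N - 2 by lia) with e | e <;> rw [e] at this <;> lia
      rcases (show q m = 1 ∨ q m = -1 by lia) with hq | hq
      · exact key h hq (hpos _ hq) hN1 hN2
      · exact key h.symm (by simp [hq]) (by simp [hneg _ hq]) (by simp [hN1]) (by simp [hN2])
    have hright := h.right_iterate hi2 hN1
    have hb0 : ∀ m ≥ N, b m = 0 := by
      intro m hm
      have := hright ((m - N) / 2).toNat
      rcases (show m = N + 2 * (((m - N) / 2).toNat : ℤ) ∨ m = N + 2 * (((m - N) / 2).toNat : ℤ) + 1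
        by lia) with e | e <;> rw [e]
      · exact this.2.2.2.1
      · exact this.2.2.2.2.2
    have hbN : b (N - 1) = a (N - 1) + 1 := by
      have := h.sub_eq (N - 1)
      rw [sub_add_cancel, hi2, hN1, hz (N - 1 - 1) (by lia)] at this
      lia
    refine hR.glue _ h.left_mem _ h.right_mem (.inl ⟨N - 1, a (N - 1), ?_, fun m hm => ?_, rfl, hbN,
      fun i => ⟨?_, ?_⟩, fun m hm => hb0 m (by lia)⟩)
    · have := (h.right_mem (N - 1)).1
      lia
    · have := h.sub_eq m
      rw [hz m (by lia), hz (m + 1) (by lia), hz (m - 1) (by lia)] at this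
      lia
    · rw [sub_add_cancel]
      exact (hright i).2.2.1
    · rw [show N - 1 + 2 + 2 * (i : ℤ) = N + 2 * i + 1 by ring]
      exact (hright i).2.2.2.2.1

theorem rel_of_isolated
    (hR : IsClosedGluing (markovCompactum r)
      (fun a b => MarkovGlueRight r a b ∨ MarkovGlueLeft r a b) R) (h : MarkovCarry r a b q)
    (hpos : ∀ n, q n = 1 → q (n - 1) = 0) (hneg : ∀ n, q n = -1 → q (n - 1) = 0) : R a b := by
  by_cases hz : ∀ n, q n = 0
  · rw [h.eq_of_zero hz]
    exact hR.refl _ h.right_mem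
  push Not at hz
  obtain ⟨n, hn⟩ := hz
  have := h.abs_le n
  rcases (show q n = 1 ∨ q n = -1 by lia) with hq | hq
  · exact rel_of_isolated_one hR h hpos hneg hq
  · refine hR.symm _ _ (rel_of_isolated_one hR h.symm (fun m hm => ?_) (fun m hm => ?_) (n := n)
      (by simp [hq]))
    · simpa using hneg m (by simp at hm; lia)
    · simpa using hpos m (by simpa using hm)

/-- The sequence equal to `a` on the left of `N`, to `b` on the right of `N`, and to `k` at `N`. -/
def join (a b : ℤ → ℕ) (N : ℤ) (k : ℕ) : ℤ → ℕ :=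
  fun n => if n < N then a n else if n = N then k else b n

theorem join_mem {N : ℤ} {k : ℕ} (ha : a ∈ markovCompactum r) (hb : b ∈ markovCompactum r)
    (h1 : a (N - 1) ≠ r) (h2 : k < r ∨ k = r ∧ b (N + 1) = 0) :
    join a b N k ∈ markovCompactum r := by
  intro n
  have ha' := ha n
  have hb' := hb n
  rcases (show n < N - 1 ∨ n = N - 1 ∨ n = N ∨ n > N by lia) with hn | rfl | rfl | hn
  · simpa [join, show n < N by lia, show n + 1 < N by lia] using ha'
  · simp only [join, show N - 1 < N by lia, if_true]
    exact ⟨ha'.1, fun e => absurd e h1⟩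
  · simp only [join, lt_irrefl, if_true, if_false, show ¬ n + 1 < n by lia, show ¬ n + 1 = n by lia]
    lia
  · simpa [join, show ¬ n < N by lia, show ¬ n + 1 < N by lia, show ¬ n = N by lia,
      show ¬ n + 1 = N by lia] using hb'

/-- Gluing in the presence of a maximal alternating run of the carry which ends at `M`. -/
theorem rel_of_left_run
    (hR : IsClosedGluing (markovCompactum r)
      (fun a b => MarkovGlueRight r a b ∨ MarkovGlueLeft r a b) R) (h : MarkovCarry r a b q)
    {M : ℤ} (h1 : q M = 1) (h2 : q (M - 1) = -1) (h0 : q (M + 1) = 0) : R a b := by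
  have hr := h.hr
  have hrun : ∀ i : ℕ, q (M - 2 * i) = 1 ∧ q (M - 2 * i - 1) = -1 := fun i => by
    have := h.symm.left_iterate (n := M - 1) (by simp [h2]) (by simp [h1]) i
    simp only [Pi.neg_apply] at this
    rw [show M - 1 - 2 * (i : ℤ) + 1 = M - 2 * i by ring,
      show M - 1 - 2 * (i : ℤ) = M - 2 * i - 1 by ring] at this
    lia
  have hne : ∀ n ≤ M, q n ≠ 0 := fun n hn => by
    have := hrun ((M - n) / 2).toNat
    rcases (show M - 2 * (((M - n) / 2).toNat : ℤ) = n ∨ M - 2 * (((M - n) / 2).toNat : ℤ) - 1 = n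
      by lia) with e | e <;> rw [e] at this <;> lia
  have hdig : ∀ i : ℕ, (a (M - 1 - 2 * i) = 0 ∧ b (M - 1 - 2 * i) = r) ∧
      (a (M - 2 - 2 * i) = r ∧ b (M - 2 - 2 * i) = 0) := by
    intro i
    have e1 := hrun i
    have e2 := hrun (i + 1)
    have d1 := h.sub_eq (M - 1 - 2 * i)
    have d2 := h.sub_eq (M - 2 - 2 * i)
    push_cast at e2
    rw [show M - 2 * ((i : ℤ) + 1) = M - 2 - 2 * i by ring] at e2
    rw [show M - 2 * (i : ℤ) - 1 = M - 1 - 2 * i by ring] at e1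
    rw [show M - 1 - 2 * (i : ℤ) + 1 = M - 2 * i by ring,
      show M - 1 - 2 * (i : ℤ) - 1 = M - 2 - 2 * i by ring, e1.1, e1.2, e2.1] at d1
    rw [show M - 2 - 2 * (i : ℤ) + 1 = M - 1 - 2 * i by ring, e1.2, e2.1, e2.2] at d2
    have a1 := h.left_mem (M - 1 - 2 * i)
    have a2 := h.left_mem (M - 2 - 2 * i)
    have b1 := h.right_mem (M - 1 - 2 * i)
    have b2 := h.right_mem (M - 2 - 2 * i)
    lia
  have hM : a M = r - 1 ∧ b M = 0 := by
    have d1 := h.sub_eq M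
    have b1 := h.right_mem (M - 1)
    have := (hdig 0).1.2
    simp only [Nat.cast_zero, mul_zero, sub_zero] at this
    rw [sub_add_cancel] at b1
    rw [h0, h1, h2] at d1
    lia
  have hb0 : ∀ i : ℕ, b (M - 2 * i) = 0 := fun i => by
    rcases Nat.eq_zero_or_pos i with rfl | hi
    · simpa using hM.2
    · rw [← (hdig (i - 1)).2.2]
      congr 1; lia
  -- A sign change beyond `M + 1` would propagate left onto the zero at `M + 1`.
  have hiso : ∀ n ≥ M + 2, q n = 1 → q (n - 1) = 0 := fun n hn hq => by
    have e1 := h.abs_le (n - 1)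
    have e2 := h.next_ne_one (n := n - 1)
    rw [sub_add_cancel] at e2
    by_contra hne0
    have hm : q (n - 1) = -1 := by lia
    have := h.symm.left_iterate (n := n - 1) (by simp [hm]) (by simp [hq])
    have h4 := this ((n - 1 - M) / 2).toNat
    simp only [Pi.neg_apply] at h4
    rcases (show n - 1 - 2 * (((n - 1 - M) / 2).toNat : ℤ) = M + 1 ∨
      n - 1 - 2 * (((n - 1 - M) / 2).toNat : ℤ) + 1 = M + 1 by lia) with e | e <;>
      rw [e] at h4 <;> lia
  have hiso' : ∀ n ≥ M + 2, q n = -1 → q (n - 1) = 0 := fun n hn hq => by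
    have e1 := h.abs_le (n - 1)
    have e2 := h.symm.next_ne_one (n := n - 1)
    rw [sub_add_cancel] at e2
    simp only [Pi.neg_apply] at e2
    by_contra hne0
    have hm : q (n - 1) = 1 := by lia
    have := h.left_iterate (n := n - 1) (by simp [hm]) (by simp [hq])
    have h4 := this ((n - 1 - M) / 2).toNat
    rcases (show n - 1 - 2 * (((n - 1 - M) / 2).toNat : ℤ) = M + 1 ∨
      n - 1 - 2 * (((n - 1 - M) / 2).toNat : ℤ) + 1 = M + 1 by lia) with e | e <;>
      rw [e] at h4 <;> lia
  -- The carry that remains once a left glue at `M + 1` has removed the alternating run; it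
  -- satisfies the hypotheses of `rel_of_isolated`.
  set qR : ℤ → ℤ := fun n => if M + 2 ≤ n then q n else 0 with hqR
  have hqR1 : ∀ n, qR n = 1 → qR (n - 1) = 0 := fun n hn => by
    simp only [hqR] at hn ⊢
    by_cases hc : M + 2 ≤ n
    · rw [if_pos hc] at hn
      rw [hiso n hc hn, ite_self]
    · rw [if_neg hc] at hn
      lia
  have hqR2 : ∀ n, qR n = -1 → qR (n - 1) = 0 := fun n hn => by
    simp only [hqR] at hn ⊢
    by_cases hc : M + 2 ≤ n
    · rw [if_pos hc] at hn
      rw [hiso' n hc hn, ite_self]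
    · rw [if_neg hc] at hn
      lia
  have hqRle : ∀ n, -1 ≤ qR n ∧ qR n ≤ 1 := fun n => by
    have := h.abs_le n
    simp only [hqR]
    split_ifs <;> lia
  have dM := h.sub_eq (M + 1)
  rw [add_sub_cancel_right, h0, h1, add_assoc, one_add_one_eq_two] at dM
  have aM := h.left_mem (M + 1)
  have bM := h.right_mem (M + 1)
  rw [add_assoc, one_add_one_eq_two] at aM bM
  have hqM := h.abs_le (M + 2)
  have hq1 : qR (M + 2) = q (M + 2) := if_pos le_rfl
  have hqz : ∀ n ≤ M + 1, qR n = 0 := fun n hn => if_neg (by lia)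
  have hqq : ∀ n ≥ M + 1, qR n = q n := fun n hn => by
    simp only [hqR]
    split_ifs with hc
    · rfl
    · rw [show n = M + 1 by lia, h0]
  -- By `dM`, the digits of `a` and `b` at `M + 1` differ by `1 - q (M + 2)`. If they agree, the
  -- left glue raises the digit of `b`, which is below `r`; otherwise the digit of `a` is positive
  -- and the glue lowers it.
  by_cases hs : q (M + 2) = 1
  · have haM : a (M + 1) < r := by
      have := h.right_step hs (by rw [← h0]; congr 1; ring)
      lia
    have hb2 : b (M + 2) = 0 := (h.right_step hs (by rw [← h0]; congr 1; ring)).2.2.2.1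
    set z := join a b (M + 1) (a (M + 1) + 1) with hz
    have hzC : z ∈ markovCompactum r := by
      refine join_mem h.left_mem h.right_mem ?_ ?_
      · rw [add_sub_cancel_right]; lia
      · rw [add_assoc, one_add_one_eq_two]; lia
    have hz1 : ∀ n < M + 1, z n = a n := fun n hn => if_pos hn
    have hz2 : z (M + 1) = a (M + 1) + 1 := by simp [hz, join]
    have hz3 : ∀ n > M + 1, z n = b n := fun n hn => by
      simp only [hz, join]; rw [if_neg (by lia), if_neg (by lia)]
    have hc : MarkovCarry r a z qR := by
      refine ⟨hr, h.left_mem, hzC, hqRle, fun n => ?_⟩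
      rcases lt_trichotomy n (M + 1) with hn | rfl | hn
      · rw [hz1 n hn, hqz n (by lia), hqz (n + 1) (by lia), hqz (n - 1) (by lia)]
        lia
      · rw [hz2, hqz (M + 1) le_rfl, hqz (M + 1 - 1) (by lia), add_assoc, one_add_one_eq_two, hq1]
        lia
      · rw [hz3 n hn, hqq n (by lia), hqq (n + 1) (by lia), hqq (n - 1) (by lia)]
        exact h.sub_eq n
    refine hR.trans _ z _ (rel_of_isolated hR hc hqR1 hqR2) (hR.symm _ _
      (hR.glue _ h.right_mem _ hzC (.inr ⟨M + 1, a (M + 1), haM, fun n hn => (hz3 n hn).symm,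
        by lia, hz2, fun i => ?_, ?_, fun i => ?_⟩)))
    · rw [show M + 1 - 1 - 2 * (i : ℤ) = M - 2 * i by ring,
        show M + 1 - 2 - 2 * (i : ℤ) = M - 1 - 2 * i by ring]
      exact ⟨hb0 i, (hdig i).1.2⟩
    · rw [add_sub_cancel_right, hz1 M (by lia)]; exact hM.1
    · rw [hz1 _ (by lia), hz1 _ (by lia), show M + 1 - 3 - 2 * (i : ℤ) = M - 2 - 2 * i by ring,
        show M + 1 - 2 - 2 * (i : ℤ) = M - 1 - 2 * i by ring]
      exact ⟨(hdig i).1.1, (hdig i).2.1⟩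
  · have haM : 1 ≤ a (M + 1) := by lia
    set z := join b a (M + 1) (a (M + 1) - 1) with hz
    have hzC : z ∈ markovCompactum r := by
      refine join_mem h.right_mem h.left_mem ?_ ?_
      · rw [add_sub_cancel_right]; lia
      · lia
    have hz1 : ∀ n < M + 1, z n = b n := fun n hn => if_pos hn
    have hz2 : z (M + 1) = a (M + 1) - 1 := by simp [hz, join]
    have hz3 : ∀ n > M + 1, z n = a n := fun n hn => by
      simp only [hz, join]; rw [if_neg (by lia), if_neg (by lia)]
    have hc : MarkovCarry r z b qR := by
      refine ⟨hr, hzC, h.right_mem, hqRle, fun n => ?_⟩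
      rcases lt_trichotomy n (M + 1) with hn | rfl | hn
      · rw [hz1 n hn, hqz n (by lia), hqz (n + 1) (by lia), hqz (n - 1) (by lia)]
        lia
      · rw [hz2, hqz (M + 1) le_rfl, hqz (M + 1 - 1) (by lia), add_assoc, one_add_one_eq_two, hq1]
        lia
      · rw [hz3 n hn, hqq n (by lia), hqq (n + 1) (by lia), hqq (n - 1) (by lia)]
        exact h.sub_eq n
    refine hR.trans _ z _ (hR.symm _ _
      (hR.glue _ hzC _ h.left_mem (.inr ⟨M + 1, a (M + 1) - 1, by lia, hz3,
        hz2, by lia, fun i => ?_, ?_, fun i => ?_⟩))) (rel_of_isolated hR hc hqR1 hqR2)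
    · rw [hz1 _ (by lia), hz1 _ (by lia), show M + 1 - 1 - 2 * (i : ℤ) = M - 2 * i by ring,
        show M + 1 - 2 - 2 * (i : ℤ) = M - 1 - 2 * i by ring]
      exact ⟨hb0 i, (hdig i).1.2⟩
    · rw [add_sub_cancel_right]; exact hM.1
    · rw [show M + 1 - 3 - 2 * (i : ℤ) = M - 2 - 2 * i by ring,
        show M + 1 - 2 - 2 * (i : ℤ) = M - 1 - 2 * i by ring]
      exact ⟨(hdig i).1.1, (hdig i).2.1⟩

/-- The sign change extends to minus infinity. If alternation also never stops on the right, `a` and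
`b` are the two alternating sequences, both related to 0; otherwise it stops at a zero and
`rel_of_left_run` applies. -/
theorem rel_of_opposite
    (hR : IsClosedGluing (markovCompactum r)
      (fun a b => MarkovGlueRight r a b ∨ MarkovGlueLeft r a b) R) (h : MarkovCarry r a b q)
    {n : ℤ} (hn : q n = 1) (hn' : q (n + 1) = -1) : R a b := by
  have hr := h.hr
  by_cases hz : ∀ m, n + 1 ≤ m → q m ≠ 0
  · have halt : ∀ m, n ≤ m → q m = -q (m + 1) := fun m hm => by
      have e1 := h.next_ne_one (n := m)
      have e2 := h.symm.next_ne_one (n := m)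
      have e3 := h.abs_le m
      have e4 := h.abs_le (m + 1)
      have e5 := hz (m + 1) (by lia)
      have e6 : q m ≠ 0 := by
        rcases hm.eq_or_lt with rfl | hm
        · lia
        · exact hz m (by lia)
      simp only [Pi.neg_apply] at e2
      lia
    have hpar : ∀ i : ℕ, q (n + 2 * i) = 1 ∧ q (n + 2 * i + 1) = -1 := by
      intro i
      induction i with
      | zero => simpa using ⟨hn, hn'⟩
      | succ i ih =>
        have e1 := halt (n + 2 * i + 1) (by lia)
        have e2 := halt (n + 2 * i + 1 + 1) (by lia)
        push_cast
        rw [show n + 2 * ((i : ℤ) + 1) = n + 2 * i + 1 + 1 by ring]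
        lia
    have hall : ∀ m, (m - n) % 2 = 0 → q m = 1 ∧ q (m + 1) = -1 := fun m hm => by
      rcases le_total n m with hle | hle
      · have := hpar ((m - n) / 2).toNat
        rwa [show n + 2 * (((m - n) / 2).toNat : ℤ) = m by lia] at this
      · have := h.left_iterate hn hn' ((n - m) / 2).toNat
        rwa [show n - 2 * (((n - m) / 2).toNat : ℤ) = m by lia] at this
    have ha : a = alternating r n := by
      ext m
      unfold alternating
      have d := h.sub_eq m
      have a1 := h.left_mem m
      have b1 := h.right_mem m
      split_ifs with hp
      · have e1 := hall m hp
        have e2 := hall (m - 2) (by lia)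
        rw [show m - 2 + 1 = m - 1 by ring] at e2
        rw [e1.1, e1.2, e2.2] at d
        lia
      · have e1 := hall (m - 1) (by lia)
        have e2 := hall (m + 1) (by lia)
        rw [sub_add_cancel] at e1
        rw [e1.2, e1.1, e2.1] at d
        lia
    have hb : b = alternating r (n + 1) := by
      ext m
      unfold alternating
      have d := h.sub_eq m
      have a1 := h.left_mem m
      have b1 := h.right_mem m
      split_ifs with hp
      · have e1 := hall (m - 1) (by lia)
        have e2 := hall (m + 1) (by lia)
        rw [sub_add_cancel] at e1
        rw [e1.2, e1.1, e2.1] at d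
        lia
      · have e1 := hall m (by lia)
        have e2 := hall (m - 2) (by lia)
        rw [show m - 2 + 1 = m - 1 by ring] at e2
        rw [e1.1, e1.2, e2.2] at d
        lia
    rw [ha, hb]
    exact hR.trans _ 0 _ (rel_alternating_zero hR hr _)
      (hR.symm _ _ (rel_alternating_zero hR hr _))
  · push Not at hz
    obtain ⟨m, ⟨hm1, hm2⟩, hleast⟩ := Int.exists_least_of_bdd (P := fun m => n + 1 ≤ m ∧ q m = 0)
      ⟨n + 1, fun m hm => hm.1⟩ hz
    have hne : ∀ k, n ≤ k → k < m → q k ≠ 0 := fun k hk hkm e => by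
      rcases hk.eq_or_lt with rfl | hk
      · lia
      · have := hleast k ⟨by lia, e⟩
        lia
    have hm3 : m ≠ n + 1 := fun e => by rw [e] at hm2; lia
    have e1 := hne (m - 1) (by lia) (by lia)
    have e2 := hne (m - 1 - 1) (by lia) (by lia)
    have e3 := h.abs_le (m - 1)
    have e4 := h.abs_le (m - 1 - 1)
    have e5 := h.next_ne_one (n := m - 1 - 1)
    have e6 := h.symm.next_ne_one (n := m - 1 - 1)
    rw [sub_add_cancel] at e5 e6
    simp only [Pi.neg_apply] at e6
    rcases (show q (m - 1) = 1 ∨ q (m - 1) = -1 by lia) with hq | hq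
    · exact rel_of_left_run hR h (M := m - 1) hq (by lia) (by rw [sub_add_cancel, hm2])
    · exact hR.symm _ _ (rel_of_left_run hR h.symm (M := m - 1) (by simp [hq])
        (by simp only [Pi.neg_apply]; lia) (by simp [hm2]))

/-- Two elements of the Markov compactum with a carry are glued. -/
theorem rel
    (hR : IsClosedGluing (markovCompactum r)
      (fun a b => MarkovGlueRight r a b ∨ MarkovGlueLeft r a b) R) (h : MarkovCarry r a b q) :
    R a b := by
  by_cases hop : ∃ n, q n = 1 ∧ q (n + 1) = -1
  · obtain ⟨n, hn, hn'⟩ := hop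
    exact rel_of_opposite hR h hn hn'
  by_cases hop' : ∃ n, q n = -1 ∧ q (n + 1) = 1
  · obtain ⟨n, hn, hn'⟩ := hop'
    exact hR.symm _ _ (rel_of_opposite hR h.symm (n := n) (by simp [hn]) (by simp [hn']))
  push Not at hop hop'
  refine rel_of_isolated hR h (fun n hn => ?_) (fun n hn => ?_)
  · have e1 := hop' (n - 1)
    have e2 := h.next_ne_one (n := n - 1)
    have e3 := h.abs_le (n - 1)
    rw [sub_add_cancel] at e1 e2
    lia
  · have e1 := hop (n - 1)
    have e2 := h.symm.next_ne_one (n := n - 1)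
    have e3 := h.abs_le (n - 1)
    rw [sub_add_cancel] at e1 e2
    simp only [Pi.neg_apply] at e2
    lia

theorem tail_of_opposite (h : MarkovCarry r a b q) {n : ℤ} (hn : q n = 1)
    (hn' : q (n + 1) = -1) : ∀ m < n, a m = alternating r n m := by
  intro m hm
  unfold alternating
  have d := h.sub_eq m
  have a1 := h.left_mem m
  have b1 := h.right_mem m
  have key : ∀ m ≤ n, (m - n) % 2 = 0 → q m = 1 ∧ q (m + 1) = -1 := fun m hle hm => by
    have := h.left_iterate hn hn' ((n - m) / 2).toNat
    rwa [show n - 2 * (((n - m) / 2).toNat : ℤ) = m by lia] at this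
  split_ifs with hp
  · have e1 := key m (by lia) hp
    have e2 := key (m - 2) (by lia) (by lia)
    rw [show m - 2 + 1 = m - 1 by ring] at e2
    rw [e1.1, e1.2, e2.2] at d
    lia
  · have e1 := key (m - 1) (by lia) (by lia)
    have e2 := key (m + 1) (by lia) (by lia)
    rw [sub_add_cancel] at e1
    rw [e1.2, e1.1, e2.1] at d
    lia

theorem tail_of_one (h : MarkovCarry r a b q) {n : ℤ} (hn : q n = 1) :
    (∃ N, ∀ n > N, b n = 0) ∨ (∃ N p, ∀ n < N, a n = alternating r p n) ∨
      ∃ N p, ∀ n < N, b n = alternating r p n := by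
  have e1 := h.abs_le (n - 1)
  have e2 := h.next_ne_one (n := n - 1)
  rw [sub_add_cancel] at e2
  rcases (show q (n - 1) = 0 ∨ q (n - 1) = -1 by lia) with hq | hq
  · left
    refine ⟨n - 1, fun m hm => ?_⟩
    have := h.right_iterate hn hq ((m - n) / 2).toNat
    rcases (show m = n + 2 * (((m - n) / 2).toNat : ℤ) ∨ m = n + 2 * (((m - n) / 2).toNat : ℤ) + 1
      by lia) with e | e <;> rw [e]
    · exact this.2.2.2.1
    · exact this.2.2.2.2.2
  · exact .inr (.inr ⟨n - 1, n - 1, h.symm.tail_of_opposite (n := n - 1) (by simp [hq])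
      (by simp [hn])⟩)

end MarkovCarry
end Markov
end ArithCoding

namespace ArithCoding
open Filter Topology

/-! ### Equality of codes is the gluing relation. -/

section Carry

variable {r : ℕ} {σ : ℤ}

/-- The carry is the integral potential of the difference `a - b`, bounded by `r` times the ℓ¹ norm
of `green`; this product is less than 2. -/
theorem exists_markovCarry (h : Admissible r (-1)) (hr : 1 ≤ r) {a b : ℤ → ℕ}
    (ha : a ∈ markovCompactum r) (hb : b ∈ markovCompactum r)
    (hab : code r (-1) a = code r (-1) b) : ∃ q, MarkovCarry r a b q := by
  set d : ℤ → ℤ := (fun n => (a n : ℤ)) - fun n => (b n : ℤ) with hd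
  have hdr : d ∈ boundedSeq r := fun n => by
    have e1 := (ha n).1
    have e2 := (hb n).1
    simp only [hd, Pi.sub_apply]
    rw [abs_le]; lia
  have h0 : torusCode r (-1) d = 0 := by
    rw [hd, h.torusCode_sub (cast_mem_boundedSeq fun n => (ha n).1)
      (cast_mem_boundedSeq fun n => (hb n).1)]
    exact sub_eq_zero.2 hab
  obtain ⟨q, hq, hdq⟩ := h.exists_potential_eq hdr h0
  refine ⟨q, hr, ha, hb, fun n => ?_, fun n => ?_⟩
  · have hle := h.abs_potential_le (abs_cast_le hdr) n
    rw [← hq] at hle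
    have h1 := h.one_lt
    have h2 := h.sub_pos
    have h3 := h.dominantRoot_mul_conjRoot
    have h4 := dominantRoot_add_conjRoot (r := r) (σ := -1)
    set l := dominantRoot r (-1)
    set m := conjRoot r (-1)
    have hlt : (l + 1) / (l - 1) / (l - m) * r < 2 := by
      rw [div_div, div_mul_eq_mul_div, div_lt_iff₀ (mul_pos (by linarith) h2), ← h4]
      -- Multiplying by `l` eliminates `m` through `l * m = -1`; the two sides then differ by
      -- exactly `(l - 1) ^ 3`.
      have h5 : l * ((l + 1) * (l + m)) < l * (2 * ((l - 1) * (l - m))) := by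
        push_cast at h3
        have e1 : l * ((l + 1) * (l + m)) = (l + 1) * (l ^ 2 - 1) := by
          linear_combination (l + 1) * h3
        have e2 : l * (2 * ((l - 1) * (l - m))) = 2 * (l - 1) * (l ^ 2 + 1) := by
          linear_combination (-2 * (l - 1)) * h3
        rw [e1, e2]
        nlinarith [mul_pos (sub_pos.2 h1) (pow_pos (sub_pos.2 h1) 2)]
      exact lt_of_mul_lt_mul_left h5 h.pos.le
    have hlt2 : |q n| < 2 := by
      have : |(q n : ℝ)| < 2 := hle.trans_lt hlt
      exact_mod_cast this
    rw [abs_lt] at hlt2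
    lia
  · have := hdq n
    simp only [hd, Pi.sub_apply, charOp] at this
    rw [this]
    push_cast; ring

theorem exists_soficCarry (h : Admissible r 1) (hr : 3 ≤ r) {a b : ℤ → ℕ}
    (ha : a ∈ soficCompactum r) (hb : b ∈ soficCompactum r)
    (hab : code r 1 a = code r 1 b) : ∃ q, SoficCarry r a b q := by
  set d : ℤ → ℤ := (fun n => (a n : ℤ)) - fun n => (b n : ℤ) with hd
  have hdr : d ∈ boundedSeq (r - 1) := fun n => by
    have e1 := ha.1 n
    have e2 := hb.1 n
    simp only [hd, Pi.sub_apply]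
    rw [abs_le]; lia
  have h0 : torusCode r 1 d = 0 := by
    rw [hd, h.torusCode_sub (cast_mem_boundedSeq ha.1) (cast_mem_boundedSeq hb.1)]
    exact sub_eq_zero.2 hab
  obtain ⟨q, hq, hdq⟩ := h.exists_potential_eq hdr h0
  have hsub : ∀ n, (a n : ℤ) - b n = r * q n - q (n + 1) - q (n - 1) := fun n => by
    have := hdq n
    simp only [hd, Pi.sub_apply, charOp] at this
    rw [this]
    push_cast; ring
  have hq2 : ∀ n, -2 ≤ q n ∧ q n ≤ 2 ∧ ((r : ℤ) - 2) * |q n| ≤ r - 1 := by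
    intro n
    have hle := h.abs_potential_le (abs_cast_le hdr) n
    rw [← hq] at hle
    have h1 := h.one_lt
    have h2 := h.sub_pos
    have h3 := h.dominantRoot_mul_conjRoot
    have h4 := dominantRoot_add_conjRoot (r := r) (σ := 1)
    have hr' : (3 : ℝ) ≤ r := by exact_mod_cast hr
    set l := dominantRoot r 1
    set m := conjRoot r 1
    -- For `σ = 1` the ℓ¹ norm is `1 / (r - 2)`. With digits up to `r - 1` this leaves a carry of
    -- absolute value 2 possible, to be excluded separately.
    have heq : (l + 1) / (l - 1) / (l - m) = 1 / ((r : ℝ) - 2) := by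
      rw [div_div, div_eq_div_iff (mul_pos (by linarith) h2).ne' (by linarith), ← h4]
      refine mul_left_cancel₀ h.pos.ne' ?_
      push_cast at h3
      linear_combination (l + 1 + (l - 1)) * h3
    rw [heq, Nat.cast_sub (by lia), one_div_mul_eq_div, le_div_iff₀ (by linarith)] at hle
    have hz : ((r : ℤ) - 2) * |q n| ≤ r - 1 := by
      have : ((r : ℝ) - 2) * |(q n : ℝ)| ≤ r - 1 := by push_cast at hle; linarith
      exact_mod_cast this
    have : |q n| ≤ 2 := by
      by_contra! hlt
      nlinarith [show (3 : ℤ) ≤ r by exact_mod_cast hr]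
    rw [abs_le] at this
    exact ⟨this.1, this.2, hz⟩
  have hno : ∀ {a b : ℤ → ℕ} {q : ℤ → ℤ}, a ∈ soficCompactum r →
      (∀ n, (a n : ℤ) - b n = r * q n - q (n + 1) - q (n - 1)) →
      (∀ n, q n ≤ 2) → ∀ n, q n ≠ 2 := by
    intro a b q ha hsub hq n hn
    -- A carry 2 forces `r = 3` and carries 2 on both sides, so `a` has `r - 1` there; two such
    -- digits in a row are forbidden.
    have key : ∀ n, q n = 2 → q (n + 1) = 2 ∧ a n = r - 1 := fun n hn => by
      have e1 := hsub n
      have e2 := hq (n + 1)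
      have e3 := hq (n - 1)
      have e4 := ha.1 n
      rw [hn] at e1
      lia
    have k1 := key n hn
    have k2 := key (n + 1) k1.1
    exact ha.2 n 0 ⟨k1.2, by simp, by simpa using k2.2⟩
  refine ⟨q, hr, ha, hb, fun n => ?_, hsub⟩
  have e1 := hq2 n
  have e2 := hno ha hsub (fun n => (hq2 n).2.1) n
  have e3 := hno (a := b) (b := a) (q := -q) hb (fun n => by
    simp only [Pi.neg_apply]; linear_combination -(hsub n))
    (fun n => by have := hq2 n; simp only [Pi.neg_apply]; lia) n
  simp only [Pi.neg_apply] at e3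
  lia

theorem charOp_code_eq (h : Admissible r σ) {a b : ℤ → ℕ} (ha : ∀ n, a n ≤ r) (hb : ∀ n, b n ≤ r)
    {B : ℕ} {q : ℤ → ℤ} (hq : q ∈ boundedSeq B)
    (hab : ∀ n, (a n : ℤ) - b n = charOp σ r q n) : code r σ a = code r σ b := by
  rw [← sub_eq_zero]
  unfold code
  rw [← h.torusCode_sub (cast_mem_boundedSeq ha) (cast_mem_boundedSeq hb),
    ← h.torusCode_charOp hq]
  congr 1; ext n; exact hab n

/-- Each glue has an explicit carry. Sofic glues carry 1 on an open half-line beside `N`. The Markov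
right glue carries 1 at odd distances to the right of `N`, and the Markov left glue carries
alternately `-1` and 1 to the left of `N`. -/
theorem Admissible.code_eq_of_glue (h : Admissible r σ) {a b : ℤ → ℕ} (ha : a ∈ compactum r σ)
    (hb : b ∈ compactum r σ) (hg : Glue r σ a b) : code r σ a = code r σ b := by
  have ha' := h.le_of_mem ha
  have hb' := h.le_of_mem hb
  rcases h.imp id id with ⟨rfl, hr⟩ | ⟨rfl, hr⟩
  · rw [Glue, if_pos rfl] at hg
    rcases hg with ⟨N, k, hk, h1, h2, h3, h4, h5⟩ | ⟨N, k, hk, h1, h2, h3, h4, h5, h6⟩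
    · refine charOp_code_eq h ha' hb' (B := 1)
        (q := fun n => if N < n ∧ (n - N) % 2 = 1 then 1 else 0)
        (fun n => by beta_reduce; split_ifs <;> simp) fun n => ?_
      simp only [charOp]
      rcases lt_trichotomy n N with hn | rfl | hn
      · rw [if_neg (by lia), if_neg (by lia), if_neg (by lia), h1 n hn]
        simp
      · rw [if_neg (by lia), if_pos (by lia), if_neg (by lia), h2, h3]
        simp
      · have h4' := h4 ((n - N - 1) / 2).toNat
        have h5' := h5 n hn
        by_cases hp : (n - N) % 2 = 1
        · rw [show N + 1 + 2 * (((n - N - 1) / 2).toNat : ℤ) = n by lia] at h4'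
          rw [if_pos ⟨hn, hp⟩, if_neg (by lia), if_neg (by lia), h4'.1, h5']
          simp
        · rw [show N + 2 + 2 * (((n - N - 1) / 2).toNat : ℤ) = n by lia] at h4'
          rw [if_neg (by lia), if_pos (by lia), if_pos (by lia), h4'.2, h5']
          simp
    · refine charOp_code_eq h ha' hb' (B := 1)
        (q := fun n => if N ≤ n then 0 else if (N - n) % 2 = 1 then -1 else 1)
        (fun n => by beta_reduce; split_ifs <;> simp) fun n => ?_
      simp only [charOp]
      rcases (show n > N ∨ n = N ∨ n = N - 1 ∨ n < N - 1 by lia) with hn | rfl | rfl | hn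
      · rw [if_pos (by lia), if_pos (by lia), if_pos (by lia), h1 n hn]
        simp
      · rw [if_pos (by lia), if_pos (by lia), if_neg (by lia), if_pos (by lia), h2, h3]
        simp
      · have h4' := (h4 0).1
        simp only [Nat.cast_zero, mul_zero, sub_zero] at h4'
        rw [if_neg (by lia), if_pos (by lia), if_pos (by lia), if_neg (by lia), if_neg (by lia),
          h4', h5]
        push_cast [Nat.cast_sub hr]
        ring
      · have h4' := (h4 ((N - 2 - n) / 2).toNat).2
        have h4'' := (h4 ((N - 1 - n) / 2).toNat).1
        have h6' := h6 ((N - 2 - n) / 2).toNat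
        rw [if_neg (show ¬ N ≤ n by lia), if_neg (show ¬ N ≤ n + 1 by lia),
          if_neg (show ¬ N ≤ n - 1 by lia)]
        by_cases hp : (N - n) % 2 = 1
        · rw [show N - 1 - 2 * (((N - 1 - n) / 2).toNat : ℤ) = n by lia] at h4''
          rw [show N - 3 - 2 * (((N - 2 - n) / 2).toNat : ℤ) = n by lia] at h6'
          rw [if_pos hp, if_neg (by lia), if_neg (by lia), h4'', h6'.2]
          push_cast; ring
        · rw [show N - 2 - 2 * (((N - 2 - n) / 2).toNat : ℤ) = n by lia] at h4' h6'
          rw [if_neg hp, if_pos (by lia), if_pos (by lia), h4', h6'.1]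
          push_cast; ring
  · rw [Glue, if_neg (by norm_num)] at hg
    rcases hg with ⟨N, k, hk, h1, h2, h3, h4, h5, h6⟩ | ⟨N, k, hk, h1, h2, h3, h4, h5, h6⟩
    · refine charOp_code_eq h ha' hb' (B := 1) (q := fun n => if N < n then 1 else 0)
        (fun n => by beta_reduce; split_ifs <;> simp) fun n => ?_
      simp only [charOp]
      rcases (show n < N ∨ n = N ∨ n = N + 1 ∨ n > N + 1 by lia) with hn | rfl | rfl | hn
      · rw [if_neg (by lia), if_neg (by lia), if_neg (by lia), h1 n hn]
        simp
      · rw [if_neg (by lia), if_pos (by lia), if_neg (by lia), h2, h3]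
        simp
      · rw [if_pos (by lia), if_pos (by lia), if_neg (by lia), h4, h6 _ (by lia)]
        push_cast [Nat.cast_sub (show 1 ≤ r by lia)]
        ring
      · have := h5 (n - N - 2).toNat
        rw [show N + 2 + ((n - N - 2).toNat : ℤ) = n by lia] at this
        rw [if_pos (by lia), if_pos (by lia), if_pos (by lia), this, h6 _ (by lia)]
        push_cast [Nat.cast_sub (show 2 ≤ r by lia)]
        ring
    · refine charOp_code_eq h ha' hb' (B := 1) (q := fun n => if n < N then 1 else 0)
        (fun n => by beta_reduce; split_ifs <;> simp) fun n => ?_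
      simp only [charOp]
      rcases (show n > N ∨ n = N ∨ n = N - 1 ∨ n < N - 1 by lia) with hn | rfl | rfl | hn
      · rw [if_neg (by lia), if_neg (by lia), if_neg (by lia), h1 n hn]
        simp
      · rw [if_neg (by lia), if_neg (by lia), if_pos (by lia), h2, h3]
        simp
      · rw [if_pos (by lia), if_neg (by lia), if_pos (by lia), h4, h6 _ (by lia)]
        push_cast [Nat.cast_sub (show 1 ≤ r by lia)]
        ring
      · have := h5 (N - 2 - n).toNat
        rw [show N - 2 - ((N - 2 - n).toNat : ℤ) = n by lia] at this
        rw [if_pos (by lia), if_pos (by lia), if_pos (by lia), this, h6 _ (by lia)]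
        push_cast [Nat.cast_sub (show 2 ≤ r by lia)]
        ring

theorem Admissible.closedGluing_of_code_eq (h : Admissible r σ) {R : (ℤ → ℕ) → (ℤ → ℕ) → Prop}
    (hR : IsClosedGluing (compactum r σ) (Glue r σ) R) {a b : ℤ → ℕ} (ha : a ∈ compactum r σ)
    (hb : b ∈ compactum r σ) (hab : code r σ a = code r σ b) : R a b := by
  rcases h.imp id id with ⟨rfl, hr⟩ | ⟨rfl, hr⟩
  · have e1 : compactum r (-1) = markovCompactum r := if_pos rfl
    have e2 : Glue r (-1) = fun a b => MarkovGlueRight r a b ∨ MarkovGlueLeft r a b := by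
      ext a b; rw [Glue, if_pos rfl]
    rw [e1] at ha hb
    rw [e1, e2] at hR
    obtain ⟨q, hq⟩ := exists_markovCarry h hr ha hb hab
    exact hq.rel hR
  · have e1 : compactum r 1 = soficCompactum r := if_neg (by norm_num)
    have e2 : Glue r 1 = fun a b => SoficGlueRight r a b ∨ SoficGlueLeft r a b := by
      ext a b; rw [Glue, if_neg (by norm_num)]
    rw [e1] at ha hb
    rw [e1, e2] at hR
    obtain ⟨q, hq⟩ := exists_soficCarry h hr ha hb hab
    exact hq.rel hR

/-- Distinct elements of the compactum with the same code have an exceptional tail. -/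
theorem Admissible.tail_of_code_eq (h : Admissible r σ) {a b : ℤ → ℕ} (ha : a ∈ compactum r σ)
    (hb : b ∈ compactum r σ) (hab : code r σ a = code r σ b) (hne : a ≠ b) :
    ∃ x, (x = a ∨ x = b) ∧ ∃ N : ℤ, (∀ n > N, x n = 0) ∨ (∀ n < N, x n = 0) ∨
      ∃ p, ∀ n < N, x n = alternating r p n := by
  rcases h.imp id id with ⟨rfl, hr⟩ | ⟨rfl, hr⟩
  · rw [show compactum r (-1) = markovCompactum r from if_pos rfl] at ha hb
    obtain ⟨q, hq⟩ := exists_markovCarry h hr ha hb hab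
    have hz : ∃ n, q n ≠ 0 := by
      by_contra! hz
      exact hne (hq.eq_of_zero hz)
    obtain ⟨n, hn⟩ := hz
    have := hq.abs_le n
    rcases (show q n = 1 ∨ q n = -1 by lia) with h1 | h1
    · rcases hq.tail_of_one h1 with ⟨N, hN⟩ | ⟨N, p, hN⟩ | ⟨N, p, hN⟩
      exacts [⟨b, .inr rfl, N, .inl hN⟩, ⟨a, .inl rfl, N, .inr (.inr ⟨p, hN⟩)⟩,
        ⟨b, .inr rfl, N, .inr (.inr ⟨p, hN⟩)⟩]
    · rcases hq.symm.tail_of_one (n := n) (by simp [h1]) with ⟨N, hN⟩ | ⟨N, p, hN⟩ | ⟨N, p, hN⟩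
      exacts [⟨a, .inl rfl, N, .inl hN⟩, ⟨b, .inr rfl, N, .inr (.inr ⟨p, hN⟩)⟩,
        ⟨a, .inl rfl, N, .inr (.inr ⟨p, hN⟩)⟩]
  · rw [show compactum r 1 = soficCompactum r from if_neg (by norm_num)] at ha hb
    obtain ⟨q, hq⟩ := exists_soficCarry h hr ha hb hab
    have hz : ∃ n, q n ≠ 0 := by
      by_contra! hz
      exact hne (hq.eq_of_zero hz)
    obtain ⟨n, hn⟩ := hz
    have := hq.abs_le n
    rcases (show q n = 1 ∨ q n = -1 by lia) with h1 | h1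
    · rcases hq.tail_of_one h1 with ⟨N, hN⟩ | ⟨N, hN⟩
      exacts [⟨b, .inr rfl, N, .inl hN⟩, ⟨b, .inr rfl, N, .inr (.inl hN)⟩]
    · rcases hq.symm.tail_of_one (n := n) (by simp [h1]) with ⟨N, hN⟩ | ⟨N, hN⟩
      exacts [⟨a, .inl rfl, N, .inl hN⟩, ⟨a, .inl rfl, N, .inr (.inl hN)⟩]

/-- A closed equivalence relation on the compactum containing the glued pairs contains all pairs
with the same code. -/
theorem Admissible.rel_of_code_eq (h : Admissible r σ) (s : Setoid (compactum r σ))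
    (hg : ∀ a b : compactum r σ, Glue r σ a b → s a b)
    (hs : IsClosed {p : compactum r σ × compactum r σ | s p.1 p.2}) {a b : compactum r σ}
    (hab : code r σ a = code r σ b) : s a b := by
  have hR : IsClosedGluing (compactum r σ) (Glue r σ)
      (fun x y => ∃ (hx : x ∈ compactum r σ) (hy : y ∈ compactum r σ), s ⟨x, hx⟩ ⟨y, hy⟩) := by
    refine ⟨fun x hx => ⟨hx, hx, s.refl _⟩, ?_, ?_, fun x hx y hy hxy => ⟨hx, hy, hg _ _ hxy⟩, ?_⟩
    · rintro x y ⟨hx, hy, hxy⟩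
      exact ⟨hy, hx, s.symm hxy⟩
    · rintro x y z ⟨hx, hy, hxy⟩ ⟨_, hz, hyz⟩
      exact ⟨hx, hz, s.trans hxy hyz⟩
    · intro u v x y hx hy huv hu hv
      choose hu1 hv1 huv using huv
      refine ⟨hx, hy, ?_⟩
      have h1 : Tendsto (fun j => (⟨u j, hu1 j⟩ : compactum r σ)) atTop (𝓝 ⟨x, hx⟩) :=
        tendsto_subtype_rng.2 hu
      have h2 : Tendsto (fun j => (⟨v j, hv1 j⟩ : compactum r σ)) atTop (𝓝 ⟨y, hy⟩) :=
        tendsto_subtype_rng.2 hv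
      exact hs.mem_of_tendsto (h1.prodMk_nhds h2) (.of_forall huv)
  obtain ⟨a, ha⟩ := a
  obtain ⟨b, hb⟩ := b
  suffices H : ∃ (hx : a ∈ compactum r σ) (hy : b ∈ compactum r σ), s ⟨a, hx⟩ ⟨b, hy⟩ from H.2.2
  exact h.closedGluing_of_code_eq hR ha hb hab

end Carry
end ArithCoding

namespace ArithCoding
open Filter Topology

/-! ### The quotient as the torus, and uniqueness of its group law. -/

section GluedSpace

variable {r : ℕ} {σ : ℤ}

theorem Admissible.continuous_code_subtype (h : Admissible r σ) :
    Continuous fun a : compactum r σ => code r σ a :=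
  continuousOn_iff_continuous_domRestrict.1 ((h.continuousOn_code r).mono fun _ ha => h.le_of_mem ha)

/-- The identifications are exactly the coincidences of the universal coding. -/
theorem Admissible.gluing_iff (h : Admissible r σ) (a b : compactum r σ) :
    gluing r σ a b ↔ code r σ a = code r σ b := by
  constructor
  · intro hab
    -- Equality of codes is itself a closed equivalence relation containing the glues, so the
    -- smallest such relation is contained in it.
    have hmem : Setoid.ker (fun a : compactum r σ => code r σ a) ∈
        {s : Setoid (compactum r σ) | (∀ a b : compactum r σ, Glue r σ a b → s a b) ∧
          IsClosed {p : compactum r σ × compactum r σ | s p.1 p.2}} := by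
      refine ⟨fun a b hg => h.code_eq_of_glue a.2 b.2 hg, ?_⟩
      exact isClosed_eq (h.continuous_code_subtype.comp continuous_fst)
        (h.continuous_code_subtype.comp continuous_snd)
    exact hab _ hmem
  · rintro hab s ⟨hg, hs⟩
    exact h.rel_of_code_eq s hg hs hab

theorem Admissible.compactSpace_compactum (h : Admissible r σ) : CompactSpace (compactum r σ) :=
  isCompact_iff_compactSpace.1 h.isCompact_compactum

theorem Admissible.compactSpace (h : Admissible r σ) : CompactSpace (GluedSpace r σ) := by
  have := h.compactSpace_compactum
  exact inferInstanceAs (CompactSpace (Quotient (gluing r σ)))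

theorem continuous_proj : Continuous (proj r σ) := continuous_quotient_mk'

theorem proj_surjective : Function.Surjective (proj r σ) := Quotient.mk_surjective

/-- The factor space is in bijection with the torus. -/
noncomputable def gluedEquiv (h : Admissible r σ) : GluedSpace r σ ≃ Torus :=
  Equiv.ofBijective
    (Quotient.lift (fun a : compactum r σ => code r σ a) fun a b hab => (h.gluing_iff a b).1 hab) <| by
    constructor
    · intro p q
      refine Quotient.inductionOn₂ p q fun a b hab => Quotient.sound ((h.gluing_iff a b).2 hab)
    · intro x
      obtain ⟨a, ha, hx⟩ := h.code_surjOn x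
      exact ⟨proj r σ ⟨a, ha⟩, hx⟩

theorem continuous_gluedEquiv (h : Admissible r σ) : Continuous (gluedEquiv h) :=
  Continuous.quotient_lift h.continuous_code_subtype _

theorem Admissible.t2Space (h : Admissible r σ) : T2Space (GluedSpace r σ) :=
  T2Space.of_injective_continuous (gluedEquiv h).injective (continuous_gluedEquiv h)

/-- The factor space is homeomorphic to the torus. -/
noncomputable def gluedHomeo (h : Admissible r σ) : GluedSpace r σ ≃ₜ Torus :=
  haveI := h.compactSpace
  Continuous.homeoOfEquivCompactToT2 (f := gluedEquiv h) (continuous_gluedEquiv h)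

theorem gluedHomeo_proj (h : Admissible r σ) (a : compactum r σ) :
    gluedHomeo h (proj r σ a) = code r σ a := rfl

theorem Admissible.isNormalizationGroup_transport (h : Admissible r σ) :
    IsNormalizationGroup r σ (gluedHomeo h).toEquiv.addCommGroup := by
  let := (gluedHomeo h).toEquiv.addCommGroup
  have hadd : ∀ p q : GluedSpace r σ, p + q =
    (gluedHomeo h).symm (gluedHomeo h p + gluedHomeo h q) := fun p q => rfl
  have hneg : ∀ p : GluedSpace r σ, -p = (gluedHomeo h).symm (-gluedHomeo h p) := fun p => rfl
  refine ⟨{ continuous_add := ?_, continuous_neg := ?_ }, fun a b z hz => ?_, fun a z hz => ?_⟩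
  · simp only [hadd]
    fun_prop
  · simp only [hneg]
    fun_prop
  · rw [hadd, Homeomorph.symm_apply_eq, gluedHomeo_proj, gluedHomeo_proj, gluedHomeo_proj,
      ← h.code_add (h.le_of_mem a.2) (h.le_of_mem b.2)]
    exact h.code_eq_of_isNormalization
      (fun n => add_le_add (h.le_of_mem a.2 n) (h.le_of_mem b.2 n)) hz
  · rw [hneg, Homeomorph.symm_apply_eq, gluedHomeo_proj, gluedHomeo_proj, ← h.code_reflect a.2]
    exact h.code_eq_of_isNormalization (reflect_le _) hz

/-- Finitely supported sequences with the same value are related by normalization. -/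
theorem isNormalization_of_value_eq {x z : ℤ →₀ ℕ} (hz : ⇑z ∈ compactum r σ)
    (hxz : value r σ z = value r σ x) : IsNormalization r σ x z := by
  refine ⟨hz, ?_⟩
  obtain ⟨B, hB⟩ : ∃ B : ℕ, ∀ n ∈ x.support ∪ z.support, n.natAbs < B :=
    ⟨(x.support ∪ z.support).sup Int.natAbs + 1, fun n hn =>
      Nat.lt_succ_of_le (Finset.le_sup (f := Int.natAbs) hn)⟩
  have hBpos : (0 : ℤ) < 2 * (B + 1) := by positivity
  -- Equal blocks of length `2 * (B + 1)`: the block with index 0 contains both supports, and all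
  -- others see only zeros.
  refine ⟨fun j => -(B + 1) + j * (2 * (B + 1)), fun i j hij => ?_, fun j => ?_⟩
  · have := mul_lt_mul_of_pos_right hij hBpos
    simpa using this
  · by_cases hj : j = 0
    · subst hj
      have hsub : x.support ∪ z.support ⊆ Finset.Ioc (-((B : ℤ) + 1) + 0 * (2 * (B + 1)))
          (-(B + 1) + (0 + 1) * (2 * (B + 1))) := fun n hn => by
        have := hB n hn
        rw [Finset.mem_Ioc]
        lia
      rw [← value_eq_sum x (Finset.subset_union_left.trans hsub),
        ← value_eq_sum z (Finset.subset_union_right.trans hsub), hxz]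
    · have hzero : ∀ n ∈ Finset.Ioc (-((B : ℤ) + 1) + j * (2 * (B + 1)))
          (-(B + 1) + (j + 1) * (2 * (B + 1))), x n = 0 ∧ z n = 0 := by
        intro n hn
        have hnot : n ∉ x.support ∪ z.support := fun hmem => by
          have h1 := hB n hmem
          rw [Finset.mem_Ioc] at hn
          have h2 : -(B : ℤ) < n := by lia
          have h3 : n < B := by lia
          rcases lt_or_gt_of_ne hj with hj | hj <;> nlinarith
        simp only [Finset.mem_union, Finsupp.mem_support_iff] at hnot
        lia
      rw [Finset.sum_eq_zero, Finset.sum_eq_zero]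
      · intro n hn
        simp [(hzero n hn).2]
      · intro n hn
        simp [(hzero n hn).1]

/-- Every normalization group is the torus. -/
theorem IsNormalizationGroup.gluedHomeo_add (h : Admissible r σ) {G : AddCommGroup (GluedSpace r σ)}
    (hG : IsNormalizationGroup r σ G) (p q : GluedSpace r σ) :
    gluedHomeo h (p + q) = gluedHomeo h p + gluedHomeo h q := by
  have := hG.isTopologicalAddGroup
  obtain ⟨a, rfl⟩ := proj_surjective p
  obtain ⟨b, rfl⟩ := proj_surjective q
  -- Truncations stay in the compactum, and their sums have finite normalizations, so `proj_add`
  -- determines those sums. Continuity of the given addition extends this to all points.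
  set u : compactum r σ → ℕ → compactum r σ := fun a j =>
    ⟨restrict (Finset.Icc (-j : ℤ) j) a, h.restrict_mem a.2 _⟩ with hu
  have hlim : ∀ a, Tendsto (u a) atTop (𝓝 a) := fun a =>
    tendsto_subtype_rng.2 (tendsto_restrict a)
  have hp : ∀ a, Tendsto (fun j => proj r σ (u a j)) atTop (𝓝 (proj r σ a)) := fun a =>
    (continuous_proj.tendsto a).comp (hlim a)
  have hl := ((gluedHomeo h).continuous.tendsto _).comp ((hp a).add (hp b))
  have hr := (((gluedHomeo h).continuous.tendsto _).comp (hp a)).add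
    (((gluedHomeo h).continuous.tendsto _).comp (hp b))
  refine tendsto_nhds_unique hl (hr.congr fun j => ?_)
  simp only [Function.comp_apply]
  obtain ⟨z, hz, hv⟩ := h.exists_normal (restrict (Finset.Icc (-j : ℤ) j) a +
    restrict (Finset.Icc (-j : ℤ) j) b)
  have hn := isNormalization_of_value_eq hz hv
  rw [Finsupp.coe_add] at hn
  have e : proj r σ (u a j) + proj r σ (u b j) = proj r σ ⟨z, hz⟩ := hG.proj_add _ _ ⟨z, hz⟩ hn
  rw [e, gluedHomeo_proj, gluedHomeo_proj, gluedHomeo_proj,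
    ← h.code_add (h.le_of_mem (u a j).2) (h.le_of_mem (u b j).2)]
  exact h.code_eq_of_isNormalization (B := r + r)
    (fun n => add_le_add (h.le_of_mem (u a j).2 n) (h.le_of_mem (u b j).2 n)) hn

/-- There is exactly one normalization group. -/
theorem Admissible.existsUnique_group (h : Admissible r σ) :
    ∃! G : AddCommGroup (GluedSpace r σ), IsNormalizationGroup r σ G := by
  refine ⟨_, h.isNormalizationGroup_transport, fun G hG => AddCommGroup.ext ?_⟩
  funext p q
  apply (gluedHomeo h).injective
  rw [hG.gluedHomeo_add h]
  let := (gluedHomeo h).toEquiv.addCommGroup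
  exact ((gluedHomeo h).apply_symm_apply _).symm

end GluedSpace
end ArithCoding

namespace ArithCoding
open Filter Topology

/-! ### Coding maps factor through the universal coding. -/

section CodingMaps

variable {r : ℕ} {σ : ℤ}

theorem Admissible.green_succ_coe (h : Admissible r σ) (n : ℤ) :
    ((green r σ (n + 1) : ℝ) : UnitAddCircle) =
      (σ * r) • (green r σ n : UnitAddCircle) + (-σ) • (green r σ (n - 1) : UnitAddCircle) := by
  have h1 := h.green_rec n
  obtain ⟨k, hk⟩ : ∃ k : ℤ, (if n = 0 then (1 : ℝ) else 0) = k := by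
    split_ifs
    exacts [⟨1, by simp⟩, ⟨0, by simp⟩]
  rw [hk] at h1
  have h2 : green r σ (n + 1) = ((σ * r : ℤ) : ℝ) * green r σ n +
      ((-σ : ℤ) : ℝ) * green r σ (n - 1) - ((σ * k : ℤ) : ℝ) := by
    push_cast
    linear_combination (-σ : ℝ) * h1 - green r σ (n + 1) * h.sign_sq
  rw [h2, AddCircle.coe_sub, AddCircle.coe_add, coe_int_mul, coe_int_mul, coe_int_eq_zero, sub_zero]

theorem Admissible.green_pred_coe (h : Admissible r σ) (n : ℤ) :
    ((green r σ (n - 1) : ℝ) : UnitAddCircle) =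
      (r : ℤ) • (green r σ n : UnitAddCircle) + (-σ) • (green r σ (n + 1) : UnitAddCircle) := by
  have h1 := h.green_rec n
  obtain ⟨k, hk⟩ : ∃ k : ℤ, (if n = 0 then (1 : ℝ) else 0) = k := by
    split_ifs
    exacts [⟨1, by simp⟩, ⟨0, by simp⟩]
  rw [hk] at h1
  have h2 : green r σ (n - 1) = ((r : ℤ) : ℝ) * green r σ n +
      ((-σ : ℤ) : ℝ) * green r σ (n + 1) - (k : ℝ) := by
    push_cast
    linear_combination -h1
  rw [h2, AddCircle.coe_sub, AddCircle.coe_add, coe_int_mul, coe_int_mul, coe_int_eq_zero, sub_zero]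

/-- Modulo `1`, translates of the fundamental solution are integer combinations of two of them. -/
theorem Admissible.exists_green_add_coe (h : Admissible r σ) (m : ℤ) :
    ∃ α β : ℤ, ∀ n, ((green r σ (m + n) : ℝ) : UnitAddCircle) =
      α • (green r σ n : UnitAddCircle) + β • (green r σ (n - 1) : UnitAddCircle) := by
  induction m using Int.induction_on with
  | zero => exact ⟨1, 0, fun n => by simp⟩
  | succ m ih =>
    obtain ⟨α, β, hab⟩ := ih
    refine ⟨α * (σ * r) + β, α * (-σ), fun n => ?_⟩
    rw [show (m : ℤ) + 1 + n = m + (n + 1) by ring, hab, add_sub_cancel_right, h.green_succ_coe,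
      smul_add, smul_smul, smul_smul, add_smul]
    abel
  | pred m ih =>
    obtain ⟨α, β, hab⟩ := ih
    refine ⟨β * (-σ), α + β * r, fun n => ?_⟩
    rw [show -(m : ℤ) - 1 + n = -m + (n - 1) by ring, hab, h.green_pred_coe (n - 1), sub_add_cancel,
      smul_add, smul_smul, smul_smul, add_smul]
    abel

theorem exists_small_lift (x : UnitAddCircle) :
    ∃ g : ℝ, (g : UnitAddCircle) = x ∧ |g| = ‖x‖ ∧ |g| ≤ 1 / 2 := by
  obtain ⟨y, rfl⟩ := QuotientAddGroup.mk_surjective x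
  refine ⟨y - round y, ?_, (UnitAddCircle.norm_eq).symm, abs_sub_round y⟩
  rw [AddCircle.coe_sub, coe_int_eq_zero, sub_zero]

/-- A solution of the recursion on the circle that vanishes at infinity is an integer combination
of translates of the fundamental solution. -/
theorem Admissible.exists_coeff (h : Admissible r σ) (τ : ℤ → UnitAddCircle)
    (hrec : ∀ n, τ (n - 1) = (r : ℤ) • τ n - σ • τ (n + 1))
    (hlim : Tendsto τ cofinite (𝓝 0)) :
    ∃ α β : ℤ, ∀ n, τ n =
      α • (green r σ n : UnitAddCircle) + β • (green r σ (n - 1) : UnitAddCircle) := by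
  -- Shortest lifts still tend to 0, so the integer defect `k` of their recursion tends to 0 and has
  -- finite support.
  choose g hg hgn hgb using fun n => exists_small_lift (τ n)
  have hg0 : Tendsto g cofinite (𝓝 0) := by
    rw [tendsto_zero_iff_norm_tendsto_zero] at hlim ⊢
    exact hlim.congr fun n => (hgn n).symm
  have hk : ∀ n, ∃ k : ℤ, (k : ℝ) = r * g n - g (n - 1) - σ * g (n + 1) := fun n => by
    rw [← coe_eq_zero_iff_int, AddCircle.coe_sub, AddCircle.coe_sub, coe_int_mul,
      show ((r : ℝ) * g n) = ((r : ℤ) : ℝ) * g n by simp, coe_int_mul, hg, hg, hg, hrec]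
    abel
  choose k hk using hk
  have hfin : {n | k n ≠ 0}.Finite := by
    have h1 : Tendsto (fun n => g (n - 1)) cofinite (𝓝 0) :=
      hg0.comp (sub_left_injective (b := (1 : ℤ))).tendsto_cofinite
    have h2 : Tendsto (fun n => g (n + 1)) cofinite (𝓝 0) :=
      hg0.comp (add_left_injective (1 : ℤ)).tendsto_cofinite
    have h3 := ((hg0.const_mul (r : ℝ)).sub h1).sub (h2.const_mul (σ : ℝ))
    simp only [mul_zero, sub_zero, ← hk] at h3
    have h4 := h3.eventually (eventually_abs_sub_lt 0 one_pos)
    refine h4.mono fun n hn => ?_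
    have : |k n| < 1 := by
      rw [sub_zero] at hn
      exact_mod_cast hn
    exact Int.abs_lt_one_iff.1 this
  -- The recursion for `g` runs opposite to `charOp`, whence the reversal. The bounded lift is
  -- recovered from its finitely supported defect as a finite combination of translates of `green`.
  have hpot := h.potential_charOp (q := fun n => g (-n)) (B := 1 / 2) fun n => hgb (-n)
  have hsum : ∀ n, g n = ∑ m ∈ (hfin.toFinset.image fun n => -n), green r σ (m + n) * k (-m) := by
    intro n
    have := hpot (-n)
    simp only [neg_neg] at this
    rw [← this]
    unfold potential
    refine (tsum_congr fun m => ?_).trans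
      (tsum_eq_sum (f := fun m => green r σ (m + n) * (k (-m) : ℝ)) ?_)
    · rw [sub_neg_eq_add, hk, charOp, show -(m + 1) = -m - 1 by ring,
        show -(m - 1) = -m + 1 by ring]
    · intro m hm
      have : k (-m) = 0 := by
        by_contra hne
        exact hm (Finset.mem_image.2 ⟨-m, by simpa using hne, by simp⟩)
      simp [this]
  choose α β hab using h.exists_green_add_coe
  refine ⟨∑ m ∈ (hfin.toFinset.image fun n => -n), k (-m) * α m,
    ∑ m ∈ (hfin.toFinset.image fun n => -n), k (-m) * β m, fun n => ?_⟩
  have hcoe : ∀ (s : Finset ℤ) (f : ℤ → ℝ), ((∑ m ∈ s, f m : ℝ) : UnitAddCircle) =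
      ∑ m ∈ s, (f m : UnitAddCircle) := fun s f =>
    map_sum (QuotientAddGroup.mk' (AddSubgroup.zmultiples (1 : ℝ))) f s
  rw [← hg n, hsum n, hcoe, Finset.sum_smul, Finset.sum_smul, ← Finset.sum_add_distrib]
  refine Finset.sum_congr rfl fun m _ => ?_
  rw [mul_comm, coe_int_mul, hab, smul_add, smul_smul, smul_smul]

theorem Admissible.mem_primarySpace (h : Admissible r σ) {B : ℕ} {a : ℤ → ℕ}
    (ha : ∀ n, a n ≤ B) : a ∈ primarySpace (dominantRoot r σ) := by
  have hs : Summable fun n : ℕ => (B : ℝ) * (dominantRoot r σ)⁻¹ ^ (n + 1) :=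
    ((summable_nat_add_iff 1).2 (summable_geometric_of_lt_one (inv_nonneg.2 h.pos.le)
      (inv_lt_one_of_one_lt₀ h.one_lt))).mul_left _
  have key : ∀ f : ℕ → ℤ, Summable fun n : ℕ => (a (f n) : ℝ) / dominantRoot r σ ^ (n + 1) := by
    intro f
    refine Summable.of_nonneg_of_le (fun n => div_nonneg (Nat.cast_nonneg _)
      (pow_pos h.pos _).le) (fun n => ?_) hs
    rw [inv_pow, ← div_eq_mul_inv]
    exact div_le_div_of_nonneg_right (by exact_mod_cast ha _) (pow_pos h.pos _).le
  exact ⟨key fun n => n + 1, key fun n => -(n + 1)⟩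

theorem sq_of_trace_det {M : Matrix (Fin 2) (Fin 2) ℤ} (ht : M.trace = r) (hd : M.det = σ) :
    M * M = !![r * M 0 0 - σ, r * M 0 1; r * M 1 0, r * M 1 1 - σ] := by
  rw [Matrix.trace_fin_two] at ht
  rw [Matrix.det_fin_two] at hd
  ext i j
  fin_cases i <;> fin_cases j <;>
    simp only [Matrix.mul_apply, Fin.sum_univ_two, Fin.zero_eta, Fin.mk_one, Matrix.of_apply,
      Matrix.cons_val', Matrix.cons_val_zero, Matrix.cons_val_one, Matrix.cons_val_fin_one]
  · linear_combination M 0 0 * ht - hd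
  · linear_combination M 0 1 * ht
  · linear_combination M 1 0 * ht
  · linear_combination M 1 1 * ht - hd

theorem toralMap_toralMap {M : Matrix (Fin 2) (Fin 2) ℤ} (ht : M.trace = r) (hd : M.det = σ)
    (x : Torus) : toralMap M (toralMap M x) = (r : ℤ) • toralMap M x - σ • x := by
  rw [← toralMap_mul, sq_of_trace_det ht hd]
  ext i
  fin_cases i <;> simp [toralMap_apply, -zsmul_eq_mul, -natCast_zsmul, sub_smul, mul_smul] <;> abel

theorem shift_unitDigit (n : ℤ) : shift (unitDigit n) = unitDigit (n - 1) := by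
  ext m
  simp only [shift, unitDigit, Pi.single_apply]
  congr 1
  exact propext ⟨fun h => by lia, fun h => by lia⟩

theorem tendsto_unitDigit : Tendsto unitDigit cofinite (𝓝 0) := by
  refine tendsto_pi_nhds.2 fun m => tendsto_const_nhds.congr' ?_
  filter_upwards [eventually_cofinite_ne m] with n hn
  simp [unitDigit, hn.symm]

theorem IsCodingMap.map_zero (h : Admissible r σ) {M : Matrix (Fin 2) (Fin 2) ℤ}
    {φ : (ℤ → ℕ) → Torus} (hφ : IsCodingMap M (dominantRoot r σ) φ) : φ 0 = 0 := by
  have h0 : (0 : ℤ → ℕ) ∈ primarySpace (dominantRoot r σ) :=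
    h.mem_primarySpace (B := 0) fun n => by simp
  simpa using hφ.map_add 0 h0 0 h0

/-- Every coding map factors through the universal coding by a toral endomorphism. -/
theorem IsCodingMap.exists_eq_toralMap (h : Admissible r σ) {M : Matrix (Fin 2) (Fin 2) ℤ}
    (ht : M.trace = r) (hd : M.det = σ) {φ : (ℤ → ℕ) → Torus}
    (hφ : IsCodingMap M (dominantRoot r σ) φ) :
    ∃ A : Matrix (Fin 2) (Fin 2) ℤ, ∀ (B : ℕ) (a : ℤ → ℕ), (∀ n, a n ≤ B) →
      φ a = toralMap A (code r σ a) := by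
  have hφ0 := hφ.map_zero h
  have hshift : ∀ n, φ (unitDigit (n - 1)) = toralMap M (φ (unitDigit n)) := fun n => by
    rw [← shift_unitDigit, hφ.map_shift _ (h.mem_primarySpace (unitDigit_le n))]
  have hrec : ∀ n, φ (unitDigit (n - 1)) =
      (r : ℤ) • φ (unitDigit n) - σ • φ (unitDigit (n + 1)) := fun n => by
    have h1 := hshift (n + 1)
    rw [add_sub_cancel_right] at h1
    rw [hshift, h1, toralMap_toralMap ht hd]
  -- The unit digits are bounded by 1 and tend to 0 coordinatewise in both directions, so their
  -- images form a homoclinic orbit.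
  have hlim : Tendsto (fun n => φ (unitDigit n)) cofinite (𝓝 0) := by
    have hc : ContinuousWithinAt φ {ε | ∀ n, ε n ≤ 1} 0 := hφ.continuousOn 1 0 fun n => by simp
    have := hc.tendsto.comp
      (tendsto_nhdsWithin_iff.2 ⟨tendsto_unitDigit, .of_forall unitDigit_le⟩)
    rwa [hφ0] at this
  choose α β hab using fun i => h.exists_coeff (fun n => φ (unitDigit n) i)
    (fun n => by rw [hrec]; rfl) ((continuous_apply i).tendsto _ |>.comp hlim)
  refine ⟨!![α 0, β 0; α 1, β 1], ?_⟩
  set A : Matrix (Fin 2) (Fin 2) ℤ := !![α 0, β 0; α 1, β 1]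
  have hunit : ∀ n, φ (unitDigit n) = toralMap A (code r σ (unitDigit n)) := fun n => by
    rw [code_unitDigit]
    ext i
    rw [hab i n, toralMap_apply]
    fin_cases i <;> simp [A]
  have hbd : ∀ (a : ℤ →₀ ℕ) n, a n ≤ a.degree := fun a n => Finsupp.le_degree n a
  have hadd : ∀ a b : ℤ →₀ ℕ, φ a = toralMap A (code r σ a) → φ b = toralMap A (code r σ b) →
      φ ⇑(a + b) = toralMap A (code r σ ⇑(a + b)) := fun a b ha hb => by
    rw [Finsupp.coe_add, hφ.map_add _ (h.mem_primarySpace (hbd a)) _ (h.mem_primarySpace (hbd b)),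
      h.code_add (hbd a) (hbd b), toralMap_add, ha, hb]
  have hzero : φ ⇑(0 : ℤ →₀ ℕ) = toralMap A (code r σ ⇑(0 : ℤ →₀ ℕ)) := by
    have e : code r σ ((0 : ℤ → ℕ)) = 0 := by
      have := h.code_add (a := 0) (b := 0) (B := 0) (C := 0) (fun n => by simp) fun n => by simp
      simpa using this
    rw [Finsupp.coe_zero, hφ0, e]
    exact ((toralHom A).map_zero).symm
  have hfinite : ∀ a : ℤ →₀ ℕ, φ a = toralMap A (code r σ a) := by
    intro a
    induction a using Finsupp.induction_linear with
    | zero => exact hzero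
    | add a b ha hb => exact hadd a b ha hb
    | single n k =>
      induction k with
      | zero => simpa using hzero
      | succ k ih =>
        rw [Finsupp.single_add]
        refine hadd _ _ ih ?_
        rw [Finsupp.single_eq_pi_single]
        exact hunit n
  intro B a ha
  have hb : ∀ (j : ℕ) n, restrict (Finset.Icc (-j : ℤ) j) a n ≤ B := fun j n =>
    (restrict_le _ a n).trans (ha n)
  have h1 := (hφ.continuousOn B a ha).tendsto.comp
    (tendsto_nhdsWithin_iff.2 ⟨tendsto_restrict a, .of_forall hb⟩)
  have h2 := ((continuous_toralMap A).tendsto _).comp (h.tendsto_code hb ha (tendsto_restrict a))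
  exact tendsto_nhds_unique h1 (h2.congr fun j => (hfinite _).symm)

theorem eq_zero_of_toralMap {D : Matrix (Fin 2) (Fin 2) ℤ} (hD : ∀ x, toralMap D x = 0) :
    D = 0 := by
  ext i j
  by_contra hne
  rw [Matrix.zero_apply] at hne
  -- A test point that a nonzero entry would send to the class of `1 / 2`.
  have h1 := congrFun (hD (Pi.single j ((1 / (2 * (D i j : ℝ)) : ℝ) : UnitAddCircle))) i
  have h2 : D i j • ((1 / (2 * (D i j : ℝ)) : ℝ) : UnitAddCircle) = 0 := by
    rw [toralMap_apply] at h1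
    fin_cases j <;> simpa [-zsmul_eq_mul] using h1
  rw [← coe_int_mul, coe_eq_zero_iff_int] at h2
  obtain ⟨k, hk⟩ := h2
  have : (D i j : ℝ) ≠ 0 := by exact_mod_cast hne
  field_simp at hk
  have : k * 2 = 1 := by exact_mod_cast hk
  lia

/-- For `σ = -1` a root would have to be `r + 1`, which parity excludes; for `σ = 1` and `r ≥ 3` the
discriminant lies strictly between `(r - 1) ^ 2` and `r ^ 2`. -/
theorem Admissible.not_isSquare_discr (h : Admissible r σ) (s : ℤ) :
    s ^ 2 ≠ (r : ℤ) ^ 2 - 4 * σ := by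
  intro hs
  rw [← sq_abs] at hs
  have h0 := abs_nonneg s
  generalize |s| = s at hs h0
  rcases h with ⟨rfl, hr⟩ | ⟨rfl, hr⟩
  · have h1 : (r : ℤ) < s := by nlinarith
    have h2 : s < r + 2 := by nlinarith
    obtain rfl : s = r + 1 := by lia
    ring_nf at hs
    lia
  · have h1 : s < (r : ℤ) := by nlinarith
    nlinarith

/-- A nontrivial integer zero would make the discriminant a perfect square. -/
theorem Admissible.form_ne_zero (h : Admissible r σ) {x y : ℤ} (hxy : x ≠ 0 ∨ y ≠ 0) :
    y ^ 2 - r * x * y + σ * x ^ 2 ≠ 0 := by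
  intro h0
  have hsq : (2 * y - r * x) ^ 2 = ((r : ℤ) ^ 2 - 4 * σ) * x ^ 2 := by linear_combination 4 * h0
  by_cases hx : x = 0
  · subst hx
    simp at h0 hxy
    exact hxy h0
  · have hdvd : x ∣ 2 * y - r * x := by
      rw [← Int.pow_dvd_pow_iff two_ne_zero, hsq]
      exact dvd_mul_left _ _
    obtain ⟨s, hs⟩ := hdvd
    rw [hs, mul_pow, mul_comm] at hsq
    exact h.not_isSquare_discr s (mul_right_cancel₀ (pow_ne_zero 2 hx) hsq)

/-- A nonzero intertwiner with the companion matrix is nonsingular. -/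
theorem Admissible.det_ne_zero_of_intertwine (h : Admissible r σ) {A M : Matrix (Fin 2) (Fin 2) ℤ}
    (hA : A ≠ 0) (hAM : A * !![0, 1; -σ, (r : ℤ)] = M * A) : A.det ≠ 0 := by
  intro hdet
  obtain ⟨v, hv, hAv⟩ := Matrix.exists_mulVec_eq_zero_iff.2 hdet
  have hv' : v 0 ≠ 0 ∨ v 1 ≠ 0 := by
    by_contra! hcon
    exact hv (by ext i; fin_cases i <;> simp [hcon])
  have hw : Matrix.mulVec A (Matrix.mulVec !![0, 1; -σ, (r : ℤ)] v) = 0 := by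
    rw [Matrix.mulVec_mulVec, hAM, ← Matrix.mulVec_mulVec, hAv, Matrix.mulVec_zero]
  -- The columns are a kernel vector of `A` and its image under the companion matrix, also in the
  -- kernel. The determinant is minus the anisotropic form at `v`, so the columns are independent
  -- and `A` would be zero.
  set V : Matrix (Fin 2) (Fin 2) ℤ := !![v 0, v 1; v 1, -σ * v 0 + r * v 1] with hV
  have hAV : A * V = 0 := by
    ext i j
    have e1 := congrFun hAv i
    have e2 := congrFun hw i
    simp only [Matrix.mulVec, dotProduct, Fin.sum_univ_two, Pi.zero_apply, Matrix.of_apply,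
      Matrix.cons_val', Matrix.cons_val_zero, Matrix.cons_val_one, Matrix.cons_val_fin_one,
      zero_mul, one_mul, zero_add] at e1 e2
    fin_cases j
    · simpa [Matrix.mul_apply, Fin.sum_univ_two, hV] using e1
    · simpa [Matrix.mul_apply, Fin.sum_univ_two, hV] using e2
  have hVdet : V.det ≠ 0 := by
    have := h.form_ne_zero hv'
    rw [hV, Matrix.det_fin_two_of]
    intro h0
    exact this (by linear_combination -h0)
  have : V.det • A = 0 := by
    rw [← Matrix.mul_one A, ← Matrix.mul_smul, ← Matrix.mul_adjugate, ← Matrix.mul_assoc, hAV,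
      Matrix.zero_mul]
  exact hA ((smul_eq_zero.1 this).resolve_left hVdet)

/-- The toral endomorphism of a coding map that is nontrivial on the compactum is nonsingular. -/
theorem IsCodingMap.det_ne_zero (h : Admissible r σ) {M A : Matrix (Fin 2) (Fin 2) ℤ}
    {φ : (ℤ → ℕ) → Torus} (hφ : IsCodingMap M (dominantRoot r σ) φ)
    (hA : ∀ (B : ℕ) (a : ℤ → ℕ), (∀ n, a n ≤ B) → φ a = toralMap A (code r σ a))
    (hne : ∃ a ∈ compactum r σ, φ a ≠ 0) : A.det ≠ 0 := by
  refine h.det_ne_zero_of_intertwine (M := M) ?_ ?_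
  · rintro rfl
    obtain ⟨a, ha, hne⟩ := hne
    refine hne ?_
    rw [hA r a (h.le_of_mem ha)]
    ext i
    simp [toralMap_apply]
  · rw [← sub_eq_zero]
    refine eq_zero_of_toralMap fun x => ?_
    obtain ⟨a, ha, rfl⟩ := h.code_surjOn x
    have ha' := h.le_of_mem ha
    have h1 := hφ.map_shift a (h.mem_primarySpace ha')
    have h2 : code r σ (shift a) = toralMap !![0, 1; -σ, (r : ℤ)] (code r σ a) :=
      h.torusCode_shift (cast_mem_boundedSeq ha')
    rw [hA r a ha', hA r (shift a) fun n => ha' _, h2, ← toralMap_mul, ← toralMap_mul] at h1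
    ext i
    have h3 := congrFun h1 i
    simp only [toralMap_apply] at h3
    simp only [toralMap_apply, Matrix.sub_apply, sub_smul, Pi.zero_apply]
    rw [← sub_eq_zero] at h3
    rw [← h3]
    abel

end CodingMaps
end ArithCoding

namespace ArithCoding
open Filter Topology MeasureTheory

/-! ### Nonsingular toral endomorphisms and Lebesgue measure. -/

section NonsingularMaps

variable {A : Matrix (Fin 2) (Fin 2) ℤ}

theorem toralMap_surjective (hA : A.det ≠ 0) : Function.Surjective (toralMap A) := by
  have hdiv : ∀ u : UnitAddCircle, ∃ v : UnitAddCircle, A.det • v = u := fun u => by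
    obtain ⟨y, rfl⟩ := QuotientAddGroup.mk_surjective u
    refine ⟨((y / A.det : ℝ) : UnitAddCircle), ?_⟩
    rw [← coe_int_mul, mul_div_cancel₀ _ (by exact_mod_cast hA)]
  intro x
  choose v hv using fun i => hdiv (x i)
  refine ⟨toralMap A.adjugate v, ?_⟩
  rw [← toralMap_mul, Matrix.mul_adjugate]
  ext i
  rw [toralMap_apply, ← hv]
  fin_cases i <;> simp [-zsmul_eq_mul]

theorem finite_ker_toralMap (hA : A.det ≠ 0) : {x | toralMap A x = 0}.Finite := by
  have hcirc : {u : UnitAddCircle | A.det • u = 0}.Finite :=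
    AddCircle.finite_torsion_of_isSMulRegular_int _ _ <|
      .of_right_eq_zero_of_smul fun _ h0 => (smul_eq_zero.1 h0).resolve_left hA
  refine (Set.Finite.pi' fun _ : Fin 2 => hcirc).subset fun x hx i => ?_
  have h1 : toralMap (A.adjugate * A) x = 0 := by
    rw [toralMap_mul, show toralMap A x = 0 from hx]
    exact (toralHom A.adjugate).map_zero
  rw [Matrix.adjugate_mul] at h1
  have h2 := congrFun h1 i
  rw [toralMap_apply] at h2
  fin_cases i <;> simpa [-zsmul_eq_mul] using h2

/-- The degree of a toral endomorphism. -/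
noncomputable def toralDegree (A : Matrix (Fin 2) (Fin 2) ℤ) : ℕ := {x | toralMap A x = 0}.ncard

theorem toralDegree_pos (hA : A.det ≠ 0) : 0 < toralDegree A :=
  (Set.ncard_pos (finite_ker_toralMap hA)).2 ⟨0, (toralHom A).map_zero⟩

theorem ncard_fibre_toralMap (hA : A.det ≠ 0) (x : Torus) :
    {y | toralMap A y = x}.ncard = toralDegree A := by
  obtain ⟨y, rfl⟩ := toralMap_surjective hA x
  have himage : {z | toralMap A z = toralMap A y} = (fun z => y + z) '' {x | toralMap A x = 0} := by
    ext z
    constructor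
    · intro hz
      refine ⟨z - y, ?_, by simp⟩
      have := (toralHom A).map_sub z y
      simp only [toralHom_apply] at this
      rw [Set.mem_ofPred_eq, this, show toralMap A z = toralMap A y from hz, sub_self]
    · rintro ⟨w, hw, rfl⟩
      rw [Set.mem_ofPred_eq, toralMap_add, show toralMap A w = 0 from hw, add_zero]
  rw [himage, Set.ncard_image_of_injective _ (add_right_injective y), toralDegree]

instance : IsProbabilityMeasure (volume : Measure UnitAddCircle) := ⟨UnitAddCircle.measure_univ⟩

instance : (volume : Measure Torus).IsAddHaarMeasure :=
  inferInstanceAs (Measure.pi fun _ : Fin 2 => (volume : Measure UnitAddCircle)).IsAddHaarMeasure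

theorem measurePreserving_toralMap (hA : A.det ≠ 0) :
    MeasurePreserving (toralMap A) volume volume := by
  have hc := continuous_toralMap A
  refine ⟨hc.measurable, ?_⟩
  have h1 : (Measure.map (toralMap A) volume).IsAddHaarMeasure :=
    Measure.isAddHaarMeasure_map_of_isFiniteMeasure volume (toralHom A) hc (toralMap_surjective hA)
  have h2 : IsProbabilityMeasure (Measure.map (toralMap A) volume) :=
    Measure.isProbabilityMeasure_map hc.aemeasurable
  exact Measure.isAddHaarMeasure_eq_of_isProbabilityMeasure _ _

theorem volume_singleton_torus (x : Torus) : volume ({x} : Set Torus) = 0 := by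
  have hcirc : ∀ u : UnitAddCircle, volume ({u} : Set UnitAddCircle) = 0 := fun u => by
    have := AddCircle.volume_closedBall (T := 1) (x := u) 0
    simpa using this
  rw [← Set.univ_pi_singleton, volume_pi, Measure.pi_pi]
  simp [hcirc]

/-- The image of a compact null set under a nonsingular toral endomorphism is null. -/
theorem volume_image_toralMap (hA : A.det ≠ 0) {s : Set Torus} (hs : IsCompact s)
    (h0 : volume s = 0) : volume (toralMap A '' s) = 0 := by
  have hc := continuous_toralMap A
  rw [← (measurePreserving_toralMap hA).measure_preimage
    (hs.image hc).isClosed.measurableSet.nullMeasurableSet]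
  -- The preimage of the image is covered by the finitely many translates of `s` by kernel elements.
  -- Compactness of `s` makes the image measurable.
  refine measure_mono_null (t := ⋃ k ∈ {x | toralMap A x = 0}, (fun x => x - k) ⁻¹' s) ?_
    ((measure_biUnion_null_iff (finite_ker_toralMap hA).countable).2 fun k _ => ?_)
  · rintro x ⟨y, hy, hxy⟩
    refine Set.mem_biUnion (x := x - y) ?_ (by simpa using hy)
    have := (toralHom A).map_sub x y
    simp only [toralHom_apply] at this
    rw [Set.mem_ofPred_eq, this, hxy, sub_self]
  · simp only [sub_eq_add_neg, measure_preimage_add_right, h0]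

/-- A set that a measure preserving map contracts into small neighborhoods of `0` is null. -/
theorem volume_eq_zero_of_contracting {f : Torus → Torus} (hf : MeasurePreserving f volume volume)
    (F : ℕ → Set Torus) (hF : ∀ k, F k ⊆ f ⁻¹' F (k + 1))
    (hU : ∀ U : Set Torus, IsOpen U → (0 : Torus) ∈ U → ∃ k, F k ⊆ U) : volume (F 0) = 0 := by
  have hit : ∀ k, F 0 ⊆ f^[k] ⁻¹' F k := fun k => by
    induction k with
    | zero => exact subset_rfl
    | succ k ih =>
      rw [Function.iterate_succ']
      exact fun x hx => hF k (ih hx)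
  refine le_antisymm (le_of_forall_gt fun ε hε => ?_) zero_le
  -- Points are null, so 0 has neighbourhoods of small measure. Once `F k` is inside one, `F 0` lies
  -- in its preimage under the `k`-th iterate, of the same measure.
  obtain ⟨U, h0U, hUo, hUε⟩ := Set.exists_isOpen_lt_of_lt {(0 : Torus)} ε
    (by rwa [volume_singleton_torus])
  obtain ⟨k, hk⟩ := hU U hUo (h0U rfl)
  refine lt_of_le_of_lt ?_ hUε
  rw [← (hf.iterate k).measure_preimage hUo.measurableSet.nullMeasurableSet]
  exact measure_mono fun x hx => hk (hit k hx)

end NonsingularMaps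

/-! ### Sequences with exceptional tails have null codes. -/

section TailSets

variable {r : ℕ} {σ : ℤ}

theorem torusCode_zero : torusCode r σ 0 = 0 := by
  have := torusCode_neg (r := r) (σ := σ) 0
  ext i
  fin_cases i <;> simp [torusCode, potential]

variable (r σ) in
/-- The codes of the sequences bounded by `B` that vanish on `s`. -/
noncomputable def vanishingCodes (B : ℕ) (s : Set ℤ) : Set Torus :=
  torusCode r σ '' {d | d ∈ boundedSeq B ∧ ∀ n ∈ s, d n = 0}

/-- Sequences vanishing on sets that eventually contain each place converge coordinatewise to 0, and
the bound `B` is uniform, so their codes converge to 0. -/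
theorem Admissible.exists_vanishingCodes_subset (h : Admissible r σ) (B : ℕ) {s : ℕ → Set ℤ}
    (hs : ∀ n, ∀ᶠ k in atTop, n ∈ s k) {U : Set Torus} (hU : IsOpen U) (h0 : (0 : Torus) ∈ U) :
    ∃ k, vanishingCodes r σ B (s k) ⊆ U := by
  by_contra! hcon
  have hcon' : ∀ k, ∃ d, (d ∈ boundedSeq B ∧ ∀ n ∈ s k, d n = 0) ∧ torusCode r σ d ∉ U := fun k => by
    obtain ⟨_, ⟨d, hd, rfl⟩, hdU⟩ := Set.not_subset.1 (hcon k)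
    exact ⟨d, hd, hdU⟩
  choose d hd hdU using hcon'
  have hlim := h.tendsto_torusCode (d := 0) (e := d) (B := B) (fun k => (hd k).1)
    (fun n => by simp) fun n => (hs n).mono fun k hk => (hd k).2 n hk
  rw [torusCode_zero] at hlim
  obtain ⟨k, hk⟩ := (hlim.eventually (hU.mem_nhds h0)).exists
  exact hdU k hk

theorem Admissible.det_shift_ne_zero (h : Admissible r σ) :
    (!![0, 1; -σ, (r : ℤ)] : Matrix (Fin 2) (Fin 2) ℤ).det ≠ 0 := by
  rw [Matrix.det_fin_two_of]
  rcases h with ⟨rfl, -⟩ | ⟨rfl, -⟩ <;> simp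

theorem Admissible.det_unshift_ne_zero (h : Admissible r σ) :
    (!![σ * r, -σ; 1, 0] : Matrix (Fin 2) (Fin 2) ℤ).det ≠ 0 := by
  rw [Matrix.det_fin_two_of]
  rcases h with ⟨rfl, -⟩ | ⟨rfl, -⟩ <;> simp

/-- Each shift moves the beginning of the zero half-line one place left, so the iterates contract
the set to 0 while preserving measure. For zeros on the left the inverse shift plays the same role.
-/
theorem Admissible.volume_vanishingCodes_Ioi (h : Admissible r σ) (B : ℕ) (N : ℤ) :
    volume (vanishingCodes r σ B (Set.Ioi N)) = 0 := by
  have := volume_eq_zero_of_contracting (measurePreserving_toralMap h.det_shift_ne_zero)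
    (fun k => vanishingCodes r σ B (Set.Ioi (N - k))) ?_ fun U hU h0 =>
      h.exists_vanishingCodes_subset B (fun n => ?_) hU h0
  · simpa using this
  · rintro k _ ⟨d, ⟨hd, hd0⟩, rfl⟩
    rw [Set.mem_preimage, ← h.torusCode_shift hd]
    refine ⟨_, ⟨fun n => hd _, fun n hn => hd0 _ ?_⟩, rfl⟩
    simp only [Set.mem_Ioi] at hn ⊢
    push_cast at hn
    lia
  · filter_upwards [eventually_gt_atTop (N - n).toNat] with k hk
    simp only [Set.mem_Ioi]
    lia

theorem Admissible.volume_vanishingCodes_Iio (h : Admissible r σ) (B : ℕ) (N : ℤ) :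
    volume (vanishingCodes r σ B (Set.Iio N)) = 0 := by
  have := volume_eq_zero_of_contracting (measurePreserving_toralMap h.det_unshift_ne_zero)
    (fun k => vanishingCodes r σ B (Set.Iio (N + k))) ?_ fun U hU h0 =>
      h.exists_vanishingCodes_subset B (fun n => ?_) hU h0
  · simpa using this
  · rintro k _ ⟨d, ⟨hd, hd0⟩, rfl⟩
    rw [Set.mem_preimage, ← h.torusCode_unshift hd]
    refine ⟨_, ⟨fun n => hd _, fun n hn => hd0 _ ?_⟩, rfl⟩
    simp only [Set.mem_Iio] at hn ⊢
    push_cast at hn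
    lia
  · filter_upwards [eventually_gt_atTop (n - N).toNat] with k hk
    simp only [Set.mem_Iio]
    lia

variable (r σ) in
/-- The codes of the sequences of digits that agree with `c` on `s`. -/
noncomputable def tailCodes (s : Set ℤ) (c : ℤ → ℕ) : Set Torus :=
  code r σ '' {a | (∀ n, a n ≤ r) ∧ ∀ n ∈ s, a n = c n}

theorem Admissible.isCompact_tailCodes (h : Admissible r σ) (s : Set ℤ) (c : ℤ → ℕ) :
    IsCompact (tailCodes r σ s c) := by
  refine IsCompact.image_of_continuousOn ?_ ((h.continuousOn_code r).mono fun a ha => ha.1)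
  refine (isCompact_boundedDigits r).inter_right (t := {a | ∀ n ∈ s, a n = c n}) ?_
  simp only [Set.ofPred_forall]
  exact isClosed_biInter fun n _ => isClosed_eq (continuous_apply n) continuous_const

/-- Subtracting `c` makes the differences vanish on `s`, so the codes lie in a translate of a set of
vanishing codes. The generous bound `r + r` covers the differences. -/
theorem Admissible.volume_tailCodes (h : Admissible r σ) {s : Set ℤ} {c : ℤ → ℕ}
    (hc : ∀ n, c n ≤ r) (hs : volume (vanishingCodes r σ (r + r) s) = 0) :
    volume (tailCodes r σ s c) = 0 := by
  refine measure_mono_null (t := (fun x => x - code r σ c) ⁻¹' vanishingCodes r σ (r + r) s) ?_ ?_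
  · rintro _ ⟨a, ⟨ha, hac⟩, rfl⟩
    refine ⟨(fun n => (a n : ℤ)) - fun n => (c n : ℤ), ⟨fun n => ?_, fun n hn => ?_⟩, ?_⟩
    · have h1 := ha n
      have h2 := hc n
      simp only [Pi.sub_apply, abs_le]
      push_cast
      lia
    · simp [hac n hn]
    · exact h.torusCode_sub (cast_mem_boundedSeq ha) (cast_mem_boundedSeq hc)
  · simp only [sub_eq_add_neg, measure_preimage_add_right, hs]

variable (r σ) in
/-- The codes of sequences with an exceptional tail. -/
noncomputable def exceptionalSet : Set Torus :=
  ⋃ N : ℤ, tailCodes r σ (Set.Ioi N) 0 ∪ (tailCodes r σ (Set.Iio N) 0 ∪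
    ⋃ p : ℤ, tailCodes r σ (Set.Iio N) (alternating r p))

theorem Admissible.volume_image_exceptionalSet (h : Admissible r σ)
    {A : Matrix (Fin 2) (Fin 2) ℤ} (hA : A.det ≠ 0) :
    volume (toralMap A '' exceptionalSet r σ) = 0 := by
  have halt : ∀ p n, alternating r p n ≤ r := fun p n => by
    unfold alternating
    split_ifs <;> simp
  simp only [exceptionalSet, Set.image_iUnion, Set.image_union, measure_iUnion_null_iff,
    measure_union_null_iff]
  exact fun N => ⟨volume_image_toralMap hA (h.isCompact_tailCodes _ _)
      (h.volume_tailCodes (by simp) (h.volume_vanishingCodes_Ioi _ N)),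
    volume_image_toralMap hA (h.isCompact_tailCodes _ _)
      (h.volume_tailCodes (by simp) (h.volume_vanishingCodes_Iio _ N)),
    fun p => volume_image_toralMap hA (h.isCompact_tailCodes _ _)
      (h.volume_tailCodes (halt p) (h.volume_vanishingCodes_Iio _ N))⟩

theorem Admissible.code_mem_exceptionalSet (h : Admissible r σ) {a b : ℤ → ℕ}
    (ha : a ∈ compactum r σ) (hb : b ∈ compactum r σ) (hab : code r σ a = code r σ b)
    (hne : a ≠ b) : code r σ a ∈ exceptionalSet r σ := by
  obtain ⟨x, hx, N, hN⟩ := h.tail_of_code_eq ha hb hab hne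
  have hxa : code r σ x = code r σ a := by
    rcases hx with rfl | rfl
    exacts [rfl, hab.symm]
  have hxr : ∀ n, x n ≤ r := by
    rcases hx with rfl | rfl
    exacts [h.le_of_mem ha, h.le_of_mem hb]
  rw [← hxa]
  refine Set.mem_iUnion.2 ⟨N, ?_⟩
  rcases hN with hN | hN | ⟨p, hN⟩
  · exact .inl ⟨x, ⟨hxr, hN⟩, rfl⟩
  · exact .inr (.inl ⟨x, ⟨hxr, hN⟩, rfl⟩)
  · exact .inr (.inr (Set.mem_iUnion.2 ⟨p, x, ⟨hxr, hN⟩, rfl⟩))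

/-- Off a null set, the coding is exactly as many-to-one as the toral endomorphism. -/
theorem Admissible.ncard_code_fibre (h : Admissible r σ) {A : Matrix (Fin 2) (Fin 2) ℤ}
    (hA : A.det ≠ 0) {x : Torus} (hx : x ∉ toralMap A '' exceptionalSet r σ) :
    {a ∈ compactum r σ | toralMap A (code r σ a) = x}.ncard = toralDegree A := by
  rw [← ncard_fibre_toralMap hA x, ← Set.InjOn.ncard_image (f := code r σ)]
  · congr 1
    ext y
    constructor
    · rintro ⟨a, ⟨-, ha⟩, rfl⟩
      exact ha
    · intro hy
      obtain ⟨a, ha, rfl⟩ := h.code_surjOn y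
      exact ⟨a, ⟨ha, hy⟩, rfl⟩
  · rintro a ⟨ha, hax⟩ b ⟨hb, -⟩ hab
    by_contra hne
    exact hx ⟨_, h.code_mem_exceptionalSet ha hb hab hne, hax⟩

/-- Haar measures on the glued space are mapped to measures on the torus that are absolutely
continuous with respect to Lebesgue measure. -/
theorem IsNormalizationGroup.map_absolutelyContinuous (h : Admissible r σ)
    {G : AddCommGroup (GluedSpace r σ)} (hG : IsNormalizationGroup r σ G)
    (μ : Measure (GluedSpace r σ)) (hμ : μ.IsAddHaarMeasure) :
    Measure.map (gluedHomeo h) μ ≪ volume := by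
  have := hG.isTopologicalAddGroup
  have : (Measure.map (gluedHomeo h) μ).IsAddHaarMeasure :=
    AddEquiv.isAddHaarMeasure_map μ (AddEquiv.mk' (gluedHomeo h).toEquiv (hG.gluedHomeo_add h))
      (gluedHomeo h).continuous (gluedHomeo h).symm.continuous
  exact Measure.absolutelyContinuous_isAddHaarMeasure _ _

end TailSets
end ArithCoding

/-! ### Assembly of the three claims. -/

open ArithCoding MeasureTheory in
theorem proposition1p4 (r : ℕ) (σ : ℤ) (hr : (σ = -1 ∧ 1 ≤ r) ∨ (σ = 1 ∧ 3 ≤ r)) :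
    CompactSpace (GluedSpace r σ) ∧ T2Space (GluedSpace r σ) ∧
    (∃! G : AddCommGroup (GluedSpace r σ), IsNormalizationGroup r σ G) ∧
    ∀ G : AddCommGroup (GluedSpace r σ), IsNormalizationGroup r σ G →
      ∀ M : Matrix (Fin 2) (Fin 2) ℤ, M.trace = (r : ℤ) → M.det = σ →
      ∀ φ : (ℤ → ℕ) → Torus, IsCodingMap M (dominantRoot r σ) φ →
        ∃ φ' : GluedSpace r σ →+ Torus,
          Continuous φ' ∧ (∀ a : compactum r σ, φ' (proj r σ a) = φ a) ∧
          ((∃ a ∈ compactum r σ, φ a ≠ 0) →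
            Function.Surjective φ' ∧
            ∃ K : ℕ, 0 < K ∧
              (∀ x : Torus, {p : GluedSpace r σ | φ' p = x}.ncard = K) ∧
              (∀ μ : Measure (GluedSpace r σ), μ.IsAddHaarMeasure →
                ∀ᵐ p ∂μ, {a ∈ compactum r σ | φ a = φ' p}.ncard = K) ∧
              ∀ᵐ x : Torus, {a ∈ compactum r σ | φ a = x}.ncard = K) := by
  have h : Admissible r σ := hr
  refine ⟨h.compactSpace, h.t2Space, h.existsUnique_group, fun G hG M ht hd φ hφ => ?_⟩
  obtain ⟨A, hA⟩ := hφ.exists_eq_toralMap h ht hd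
  have hφA : ∀ a ∈ compactum r σ, φ a = toralMap A (code r σ a) := fun a ha =>
    hA r a (h.le_of_mem ha)
  refine ⟨(toralHom A).comp (AddMonoidHom.mk' (gluedHomeo h) (hG.gluedHomeo_add h)),
    (continuous_toralMap A).comp (gluedHomeo h).continuous, fun a => (hφA a a.2).symm,
    fun hne => ?_⟩
  have hdet := hφ.det_ne_zero h hA hne
  -- The image under `A` is the relevant set: the count over `x` can fail only if some preimage of
  -- `x` under `A` is exceptional.
  have hnull := h.volume_image_exceptionalSet hdet
  have hcount : ∀ x ∉ toralMap A '' exceptionalSet r σ,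
      {a ∈ compactum r σ | φ a = x}.ncard = toralDegree A := fun x hx => by
    rw [← h.ncard_code_fibre hdet hx]
    congr 1
    ext a
    exact and_congr_right fun ha => by rw [hφA a ha]
  refine ⟨(toralMap_surjective hdet).comp (gluedHomeo h).surjective, toralDegree A,
    toralDegree_pos hdet, fun x => ?_, fun μ hμ => ?_, ?_⟩
  · rw [← ncard_fibre_toralMap hdet x]
    exact Set.ncard_preimage_of_injective_subset_range (s := {y | toralMap A y = x})
      (gluedHomeo h).injective
      fun y _ => (gluedHomeo h).surjective y
  -- The bad set is pulled back first along `A`, which preserves measure, and then along the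
  -- homeomorphism, which carries `μ` to a measure absolutely continuous with respect to `volume`.
  · have h1 : ∀ᵐ y : Torus, toralMap A y ∉ toralMap A '' exceptionalSet r σ :=
      (measurePreserving_toralMap hdet).quasiMeasurePreserving.ae
        (measure_eq_zero_iff_ae_notMem.1 hnull)
    have h2 := (hG.map_absolutelyContinuous h μ hμ).ae_le h1
    filter_upwards [ae_of_ae_map (gluedHomeo h).continuous.aemeasurable h2] with p hp
    exact hcount _ hp
  · filter_upwards [measure_eq_zero_iff_ae_notMem.1 hnull] with x hx
    exact hcount x hx
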